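/- **Setting.** Let $p\ge 1$, $u\in\mathbb R^p\setminus\{0\}$, $\alpha\in(0,1)$. We observe i.i.d. copies $(X_i,Y_i)_{i=1}^n$ of $(X,Y)$, where $Y=X'\beta_0+\varepsilon$. The parameter is $\theta=(\beta_0,P_{X,\varepsilon})$; it ranges over the set $\Theta$ of all pairs with $\beta_0\in\mathbb R^p$ and $P_{X,\varepsilon}$ a probability distribution on $\mathbb R^{p+1}$ such that $\mathbb E[X\varepsilon]=0$, $\mathbb E\|X\|^4<\infty$, $\lambda_{\min}(\mathbb E[XX'])>0$, $\lambda_{\min}(\mathbb E[XX'\varepsilon^2])>0$ and $\lambda_{\max}(\mathbb E[XX'\varepsilon^2])<\infty$. Vectors carry the Euclidean norm and matrices the spectral norm; $\dagger$ is the Moore–Penrose pseudo-inverse; $\Phi,\varphi,q$ are the c.d.f., density and quantile function of $\mathcal N(0,1)$. Put $\widetilde X=\mathbb E[XX']^{-1/2}X$ and $\xi=u'\,\mathbb E[XX']^{-1}X\varepsilon$. **Classes.** Fix positive constants $\lambda_{\rm reg},K_{\rm reg},K_\varepsilon,K_\xi,\lambda_\varepsilon,K_X$ and $\rho\in[0,\infty)$.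 Let $\Theta_{\rm EE}$ be the set of $\theta\in\Theta$ with $$\lambda_{\min}(\mathbb E[XX'])\ge\lambda_{\rm reg},\quad \mathbb E\|\mathrm{vec}(\widetilde X\widetilde X'-\mathbb I_p)\|^2\le K_{\rm reg},\quad \mathbb E\|\widetilde X\varepsilon\|^4\le K_\varepsilon,\quad \mathbb E[\xi^4]/\mathbb E[\xi^2]^2\le K_\xi ,$$ and let $\Theta_{\rm EE}^{\rm strict}$ be the set of $\theta\in\Theta_{\rm EE}$ with $\lambda_{\min}(\mathbb E[XX'\varepsilon^2])\ge\lambda_\varepsilon$ and $\mathbb E\|X\|^{4(1+\rho)}\le K_X$. **Distances to normality.** For $\theta\in\Theta_{\rm EE}$ let $\sigma^2=\mathbb V[\xi]$, $\lambda_3=\mathbb E[(\xi-\mathbb E\xi)^3]/\sigma^3$, $S_n=\sum_{i=1}^n(\xi_i-\mathbb E\xi)/(\sigma\sqrt n)$ with $\xi_i$ i.i.d. copies of $\xi$, and $$\Delta_{n,\rm B}(\theta)=\sup_{x\in\mathbb R}|\mathbb P_\theta(S_n\le x)-\Phi(x)|,\qquad \Delta_{n,\rm E}(\theta)=\sup_{x\in\mathbb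 R}\Big|\mathbb P_\theta(S_n\le x)-\Phi(x)-\tfrac{\lambda_3}{6\sqrt n}(1-x^2)\varphi(x)\Big|.$$ **Interval.** Let $S=\frac1n\sum_i X_iX_i'$, $\widehat\beta=S^\dagger\frac1n\sum_iX_iY_i$, $\widehat\varepsilon_i=Y_i-X_i'\widehat\beta$, $\widehat V=S^\dagger\big(\frac1n\sum_iX_iX_i'\widehat\varepsilon_i^{\,2}\big)S^\dagger$. For $\gamma>0$ put $\widetilde\gamma=\sqrt{K_{\rm reg}/(n\gamma)}$, $$R_{n,\rm lin}(\gamma)=\sqrt2\,\|u\|\,\lambda_{\rm reg}^{-1/2}\frac{\widetilde\gamma}{1-\widetilde\gamma}\Big(\frac{K_\varepsilon}{\gamma}\Big)^{1/4},$$ $$\begin{aligned}R_{n,\rm var}(\gamma)={}&\frac{2}{n\lambda_{\rm reg}^3}\Big(\frac{\widetilde\gamma}{1-\widetilde\gamma}+1\Big)^2\sqrt{\frac{K_\varepsilon}{\gamma}}\;\frac1n\sum_i\|X_i\|^4+\frac{2\sqrt2}{\lambda_{\rm reg}^{5/2}\sqrt n}\Big(\frac{\widetilde\gamma}{1-\widetilde\gamma}+1\Big)\Big(\frac{K_\varepsilon}{\gamma}\Big)^{1/4}\frac1n\sum_i\|X_i\|^3|\widehat\varepsilon_i|\\&+\frac{K_{\rm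 reg}/(n\gamma)}{\lambda_{\rm reg}^2(1-\widetilde\gamma)^2}\,\frac1n\sum_i\|X_i\widehat\varepsilon_i\|^2+\frac{2\widetilde\gamma}{\lambda_{\rm reg}(1-\widetilde\gamma)}\Big\|\frac1n\sum_iX_iX_i'S^\dagger\widehat\varepsilon_i^{\,2}\Big\|.\end{aligned}$$ For sequences $a_n\in(1,\infty)$, $\omega_n\in(0,1)$, $\delta_n\in\mathbb R$ ($n\ge1$) put $$\nu_n^{\rm Edg}=\tfrac12\Big(\omega_n\alpha+\exp\!\big(-n(1-1/a_n)^2/(2K_\xi)\big)\Big)+\delta_n,\qquad D_n=u'\widehat Vu+\|u\|^2R_{n,\rm var}(\omega_n\alpha/2),$$ and let $n_0$ be the largest $n\ge1$ such that $n\le2K_{\rm reg}/(\omega_n\alpha)$ or $\nu_n^{\rm Edg}\ge\alpha/2$ ($n_0=0$ if there is none). Define $\mathrm{CI}_u^{\rm Edg}(1-\alpha,n)=\mathbb R$ if $n\le n_0$, and otherwise $$\mathrm{CI}_u^{\rm Edg}(1-\alpha,n)=\Big[u'\widehat\beta\pm\frac{1}{\sqrt n}\Big(\sqrt{a_n}\,q\big(1-\tfrac\alpha2+\nu_n^{\rm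 Edg}\big)\sqrt{D_n}+R_{n,\rm lin}(\omega_n\alpha/2)\Big)\Big].$$ **Proposition.** Assume that $\delta_n\ge\sup_{\theta\in\Theta_{\rm EE}}\min\{\Delta_{n,\rm E}(\theta),\Delta_{n,\rm B}(\theta)\}$ for every $n\ge1$, $\delta_n\to0$, $\omega_n\to0$, $\omega_nn^{2/3}\to\infty$, $a_n-1\to0$ and $(a_n-1)\sqrt n\to\infty$. Then $\mathrm{CI}_u^{\rm Edg}(1-\alpha,n)$ is a confidence set for $u'\beta_0$ (its values are Borel sets and, for every $n\ge1$ and $\theta\in\Theta$, the event $\{u'\beta_0\in\mathrm{CI}_u^{\rm Edg}(1-\alpha,n)\}$ is measurable), and it is asymptotically exact uniformly over $\Theta_{\rm EE}^{\rm strict}$ at level $1-\alpha$: $$\lim_{n\to\infty}\ \sup_{\theta\in\Theta_{\rm EE}^{\rm strict}}\Big|\mathbb P_\theta\big(u'\beta_0\in\mathrm{CI}_u^{\rm Edg}(1-\alpha,n)\big)-(1-\alpha)\Big|=0 .$$ It is also non-asymptotically valid over $\Theta_{\rm EE}^{\rm strict}$: $\mathbb P_\theta\big(u'\beta_0\in\mathrm{CI}_u^{\rm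 Edg}(1-\alpha,n)\big)\ge1-\alpha$ for all $n\ge1$ and $\theta\in\Theta_{\rm EE}^{\rm strict}$. Hence it is NAVAE (non-asymptotically valid and asymptotically exact uniformly) over $\Theta_{\rm EE}^{\rm strict}$ at level $1-\alpha$. -/

import Mathlib

open MeasureTheory ProbabilityTheory Filter Topology
open scoped ENNReal

noncomputable section

namespace NAVAE

/-! ### Confidence sets and their quality measures -/

section ConfidenceSets

variable {𝒳 𝒯 : Type*} [MeasurableSpace 𝒳]

/-- A sequence (in the sample size `n`) of confidence sets at one fixed nominal level: for each
`n`, a map from samples of size `n` to subsets of `ℝ`. -/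
abbrev ConfidenceSeq (𝒳 : Type*) := ∀ n : ℕ, (Fin n → 𝒳) → Set ℝ

/-- Measurability built into the notion of a confidence set for the functional `T` over the
parameter set `Θ`: values are Borel sets, and coverage events are measurable. -/
def IsConfidenceSeq (CS : ConfidenceSeq 𝒳) (T : 𝒯 → ℝ) (Θ : Set 𝒯) : Prop :=
  (∀ n s, MeasurableSet (CS n s)) ∧
    ∀ n, 1 ≤ n → ∀ θ ∈ Θ, MeasurableSet {s : Fin n → 𝒳 | T θ ∈ CS n s}

/-- Coverage probability of the value `t` when the `n` observations are i.i.d. with law `P`. -/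
def coverage (CS : ConfidenceSeq 𝒳) (P : Measure 𝒳) (n : ℕ) (t : ℝ) : ℝ :=
  (Measure.pi fun _ : Fin n => P).real {s | t ∈ CS n s}

/-- Non-asymptotic validity over `Θ` at level `1 - α`. -/
def NonAsymptoticallyValid (CS : ConfidenceSeq 𝒳) (law : 𝒯 → Measure 𝒳) (T : 𝒯 → ℝ)
    (Θ : Set 𝒯) (α : ℝ) : Prop :=
  ∀ n, 1 ≤ n → ∀ θ ∈ Θ, 1 - α ≤ coverage CS (law θ) n (T θ)

/-- Asymptotic exactness, uniformly over `Θ`, at level `1 - α`. The supremum is taken in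
`[0, ∞]`. -/
def AsymptoticallyExactUniformly (CS : ConfidenceSeq 𝒳) (law : 𝒯 → Measure 𝒳) (T : 𝒯 → ℝ)
    (Θ : Set 𝒯) (α : ℝ) : Prop :=
  Tendsto (fun n => ⨆ θ ∈ Θ, ENNReal.ofReal |coverage CS (law θ) n (T θ) - (1 - α)|)
    atTop (𝓝 0)

end ConfidenceSets

/-! ### Distance to normality of a standardized sum -/

section Normality

/-- Standard deviation of a distribution on the line. -/
def stdDev (ν : Measure ℝ) : ℝ := √(Var[fun x => x; ν])

/-- Standardized third moment. -/
def skewness (ν : Measure ℝ) : ℝ := ∫ x, ((x - ∫ y, y ∂ν) / stdDev ν) ^ 3 ∂ν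

/-- The standardized sum `∑ᵢ (xᵢ - E[ξ]) / (σ √n)` where `ν` is the law of `ξ`. -/
def stdSum (ν : Measure ℝ) (n : ℕ) (x : Fin n → ℝ) : ℝ :=
  (∑ i, (x i - ∫ y, y ∂ν)) / (stdDev ν * √n)

/-- Distribution function at `t` of the standardized sum of `n` i.i.d. variables of law `ν`. -/
def stdSumCDF (ν : Measure ℝ) (n : ℕ) (t : ℝ) : ℝ :=
  (Measure.pi fun _ : Fin n => ν).real {x | stdSum ν n x ≤ t}

/-- The standard normal distribution function. -/
def gaussCDF (t : ℝ) : ℝ := cdf (gaussianReal 0 1) t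

/-- The quantile function of the standard normal distribution. -/
def gaussQuantile (τ : ℝ) : ℝ := sInf {x | τ ≤ gaussCDF x}

/-- Uniform distance in the central limit theorem (Berry-Esseen). -/
def deltaB (ν : Measure ℝ) (n : ℕ) : ℝ := ⨆ t : ℝ, |stdSumCDF ν n t - gaussCDF t|

/-- Uniform distance to the first-order Edgeworth expansion. -/
def deltaE (ν : Measure ℝ) (n : ℕ) : ℝ :=
  ⨆ t : ℝ, |stdSumCDF ν n t - gaussCDF t
    - skewness ν / (6 * √n) * (1 - t ^ 2) * gaussianPDFReal 0 1 t|

end Normality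

/-! ### Matrices -/

section Matrices

/-- Column vectors, with the Euclidean norm. -/
abbrev Vec (p : ℕ) := EuclideanSpace ℝ (Fin p)

abbrev Mat (p : ℕ) := Matrix (Fin p) (Fin p) ℝ

variable {p : ℕ}

/-- The matrix-vector product `M x`. -/
def act (M : Mat p) (x : Vec p) : Vec p := Matrix.toEuclideanCLM (𝕜 := ℝ) M x

/-- The spectral norm of a matrix. -/
def specNorm (M : Mat p) : ℝ := ‖Matrix.toEuclideanCLM (𝕜 := ℝ) M‖

/-- The smallest real eigenvalue; used for symmetric matrices of positive size. -/
def lambdaMin (M : Mat p) : ℝ := sInf (spectrum ℝ M)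

/-- The rank-one matrix `x x'`. -/
def outer (x : Vec p) : Mat p := Matrix.vecMulVec x.ofLp x.ofLp

/-- `M ^ (-1/2)` for a symmetric positive definite matrix `M`. -/
def invSqrt (M : Mat p) : Mat p := cfc (fun t : ℝ => t ^ (-(1 / 2) : ℝ)) M

/-- The four Penrose equations: `B` is the Moore-Penrose pseudo-inverse of `A`. -/
structure IsMoorePenrose (A B : Mat p) : Prop where
  mul_mul_left : A * B * A = A
  mul_mul_right : B * A * B = B
  symm_left : (A * B).transpose = A * B
  symm_right : (B * A).transpose = B * A

theorem IsMoorePenrose.unique {A B C : Mat p} (hB : IsMoorePenrose A B)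
    (hC : IsMoorePenrose A C) : B = C := by
  have h1 : A * B = A * C := by
    calc A * B = (A * B).transpose := hB.symm_left.symm
      _ = ((A * C * A) * B).transpose := by rw [hC.mul_mul_left]
      _ = (A * B).transpose * (A * C).transpose := by
          rw [← Matrix.transpose_mul, Matrix.mul_assoc (A * C)]
      _ = A * B * (A * C) := by rw [hB.symm_left, hC.symm_left]
      _ = A * B * A * C := by rw [Matrix.mul_assoc (A * B)]
      _ = A * C := by rw [hB.mul_mul_left]
  have h2 : B * A = C * A := by
    calc B * A = (B * A).transpose := hB.symm_right.symm
      _ = (B * (A * C * A)).transpose := by rw [hC.mul_mul_left]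
      _ = (C * A).transpose * (B * A).transpose := by
          rw [← Matrix.transpose_mul, Matrix.mul_assoc A C A, ← Matrix.mul_assoc B]
      _ = C * A * (B * A) := by rw [hB.symm_right, hC.symm_right]
      _ = C * (A * B * A) := by simp only [Matrix.mul_assoc]
      _ = C * A := by rw [hB.mul_mul_left]
  calc B = B * A * B := hB.mul_mul_right.symm
    _ = C * (A * B) := by rw [h2, Matrix.mul_assoc]
    _ = C * A * C := by rw [h1, Matrix.mul_assoc]
    _ = C := hC.mul_mul_right

theorem isMoorePenrose_cfc {H : Mat p} (hH : H.IsHermitian) :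
    IsMoorePenrose H (cfc (fun t : ℝ => t⁻¹) H) := by
  have hs : IsSelfAdjoint H := hH
  have hc : ∀ f : ℝ → ℝ, ContinuousOn f (spectrum ℝ H) := fun f =>
    (Matrix.finite_real_spectrum (A := H)).continuousOn f
  have hid : cfc (fun t : ℝ => t) H = H := cfc_id' ℝ H
  have hm1 : H * cfc (fun t : ℝ => t⁻¹) H = cfc (fun t : ℝ => t * t⁻¹) H := by
    rw [cfc_mul _ _ H (hc _) (hc _), hid]
  have hm2 : cfc (fun t : ℝ => t⁻¹) H * H = cfc (fun t : ℝ => t⁻¹ * t) H := by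
    rw [cfc_mul _ _ H (hc _) (hc _), hid]
  have hsymm : ∀ f : ℝ → ℝ, (cfc f H).transpose = cfc f H := fun f =>
    (IsSelfAdjoint.cfc (f := f) (a := H) : IsSelfAdjoint (cfc f H))
  have e1 : cfc (fun t : ℝ => t * t⁻¹) H * H = cfc (fun t : ℝ => t * t⁻¹ * t) H := by
    rw [cfc_mul (fun t : ℝ => t * t⁻¹) (fun t => t) H (hc _) (hc _), hid]
  have e2 : cfc (fun t : ℝ => t⁻¹ * t) H * cfc (fun t : ℝ => t⁻¹) H
      = cfc (fun t : ℝ => t⁻¹ * t * t⁻¹) H := by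
    rw [cfc_mul (fun t : ℝ => t⁻¹ * t) (fun t => t⁻¹) H (hc _) (hc _)]
  refine ⟨?_, ?_, ?_, ?_⟩
  · rw [hm1, e1]
    simp only [mul_inv_mul_cancel]
    exact hid
  · rw [hm2, e2]
    congr 1
    funext t
    by_cases ht : t = 0 <;> simp [ht]
  · rw [hm1, hsymm]
  · rw [hm2, hsymm]

theorem exists_isMoorePenrose (A : Mat p) : ∃ B, IsMoorePenrose A B := by
  have hH : (A.transpose * A).IsHermitian := by
    have := Matrix.isHermitian_conjTranspose_mul_self A
    rwa [Matrix.conjTranspose_eq_transpose_of_trivial] at this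
  have hG := isMoorePenrose_cfc hH
  have hGs : (cfc (fun t : ℝ => t⁻¹) (A.transpose * A)).transpose
      = cfc (fun t : ℝ => t⁻¹) (A.transpose * A) :=
    (IsSelfAdjoint.cfc (f := fun t : ℝ => t⁻¹) (a := A.transpose * A) :
      IsSelfAdjoint (cfc (fun t : ℝ => t⁻¹) (A.transpose * A)))
  generalize cfc (fun t : ℝ => t⁻¹) (A.transpose * A) = G at hG hGs
  have key : A * (G * (A.transpose * A)) = A := by
    have h0 : (A * (G * (A.transpose * A)) - A).transpose * (A * (G * (A.transpose * A)) - A)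
        = 0 := by
      have h := hG.mul_mul_left
      have e : A.transpose * (A * (G * (A.transpose * A)) - A) = 0 := by
        rw [Matrix.mul_sub, ← Matrix.mul_assoc, ← Matrix.mul_assoc, h, sub_self]
      have e' : (A * (G * (A.transpose * A)) - A).transpose
          = (G * (A.transpose * A) - 1).transpose * A.transpose := by
        rw [← Matrix.transpose_mul, Matrix.mul_sub, Matrix.mul_one]
      rw [e', Matrix.mul_assoc, e, Matrix.mul_zero]
    have h1 := (Matrix.conjTranspose_mul_self_eq_zero
      (A := A * (G * (A.transpose * A)) - A)).1
      (by rw [Matrix.conjTranspose_eq_transpose_of_trivial]; exact h0)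
    exact sub_eq_zero.1 h1
  refine ⟨G * A.transpose, ?_, ?_, ?_, ?_⟩
  · simpa only [Matrix.mul_assoc] using key
  · have := congrArg (· * A.transpose) hG.mul_mul_right
    simpa only [Matrix.mul_assoc] using this
  · simp only [Matrix.transpose_mul, Matrix.transpose_transpose, hGs, Matrix.mul_assoc]
  · have := hG.symm_right
    simpa only [Matrix.mul_assoc] using this

/-- The Moore-Penrose pseudo-inverse of a square real matrix. -/
def pinv (A : Mat p) : Mat p := Classical.choose (exists_isMoorePenrose A)

theorem pinv_spec (A : Mat p) : IsMoorePenrose A (pinv A) :=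
  Classical.choose_spec (exists_isMoorePenrose A)

end Matrices

/-! ### The linear model -/

section Model

variable {p : ℕ}

/-- A parameter `θ = (β₀, P)`, with `P` the joint law of `(X, ε)` on `ℝ^p × ℝ`. -/
abbrev Param (p : ℕ) := Vec p × ProbabilityMeasure (Vec p × ℝ)

/-- The joint law of `(X, ε)`. -/
def errLaw (θ : Param p) : Measure (Vec p × ℝ) := (θ.2 : Measure (Vec p × ℝ))

/-- The law `P_θ` of an observation `(X, Y)`, where `Y = X' β₀ + ε`. -/
def obsLaw (θ : Param p) : Measure (Vec p × ℝ) :=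
  (errLaw θ).map fun z => (z.1, inner ℝ z.1 θ.1 + z.2)

/-- The matrix `E[XX']`. -/
def momXX (θ : Param p) : Mat p := Matrix.of fun i j => ∫ z, outer z.1 i j ∂errLaw θ

/-- The matrix `E[XX' ε²]`. -/
def momXXee (θ : Param p) : Mat p :=
  Matrix.of fun i j => ∫ z, z.2 ^ 2 * outer z.1 i j ∂errLaw θ

/-- The parameter set `Θ` of the linear model. Since `E[XX' ε²]` is positive semidefinite with
trace `E[‖Xε‖²]`, its largest eigenvalue is finite exactly when `E[‖Xε‖²]` is; this is the
second condition. -/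
def linearModel (p : ℕ) : Set (Param p) :=
  {θ | Integrable (fun z => ‖z.1‖ ^ 4) (errLaw θ) ∧
    Integrable (fun z => ‖z.2 • z.1‖ ^ 2) (errLaw θ) ∧
    ∫ z, z.2 • z.1 ∂errLaw θ = 0 ∧
    0 < lambdaMin (momXX θ) ∧
    0 < lambdaMin (momXXee θ)}

/-- The target `u' β₀`. -/
def target (u : Vec p) (θ : Param p) : ℝ := inner ℝ u θ.1

/-- The rotated regressor `E[XX']^(-1/2) x`. -/
def rotated (θ : Param p) (x : Vec p) : Vec p := act (invSqrt (momXX θ)) x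

/-- The influence function `ξ = u' E[XX']⁻¹ X ε`. -/
def infl (u : Vec p) (θ : Param p) (z : Vec p × ℝ) : ℝ := inner ℝ u (act (momXX θ)⁻¹ z.1) * z.2

/-- The law of `ξ` under `θ`. -/
def inflLaw (u : Vec p) (θ : Param p) : Measure ℝ := (errLaw θ).map (infl u θ)

/-- The known bounds on the data-generating process. -/
structure Bounds where
  lamReg : ℝ
  Kreg : ℝ
  Keps : ℝ
  Kxi : ℝ

/-- All four bounds are positive. -/
def Bounds.Pos (c : Bounds) : Prop := 0 < c.lamReg ∧ 0 < c.Kreg ∧ 0 < c.Keps ∧ 0 < c.Kxi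

/-- The parameter set `Θ_EE`. Each bound on a moment includes that the moment is finite. -/
def thetaEE (u : Vec p) (c : Bounds) : Set (Param p) :=
  {θ | θ ∈ linearModel p ∧
    c.lamReg ≤ lambdaMin (momXX θ) ∧
    (Integrable (fun z => ‖WithLp.toLp 2 (Matrix.vec (outer (rotated θ z.1) - 1))‖ ^ 2)
        (errLaw θ) ∧
      ∫ z, ‖WithLp.toLp 2 (Matrix.vec (outer (rotated θ z.1) - 1))‖ ^ 2 ∂errLaw θ ≤ c.Kreg) ∧
    (Integrable (fun z => ‖z.2 • rotated θ z.1‖ ^ 4) (errLaw θ) ∧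
      ∫ z, ‖z.2 • rotated θ z.1‖ ^ 4 ∂errLaw θ ≤ c.Keps) ∧
    (Integrable (fun z => infl u θ z ^ 4) (errLaw θ) ∧
      (∫ z, infl u θ z ^ 4 ∂errLaw θ) / (∫ z, infl u θ z ^ 2 ∂errLaw θ) ^ 2 ≤ c.Kxi)}

/-- The parameter set `Θ_EE^strict`. -/
def thetaStrict (u : Vec p) (c : Bounds) (lamEps ρ KX : ℝ) : Set (Param p) :=
  {θ | θ ∈ thetaEE u c ∧
    lamEps ≤ lambdaMin (momXXee θ) ∧
    (Integrable (fun z => ‖z.1‖ ^ (4 * (1 + ρ))) (errLaw θ) ∧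
      ∫ z, ‖z.1‖ ^ (4 * (1 + ρ)) ∂errLaw θ ≤ KX)}

end Model

/-! ### The confidence interval -/

section Interval

variable {p n : ℕ}

/-- The matrix `S = n⁻¹ ∑ Xᵢ Xᵢ'`. -/
def gram (s : Fin n → Vec p × ℝ) : Mat p := (n : ℝ)⁻¹ • ∑ i, outer (s i).1

/-- The ordinary least squares estimator. -/
def olsBeta (s : Fin n → Vec p × ℝ) : Vec p :=
  act (pinv (gram s)) ((n : ℝ)⁻¹ • ∑ i, (s i).2 • (s i).1)

/-- The `i`-th residual. -/
def resid (s : Fin n → Vec p × ℝ) (i : Fin n) : ℝ := (s i).2 - inner ℝ (s i).1 (olsBeta s)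

/-- The estimator of the asymptotic variance of the least squares estimator. -/
def Vhat (s : Fin n → Vec p × ℝ) : Mat p :=
  pinv (gram s) * ((n : ℝ)⁻¹ • ∑ i, resid s i ^ 2 • outer (s i).1) * pinv (gram s)

/-- `γ̃ = √(K_reg / (n γ))`. -/
def gammaTilde (c : Bounds) (n : ℕ) (γ : ℝ) : ℝ := √(c.Kreg / (n * γ))

/-- The bound on the linearization error. -/
def Rlin (u : Vec p) (c : Bounds) (n : ℕ) (γ : ℝ) : ℝ :=
  √2 * ‖u‖ * c.lamReg ^ (-(1 / 2) : ℝ) * (gammaTilde c n γ / (1 - gammaTilde c n γ))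
    * (c.Keps / γ) ^ (1 / 4 : ℝ)

/-- The bound on the error of the variance estimator. -/
def Rvar (c : Bounds) (s : Fin n → Vec p × ℝ) (γ : ℝ) : ℝ :=
  2 / (n * c.lamReg ^ 3) * (gammaTilde c n γ / (1 - gammaTilde c n γ) + 1) ^ 2 * √(c.Keps / γ)
      * ((n : ℝ)⁻¹ * ∑ i, ‖(s i).1‖ ^ 4)
    + 2 * √2 / (c.lamReg ^ (5 / 2 : ℝ) * √n)
      * (gammaTilde c n γ / (1 - gammaTilde c n γ) + 1) * (c.Keps / γ) ^ (1 / 4 : ℝ)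
      * ((n : ℝ)⁻¹ * ∑ i, ‖(s i).1‖ ^ 3 * |resid s i|)
    + c.Kreg / (n * γ) / (c.lamReg ^ 2 * (1 - gammaTilde c n γ) ^ 2)
      * ((n : ℝ)⁻¹ * ∑ i, ‖resid s i • (s i).1‖ ^ 2)
    + 2 * gammaTilde c n γ / (c.lamReg * (1 - gammaTilde c n γ))
      * specNorm ((n : ℝ)⁻¹ • ∑ i, resid s i ^ 2 • (outer (s i).1 * pinv (gram s)))

/-- The tuning parameters `a_n`, `ω_n` and the bound `δ_n` (only `n ≥ 1` matters). -/
structure Tuning where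
  a : ℕ → ℝ
  ω : ℕ → ℝ
  δ : ℕ → ℝ

/-- The perturbation `ν_n^Edg` of the order of the Gaussian quantile. -/
def nuEdg (c : Bounds) (t : Tuning) (α : ℝ) (n : ℕ) : ℝ :=
  (t.ω n * α + Real.exp (-(n * (1 - 1 / t.a n) ^ 2 / (2 * c.Kxi)))) / 2 + t.δ n

/-- The largest `m ≥ 1` such that `m ≤ 2 K_reg / (ω_m α)` or `ν_m^Edg ≥ α / 2`; it is `0` if
there is none, and `∞` if there are arbitrarily large ones. -/
def nZero (c : Bounds) (t : Tuning) (α : ℝ) : ℕ∞ :=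
  ⨆ (m : ℕ) (_ : 1 ≤ m ∧ ((m : ℝ) ≤ 2 * c.Kreg / (t.ω m * α) ∨ α / 2 ≤ nuEdg c t α m)), (m : ℕ∞)

/-- The enlarged variance `D = u' V̂ u + ‖u‖² R_var(ω_n α / 2)`. -/
def enlargedVar (u : Vec p) (c : Bounds) (t : Tuning) (α : ℝ) (s : Fin n → Vec p × ℝ) : ℝ :=
  inner ℝ u (act (Vhat s) u) + ‖u‖ ^ 2 * Rvar c s (t.ω n * α / 2)

/-- The half-width `(Q / √n) √D`, where `Q = √a_n q(1 - α / 2 + ν_n^Edg) + R_lin(ω_n α / 2) / √D`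
and `q` is the standard normal quantile function. The product is written in its simplified form
`(√a_n q(1 - α / 2 + ν_n^Edg) √D + R_lin(ω_n α / 2)) / √n`, meaningful also when `D = 0`. -/
def halfWidth (u : Vec p) (c : Bounds) (t : Tuning) (α : ℝ) (s : Fin n → Vec p × ℝ) : ℝ :=
  (√(t.a n) * gaussQuantile (1 - α / 2 + nuEdg c t α n) * √(enlargedVar u c t α s)
    + Rlin u c n (t.ω n * α / 2)) / √n

open scoped Classical in
/-- The confidence interval `CI_u^Edg(1 - α, n)` for `u' β₀`. -/
def ciEdg (u : Vec p) (c : Bounds) (t : Tuning) (α : ℝ) : ConfidenceSeq (Vec p × ℝ) :=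
  fun n s =>
    if (n : ℕ∞) ≤ nZero c t α then Set.univ
    else Set.Icc (inner ℝ u (olsBeta s) - halfWidth u c t α s)
      (inner ℝ u (olsBeta s) + halfWidth u c t α s)

end Interval

end NAVAE

end

open NAVAE

noncomputable section

namespace NAVAE


/-! ### Matrices acting on Euclidean vectors -/

section MatrixLemmas

open scoped Matrix.Norms.L2Operator

variable {p : ℕ}

/-! Write `T = E[XX']^(-1/2)`, `σ² = E[ξ²]` and `γ = ω_n α / 2`. Everything happens on one good
event: the rotated Gram matrix `T S T` is within `γ̃ < 1` of the identity, and the rotated score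
average is at most `√2 (K_ε/γ)^(1/4) / √n`. Markov's inequality with second, respectively fourth,
moments of independent centred sums bounds the failure of each requirement by `γ`, hence of both by
`ω_n α`. On this event a Neumann argument inverts `S`, and deterministic algebra gives `u'(β̂ - β₀)
= mean(ξ) + O(R_lin / √n)` and `|mean(ξ²) - u'V̂u| ≤ ‖u‖² R_var`.

Validity. A Chernoff bound for the nonnegative variables `ξ²` gives `σ² ≤ a_n mean(ξ²)` outside an
event of probability `exp(-n(1-1/a_n)²/(2K_ξ))`, so `√σ² ≤ √a_n √D_n`; then `|S_n| ≤ q` forces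
coverage (`target_mem_ciEdg`). Since the Edgeworth correction is even, it cancels in two-sided
probabilities, and either distance gives `P(|S_n| ≤ q) ≥ 2Φ(q) - 1 - 2δ_n`. The perturbation `ν_n`
is chosen so that `2ν_n` pays exactly for `2δ_n` and the exceptional probabilities. This argument
works on all of `Θ_EE`.

Exactness. Validity is already one half. Conversely, coverage forces `|S_n| ≤ (1+κ)(1+2κ)z + κ`
(`abs_stdSum_le_of_mem_ciEdg`) as soon as both remainders are small relative to `σ` and `mean(ξ²) ≤
(1+κ)σ²`. The strict class serves here: it bounds `σ²` away from zero and the empirical moments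
inside `R_var` in probability, uniformly. The rate `ω_n n^(2/3) → ∞` is what `R_lin → 0` needs,
because `γ̃ γ^(-1/4)` has order `(ω_n n^(2/3))^(-3/4)`; the rate `(a_n - 1)√n → ∞` kills the
exponential term in `ν_n`. -/

theorem specNorm_eq_norm (M : Mat p) : specNorm M = ‖M‖ := rfl

theorem act_mul (M N : Mat p) (x : Vec p) : act (M * N) x = act M (act N x) := by
  simp [act]

@[simp] theorem act_one (x : Vec p) : act (1 : Mat p) x = x := by simp [act]

theorem act_sub (M N : Mat p) (x : Vec p) : act (M - N) x = act M x - act N x := by simp [act]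

theorem act_smul (r : ℝ) (M : Mat p) (x : Vec p) : act (r • M) x = r • act M x := by simp [act]

theorem act_sum {ι : Type*} (s : Finset ι) (M : ι → Mat p) (x : Vec p) :
    act (∑ i ∈ s, M i) x = ∑ i ∈ s, act (M i) x := by simp [act]

theorem act_add_right (M : Mat p) (x y : Vec p) : act M (x + y) = act M x + act M y := by
  simp [act]

theorem act_sub_right (M : Mat p) (x y : Vec p) : act M (x - y) = act M x - act M y := by
  simp [act]

theorem act_smul_right (M : Mat p) (r : ℝ) (x : Vec p) : act M (r • x) = r • act M x := by
  simp [act]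

theorem act_sum_right {ι : Type*} (M : Mat p) (s : Finset ι) (x : ι → Vec p) :
    act M (∑ i ∈ s, x i) = ∑ i ∈ s, act M (x i) := by simp [act]

theorem act_apply (M : Mat p) (x : Vec p) (i : Fin p) : act M x i = ∑ j, M i j * x j := by
  simp [act, Matrix.mulVec, dotProduct]

theorem inner_act (M : Mat p) (x y : Vec p) : inner ℝ (act M x) y = inner ℝ x (act M.transpose y) := by
  simp only [PiLp.inner_apply, act_apply, RCLike.inner_apply, conj_trivial, Finset.mul_sum,
    Finset.sum_mul, Matrix.transpose_apply]
  rw [Finset.sum_comm]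
  exact Finset.sum_congr rfl fun i _ => Finset.sum_congr rfl fun j _ => by ring

theorem inner_act_of_symm {M : Mat p} (hM : M.transpose = M) (x y : Vec p) :
    inner ℝ (act M x) y = inner ℝ x (act M y) := by rw [inner_act, hM]

theorem act_outer (x y : Vec p) : act (outer x) y = (inner ℝ x y : ℝ) • x := by
  ext i
  simp only [act_apply, outer, Matrix.vecMulVec_apply, PiLp.smul_apply, PiLp.inner_apply,
    RCLike.inner_apply, conj_trivial, smul_eq_mul, Finset.sum_mul]
  exact Finset.sum_congr rfl fun j _ => by ring

theorem outer_transpose (x : Vec p) : (outer x).transpose = outer x := by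
  ext i j; simp [outer, Matrix.vecMulVec_apply, mul_comm]

theorem ext_act {M N : Mat p} (h : ∀ x, act M x = act N x) : M = N :=
  (Matrix.toEuclideanCLM (𝕜 := ℝ) (n := Fin p)).injective (ContinuousLinearMap.ext h)

theorem mul_outer_mul {T : Mat p} (hT : T.transpose = T) (x : Vec p) :
    T * outer x * T = outer (act T x) :=
  ext_act fun y => by rw [act_mul, act_mul, act_outer, act_outer, act_smul_right, inner_act_of_symm hT]

theorem norm_act_le (M : Mat p) (x : Vec p) : ‖act M x‖ ≤ ‖M‖ * ‖x‖ :=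
  (Matrix.toEuclideanCLM (𝕜 := ℝ) M).le_opNorm x

theorem norm_le_of_act_le {M : Mat p} {C : ℝ} (hC : 0 ≤ C) (h : ∀ x, ‖act M x‖ ≤ C * ‖x‖) :
    ‖M‖ ≤ C :=
  (Matrix.toEuclideanCLM (𝕜 := ℝ) M).opNorm_le_bound hC h

theorem norm_outer_le (x : Vec p) : ‖outer x‖ ≤ ‖x‖ ^ 2 :=
  norm_le_of_act_le (by positivity) fun y => by
    rw [act_outer, norm_smul, sq]
    nlinarith [abs_real_inner_le_norm x y, norm_nonneg x, Real.norm_eq_abs (inner ℝ x y)]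

/-- Cauchy-Schwarz row by row. Hilbert-space moment computations for vectorized matrices thereby
control spectral norms. -/
theorem norm_le_norm_vec (M : Mat p) : ‖M‖ ≤ ‖WithLp.toLp 2 (Matrix.vec M)‖ :=
  norm_le_of_act_le (norm_nonneg _) fun x => by
    rw [EuclideanSpace.norm_eq, EuclideanSpace.norm_eq, EuclideanSpace.norm_eq,
      ← Real.sqrt_mul (by positivity)]
    apply Real.sqrt_le_sqrt
    simp only [act_apply, Real.norm_eq_abs, sq_abs, Fintype.sum_prod_type, Matrix.vec]
    rw [Finset.sum_comm, Finset.sum_mul]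
    exact Finset.sum_le_sum fun i _ => Finset.sum_mul_sq_le_sq_mul_sq _ _ _

theorem norm_transpose (M : Mat p) : ‖M.transpose‖ = ‖M‖ := by
  rw [← Matrix.conjTranspose_eq_transpose_of_trivial]; exact Matrix.l2_opNorm_conjTranspose M

theorem norm_one_le : ‖(1 : Mat p)‖ ≤ 1 :=
  norm_le_of_act_le zero_le_one fun x => by simp

theorem abs_inner_act_le (M : Mat p) (x : Vec p) : |inner ℝ x (act M x)| ≤ ‖x‖ ^ 2 * ‖M‖ := by
  nlinarith [abs_real_inner_le_norm x (act M x), norm_act_le M x, norm_nonneg x]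

-- The spectrum lies above `l`, so `M - l` is positive semidefinite. Eigenvalue conditions enter the
-- proof only through this quadratic-form inequality and, for invertibility, through positivity of
-- the spectrum.
open scoped MatrixOrder in
theorem le_inner_act_of_le_lambdaMin {M : Mat p} (hM : M.transpose = M) {l : ℝ}
    (h : l ≤ lambdaMin M) (x : Vec p) : l * ‖x‖ ^ 2 ≤ inner ℝ x (act M x) := by
  have hH : IsSelfAdjoint M := by
    rw [isSelfAdjoint_iff, Matrix.star_eq_conjTranspose,
      Matrix.conjTranspose_eq_transpose_of_trivial, hM]
  have h1 : algebraMap ℝ (Mat p) l ≤ M := by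
    rw [algebraMap_le_iff_le_spectrum]
    exact fun t ht => h.trans
      (csInf_le (Matrix.finite_real_spectrum (A := M)).bddBelow ht)
  have h2 := (Matrix.le_iff.1 h1).dotProduct_mulVec_nonneg x.ofLp
  have h3 : (0 : ℝ) ≤ inner ℝ x (act (M - algebraMap ℝ (Mat p) l) x) := by
    have h4 : inner ℝ x (act (M - algebraMap ℝ (Mat p) l) x)
        = star x.ofLp ⬝ᵥ (M - algebraMap ℝ (Mat p) l).mulVec x.ofLp := by
      simp only [PiLp.inner_apply, act_apply, dotProduct, Matrix.mulVec, RCLike.inner_apply,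
        conj_trivial, Pi.star_apply, star_trivial]
      exact Finset.sum_congr rfl fun i _ => mul_comm _ _
    rw [h4]
    exact h2
  rw [act_sub, Algebra.algebraMap_eq_smul_one, act_smul, act_one, inner_sub_right,
    real_inner_smul_right, real_inner_self_eq_norm_sq] at h3
  linarith

/-- `T` is a symmetric inverse square root of `M`. -/
structure IsInvSqrt (M T : Mat p) : Prop where
  symm : T.transpose = T
  conj : T * M * T = 1

theorem isInvSqrt_invSqrt {M : Mat p} (hM : M.transpose = M) (h : 0 < lambdaMin M) :
    IsInvSqrt M (invSqrt M) := by
  have hs : IsSelfAdjoint M := by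
    rw [isSelfAdjoint_iff, Matrix.star_eq_conjTranspose,
      Matrix.conjTranspose_eq_transpose_of_trivial, hM]
  have hc : ∀ f : ℝ → ℝ, ContinuousOn f (spectrum ℝ M) := fun f =>
    (Matrix.finite_real_spectrum (A := M)).continuousOn f
  refine ⟨(IsSelfAdjoint.cfc (f := fun t : ℝ => t ^ (-(1 / 2) : ℝ)) (a := M) :
      IsSelfAdjoint (cfc (fun t : ℝ => t ^ (-(1 / 2) : ℝ)) M)), ?_⟩
  have hid : cfc (fun t : ℝ => t) M = M := cfc_id' ℝ M
  have h1 : invSqrt M * M * invSqrt M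
      = cfc (fun t : ℝ => t ^ (-(1 / 2) : ℝ) * t * t ^ (-(1 / 2) : ℝ)) M := by
    rw [cfc_mul (fun t : ℝ => t ^ (-(1 / 2) : ℝ) * t) _ M (hc _) (hc _),
      cfc_mul _ (fun t : ℝ => t) M (hc _) (hc _), hid]; rfl
  rw [h1, ← cfc_const_one ℝ M]
  -- Only spectral points matter, and these are positive, so the exponents `-1/2 + 1 - 1/2` add to
  -- zero.
  refine cfc_congr fun t ht => ?_
  have ht0 : 0 < t := h.trans_le (csInf_le (Matrix.finite_real_spectrum (A := M)).bddBelow ht)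
  have : t ^ (-(1 / 2) : ℝ) * t * t ^ (-(1 / 2) : ℝ)
      = t ^ (-(1 / 2) : ℝ) * t ^ (1 : ℝ) * t ^ (-(1 / 2) : ℝ) := by rw [Real.rpow_one]
  simp only [this]
  rw [← Real.rpow_add ht0, ← Real.rpow_add ht0]
  norm_num

namespace IsInvSqrt

variable {M T : Mat p} (h : IsInvSqrt M T)
include h

theorem mul_self_mul : T * T * M = 1 := by
  have := h.conj
  rw [mul_eq_one_comm] at this
  rwa [Matrix.mul_assoc]

theorem mul_mul_self : M * (T * T) = 1 := by
  have := h.conj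
  rw [Matrix.mul_assoc, mul_eq_one_comm] at this
  rwa [← Matrix.mul_assoc]

theorem inv_eq : M⁻¹ = T * T := Matrix.inv_eq_left_inv h.mul_self_mul

/-- Evaluate the quadratic form of `M` at `T x`: since `T M T = 1` it equals `‖x‖²`. -/
theorem sq_norm_act_le {l : ℝ} (hl : ∀ x, l * ‖x‖ ^ 2 ≤ inner ℝ x (act M x)) (x : Vec p) :
    l * ‖act T x‖ ^ 2 ≤ ‖x‖ ^ 2 := by
  refine (hl (act T x)).trans_eq ?_
  rw [inner_act_of_symm h.symm, ← act_mul, ← act_mul, h.conj, act_one, real_inner_self_eq_norm_sq]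

theorem norm_le {l : ℝ} (hl0 : 0 < l) (hl : ∀ x, l * ‖x‖ ^ 2 ≤ inner ℝ x (act M x)) :
    ‖T‖ ≤ l ^ (-(1 / 2) : ℝ) := by
  refine norm_le_of_act_le (by positivity) fun x => ?_
  have h1 := h.sq_norm_act_le hl x
  have h2 : (l ^ (-(1 / 2) : ℝ)) ^ 2 = l⁻¹ := by
    rw [← Real.rpow_natCast, ← Real.rpow_mul hl0.le]; norm_num [Real.rpow_neg_one]
  refine abs_le_of_sq_le_sq' ?_ (by positivity) |>.2
  rw [mul_pow, h2, inv_mul_eq_div, le_div_iff₀ hl0]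
  linarith

end IsInvSqrt

/-! ### Pseudo-inverse -/

theorem pinv_eq_of_mul_eq_one {A B : Mat p} (h : A * B = 1) : pinv A = B := by
  have h' : B * A = 1 := mul_eq_one_comm.1 h
  refine (pinv_spec A).unique ⟨?_, ?_, ?_, ?_⟩ <;> simp [h, h']

/-- The pseudo-inverse is not continuous where the rank drops, so measurability comes from the
Lusin-Souslin theorem: the pairs satisfying the Penrose equations form a closed set, on which the
first projection is injective by uniqueness and hence a measurable embedding. Its inverse on the
image is `A ↦ (A, A†)`. -/
theorem measurable_pinv {Ω : Type*} [MeasurableSpace Ω] {A : Ω → Mat p}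
    (hA : ∀ i j, Measurable fun w => A w i j) (i j : Fin p) :
    Measurable fun w => pinv (A w) i j := by
  let _ : MeasurableSpace (Mat p) := MeasurableSpace.pi
  have : BorelSpace (Mat p) := inferInstanceAs (BorelSpace (Fin p → Fin p → ℝ))
  let S : Set (Mat p × Mat p) := {q | IsMoorePenrose q.1 q.2}
  have hS : IsClosed S := by
    have : S = {q | q.1 * q.2 * q.1 = q.1} ∩ {q | q.2 * q.1 * q.2 = q.2}
        ∩ {q | (q.1 * q.2).transpose = q.1 * q.2} ∩ {q | (q.2 * q.1).transpose = q.2 * q.1} := by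
      ext q
      exact ⟨fun h => ⟨⟨⟨h.1, h.2⟩, h.3⟩, h.4⟩, fun h => ⟨h.1.1.1, h.1.1.2, h.1.2, h.2⟩⟩
    rw [this]
    refine ((IsClosed.inter ?_ ?_).inter ?_).inter ?_ <;>
      exact isClosed_eq (by fun_prop) (by fun_prop)
  have : StandardBorelSpace S := hS.measurableSet.standardBorel
  have hm : Measurable fun q : S => q.1.1 := measurable_fst.comp measurable_subtype_coe
  have hinj : Function.Injective fun q : S => q.1.1 := fun q q' h => by
    refine Subtype.ext (Prod.ext h (q.2.unique (?_ : IsMoorePenrose q.1.1 q'.1.2)))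
    have := q'.2
    simp only at h
    rw [h]; exact this
  have he := hm.measurableEmbedding hinj
  have hP : Measurable fun w => (⟨(A w, pinv (A w)), pinv_spec (A w)⟩ : S) := by
    rw [← he.measurable_comp_iff]
    exact measurable_pi_iff.2 fun i => measurable_pi_iff.2 fun j => hA i j
  have h2 : Measurable fun w => pinv (A w) := (measurable_snd.comp measurable_subtype_coe).comp hP
  exact (measurable_pi_apply j).comp ((measurable_pi_apply i).comp h2)

theorem measurable_specNorm {Ω : Type*} [MeasurableSpace Ω] {A : Ω → Mat p}
    (hA : ∀ i j, Measurable fun w => A w i j) : Measurable fun w => specNorm (A w) := by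
  let _ : MeasurableSpace (Mat p) := MeasurableSpace.pi
  have : BorelSpace (Mat p) := inferInstanceAs (BorelSpace (Fin p → Fin p → ℝ))
  have h1 : Measurable A := measurable_pi_iff.2 fun i => measurable_pi_iff.2 fun j => hA i j
  have h2 : Continuous fun M : Mat p => ‖M‖ := continuous_norm
  exact h2.measurable.comp h1

theorem exists_inverse_of_norm_sub_one_le {M : Mat p} {g : ℝ} (hg : ‖M - 1‖ ≤ g) (hg1 : g < 1) :
    ∃ W : Mat p, M * W = 1 ∧ W * M = 1 ∧ ‖W - 1‖ ≤ g / (1 - g) ∧ ‖W‖ ≤ g / (1 - g) + 1 := by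
  have hlt : ‖1 - M‖ < 1 := by rw [norm_sub_rev]; exact hg.trans_lt hg1
  let U := Units.oneSub (1 - M) hlt
  have hU : (U : Mat p) = M := by simp [U]
  have h1 : M * ((U⁻¹ : (Mat p)ˣ) : Mat p) = 1 := by rw [← hU]; exact U.mul_inv
  have h2 : ((U⁻¹ : (Mat p)ˣ) : Mat p) * M = 1 := by rw [← hU]; exact U.inv_mul
  set W : Mat p := ((U⁻¹ : (Mat p)ˣ) : Mat p)
  -- A fixed-point identity for `W - 1`: taking norms gives `‖W - 1‖ ≤ g ‖W - 1‖ + g`, which is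
  -- solved for `‖W - 1‖`.
  have h3 : W - 1 = - ((M - 1) * (W - 1)) - (M - 1) := by
    have : (M - 1) * (W - 1) = M * W - M - W + 1 := by noncomm_ring
    rw [this, h1]; noncomm_ring
  have h4 : ‖W - 1‖ ≤ g * ‖W - 1‖ + g := by
    calc ‖W - 1‖ = ‖- ((M - 1) * (W - 1)) - (M - 1)‖ := by rw [← h3]
      _ ≤ ‖(M - 1) * (W - 1)‖ + ‖M - 1‖ := by
          refine (norm_sub_le _ _).trans_eq ?_
          rw [norm_neg]
      _ ≤ ‖M - 1‖ * ‖W - 1‖ + ‖M - 1‖ := by gcongr; exact norm_mul_le _ _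
      _ ≤ g * ‖W - 1‖ + g := by gcongr
  have h5 : ‖W - 1‖ ≤ g / (1 - g) := by
    rw [le_div_iff₀ (by linarith)]; linarith
  refine ⟨W, h1, h2, h5, ?_⟩
  calc ‖W‖ = ‖(W - 1) + 1‖ := by rw [sub_add_cancel]
    _ ≤ ‖W - 1‖ + ‖(1 : Mat p)‖ := norm_add_le _ _
    _ ≤ _ := add_le_add h5 norm_one_le

end MatrixLemmas


/-! ### Deterministic analysis of least squares -/

section LeastSquares

open scoped Matrix.Norms.L2Operator

variable {p n : ℕ}

/-- The observations `(Xᵢ, Xᵢ' β + εᵢ)` obtained from regressors and errors. -/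
def observe (β : Vec p) (s : Fin n → Vec p × ℝ) : Fin n → Vec p × ℝ :=
  fun i => ((s i).1, inner ℝ (s i).1 β + (s i).2)

theorem gram_observe (β : Vec p) (s : Fin n → Vec p × ℝ) : gram (observe β s) = gram s := rfl

theorem gram_transpose (s : Fin n → Vec p × ℝ) : (gram s).transpose = gram s := by
  simp [gram, Matrix.transpose_sum, outer_transpose]

theorem conj_gram {T : Mat p} (hT : T.transpose = T) (s : Fin n → Vec p × ℝ) :
    T * gram s * T = (n : ℝ)⁻¹ • ∑ i, outer (act T (s i).1) := by
  simp only [gram, Matrix.mul_smul, Matrix.smul_mul, Finset.mul_sum, Finset.sum_mul,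
    mul_outer_mul hT]

/-- The rotated Gram matrix `T S T` is close to the identity and has an inverse `W`; undoing the
rotation makes `T W T` a genuine inverse of `S`. Here `T (W - 1) T` is the error of `S†` as an
estimate of `M⁻¹ = T T`. -/
theorem exists_pinv_gram {M T : Mat p} (hT : IsInvSqrt M T) {s : Fin n → Vec p × ℝ} {g : ℝ}
    (hg1 : g < 1) (hg : ‖(n : ℝ)⁻¹ • ∑ i, outer (act T (s i).1) - 1‖ ≤ g) :
    ∃ W : Mat p, pinv (gram s) = T * W * T ∧ pinv (gram s) * gram s = 1 ∧
      ‖W - 1‖ ≤ g / (1 - g) ∧ ‖W‖ ≤ g / (1 - g) + 1 := by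
  rw [← conj_gram hT.symm] at hg
  obtain ⟨W, h1, -, h3, h4⟩ := exists_inverse_of_norm_sub_one_le hg hg1
  have h5 : gram s * (T * W * T) = 1 := by
    have : T * (gram s * T * W) = 1 := by simpa only [Matrix.mul_assoc] using h1
    have := mul_eq_one_comm.1 this
    simpa only [Matrix.mul_assoc] using this
  have h6 := pinv_eq_of_mul_eq_one h5
  exact ⟨W, h6, by rw [h6]; exact mul_eq_one_comm.1 h5, h3, h4⟩

theorem olsBeta_observe {s : Fin n → Vec p × ℝ} (h : pinv (gram s) * gram s = 1) (β : Vec p) :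
    olsBeta (observe β s)
      = β + act (pinv (gram s)) ((n : ℝ)⁻¹ • ∑ i, (s i).2 • (s i).1) := by
  have h1 : (n : ℝ)⁻¹ • ∑ i, (observe β s i).2 • (observe β s i).1
      = act (gram s) β + (n : ℝ)⁻¹ • ∑ i, (s i).2 • (s i).1 := by
    simp only [observe, add_smul, Finset.sum_add_distrib, smul_add, gram, act_smul, act_sum,
      act_outer]
  rw [olsBeta, gram_observe, h1, act_add_right, ← act_mul, h, act_one]

variable {M T : Mat p} {s : Fin n → Vec p × ℝ} {g z l : ℝ}

/-- The estimation error is `T W v` with `v` the rotated score average: one factor `T` is absorbed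
in `v`, so only `l^(-1/2)` is lost. -/
theorem norm_olsBeta_sub_le (hT : IsInvSqrt M T) (hl0 : 0 < l)
    (hl : ∀ x, l * ‖x‖ ^ 2 ≤ inner ℝ x (act M x)) (hg0 : 0 ≤ g) (hg1 : g < 1)
    (hg : ‖(n : ℝ)⁻¹ • ∑ i, outer (act T (s i).1) - 1‖ ≤ g)
    (hz : ‖(n : ℝ)⁻¹ • ∑ i, (s i).2 • act T (s i).1‖ ≤ z) (β : Vec p) :
    ‖olsBeta (observe β s) - β‖ ≤ l ^ (-(1 / 2) : ℝ) * (g / (1 - g) + 1) * z := by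
  obtain ⟨W, h1, h2, h3, h4⟩ := exists_pinv_gram hT hg1 hg
  have e0 : act T ((n : ℝ)⁻¹ • ∑ i, (s i).2 • (s i).1)
      = (n : ℝ)⁻¹ • ∑ i, (s i).2 • act T (s i).1 := by
    simp only [act_smul_right, act_sum_right]
  rw [olsBeta_observe h2, add_sub_cancel_left, h1, act_mul, act_mul, e0]
  have hn := hT.norm_le hl0 hl
  have h0 : 0 ≤ g / (1 - g) := div_nonneg hg0 (by linarith)
  calc _ ≤ ‖T‖ * (‖W‖ * ‖(n : ℝ)⁻¹ • ∑ i, (s i).2 • act T (s i).1‖) :=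
        (norm_act_le _ _).trans (mul_le_mul_of_nonneg_left (norm_act_le _ _) (norm_nonneg _))
    _ ≤ l ^ (-(1 / 2) : ℝ) * ((g / (1 - g) + 1) * z) := by gcongr
    _ = _ := by ring

theorem abs_linearization_le (hT : IsInvSqrt M T) (hl0 : 0 < l)
    (hl : ∀ x, l * ‖x‖ ^ 2 ≤ inner ℝ x (act M x)) (hg0 : 0 ≤ g) (hg1 : g < 1)
    (hg : ‖(n : ℝ)⁻¹ • ∑ i, outer (act T (s i).1) - 1‖ ≤ g)
    (hz : ‖(n : ℝ)⁻¹ • ∑ i, (s i).2 • act T (s i).1‖ ≤ z) (u β : Vec p) :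
    |inner ℝ u (olsBeta (observe β s) - β)
        - (n : ℝ)⁻¹ * ∑ i, inner ℝ u (act M⁻¹ (s i).1) * (s i).2|
      ≤ ‖u‖ * l ^ (-(1 / 2) : ℝ) * (g / (1 - g)) * z := by
  obtain ⟨W, h1, h2, h3, h4⟩ := exists_pinv_gram hT hg1 hg
  have hn := hT.norm_le hl0 hl
  have h0 : 0 ≤ g / (1 - g) := div_nonneg hg0 (by linarith)
  have e1 : (n : ℝ)⁻¹ * ∑ i, inner ℝ u (act M⁻¹ (s i).1) * (s i).2
      = inner ℝ u (act T ((n : ℝ)⁻¹ • ∑ i, (s i).2 • act T (s i).1)) := by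
    simp only [hT.inv_eq, act_mul, act_smul_right, act_sum_right, real_inner_smul_right,
      inner_sum, mul_comm]
  have e0 : act T ((n : ℝ)⁻¹ • ∑ i, (s i).2 • (s i).1)
      = (n : ℝ)⁻¹ • ∑ i, (s i).2 • act T (s i).1 := by
    simp only [act_smul_right, act_sum_right]
  rw [olsBeta_observe h2, add_sub_cancel_left, e1, h1, act_mul, act_mul, e0, ← inner_sub_right]
  set v := (n : ℝ)⁻¹ • ∑ i, (s i).2 • act T (s i).1
  -- The error is `T W v` and the average of the influence function is `T v`; their difference
  -- carries the small factor `W - 1`.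
  have e2 : act T (act W v) - act T v = act T (act (W - 1) v) := by
    rw [act_sub, act_one, act_sub_right]
  rw [e2]
  calc _ ≤ ‖u‖ * (‖T‖ * (‖W - 1‖ * ‖v‖)) := by
        refine (abs_real_inner_le_norm _ _).trans ?_
        gcongr
        exact (norm_act_le _ _).trans (mul_le_mul_of_nonneg_left (norm_act_le _ _) (norm_nonneg _))
    _ ≤ ‖u‖ * (l ^ (-(1 / 2) : ℝ) * ((g / (1 - g)) * z)) := by gcongr
    _ = _ := by ring

theorem norm_pinv_gram_le (hT : IsInvSqrt M T) (hl0 : 0 < l)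
    (hl : ∀ x, l * ‖x‖ ^ 2 ≤ inner ℝ x (act M x)) (hg0 : 0 ≤ g) (hg1 : g < 1)
    (hg : ‖(n : ℝ)⁻¹ • ∑ i, outer (act T (s i).1) - 1‖ ≤ g) :
    ‖pinv (gram s)‖ ≤ l⁻¹ * (g / (1 - g) + 1) := by
  obtain ⟨W, h1, h2, h3, h4⟩ := exists_pinv_gram hT hg1 hg
  have hn := hT.norm_le hl0 hl
  have h0 : 0 ≤ g / (1 - g) := div_nonneg hg0 (by linarith)
  have hll : l ^ (-(1 / 2) : ℝ) * l ^ (-(1 / 2) : ℝ) = l⁻¹ := by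
    rw [← Real.rpow_add hl0]; norm_num [Real.rpow_neg_one]
  rw [h1]
  calc _ ≤ ‖T‖ * ‖W‖ * ‖T‖ := (norm_mul_le _ _).trans
        (mul_le_mul_of_nonneg_right (norm_mul_le _ _) (norm_nonneg _))
    _ ≤ l ^ (-(1 / 2) : ℝ) * (g / (1 - g) + 1) * l ^ (-(1 / 2) : ℝ) := by gcongr
    _ = _ := by rw [← hll]; ring

theorem norm_inv_sub_pinv_gram_le (hT : IsInvSqrt M T) (hl0 : 0 < l)
    (hl : ∀ x, l * ‖x‖ ^ 2 ≤ inner ℝ x (act M x)) (hg0 : 0 ≤ g) (hg1 : g < 1)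
    (hg : ‖(n : ℝ)⁻¹ • ∑ i, outer (act T (s i).1) - 1‖ ≤ g) :
    ‖M⁻¹ - pinv (gram s)‖ ≤ l⁻¹ * (g / (1 - g)) := by
  obtain ⟨W, h1, h2, h3, h4⟩ := exists_pinv_gram hT hg1 hg
  have hn := hT.norm_le hl0 hl
  have h0 : 0 ≤ g / (1 - g) := div_nonneg hg0 (by linarith)
  have hll : l ^ (-(1 / 2) : ℝ) * l ^ (-(1 / 2) : ℝ) = l⁻¹ := by
    rw [← Real.rpow_add hl0]; norm_num [Real.rpow_neg_one]
  have : M⁻¹ - pinv (gram s) = -(T * (W - 1) * T) := by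
    rw [h1, hT.inv_eq]; noncomm_ring
  rw [this, norm_neg]
  calc _ ≤ ‖T‖ * ‖W - 1‖ * ‖T‖ := (norm_mul_le _ _).trans
        (mul_le_mul_of_nonneg_right (norm_mul_le _ _) (norm_nonneg _))
    _ ≤ l ^ (-(1 / 2) : ℝ) * (g / (1 - g)) * l ^ (-(1 / 2) : ℝ) := by gcongr
    _ = _ := by rw [← hll]; ring

theorem norm_inv_le (hT : IsInvSqrt M T) (hl0 : 0 < l)
    (hl : ∀ x, l * ‖x‖ ^ 2 ≤ inner ℝ x (act M x)) : ‖M⁻¹‖ ≤ l⁻¹ := by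
  have hn := hT.norm_le hl0 hl
  have hll : l ^ (-(1 / 2) : ℝ) * l ^ (-(1 / 2) : ℝ) = l⁻¹ := by
    rw [← Real.rpow_add hl0]; norm_num [Real.rpow_neg_one]
  rw [hT.inv_eq, ← hll]
  exact (norm_mul_le _ _).trans (by gcongr)

theorem pinv_transpose_of_mul_eq_one {A : Mat p} (hA : A.transpose = A) (h : pinv A * A = 1) :
    (pinv A).transpose = pinv A := by
  have h' := mul_eq_one_comm.1 h
  have : (pinv A).transpose * A = 1 := by
    rw [← Matrix.transpose_one, ← h', Matrix.transpose_mul, hA]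
  calc (pinv A).transpose = (pinv A).transpose * (A * pinv A) := by rw [h', Matrix.mul_one]
    _ = pinv A := by rw [← Matrix.mul_assoc, this, Matrix.one_mul]

theorem mean_sq_infl_eq (hM : (M⁻¹).transpose = M⁻¹) (u : Vec p) :
    (n : ℝ)⁻¹ * ∑ i, (inner ℝ u (act M⁻¹ (s i).1) * (s i).2) ^ 2
      = inner ℝ u (act (M⁻¹ * ((n : ℝ)⁻¹ • ∑ i, (s i).2 ^ 2 • outer (s i).1) * M⁻¹) u) := by
  simp only [act_mul, act_smul, act_sum, act_outer, act_smul_right, act_sum_right,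
    real_inner_smul_right, inner_sum]
  congr 1
  refine Finset.sum_congr rfl fun i _ => ?_
  rw [← inner_act_of_symm hM (s i).1, real_inner_comm u (act M⁻¹ (s i).1)]
  ring

/-- With residual `r` and `v = X'(β̂ - β)`, one has `ε = r + v` and `ε² - r² = 2vr + v²`, where `|v|
≤ ‖X‖ d`. Expanding around `r` rather than `ε` keeps the bound computable from the data. -/
theorem norm_weighted_outer_sub_le (β : Vec p) {d : ℝ}
    (hd : ‖olsBeta (observe β s) - β‖ ≤ d) :
    ‖((n : ℝ)⁻¹ • ∑ i, (s i).2 ^ 2 • outer (s i).1)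
        - (n : ℝ)⁻¹ • ∑ i, resid (observe β s) i ^ 2 • outer (s i).1‖
      ≤ 2 * d * ((n : ℝ)⁻¹ * ∑ i, ‖(s i).1‖ ^ 3 * |resid (observe β s) i|)
        + d ^ 2 * ((n : ℝ)⁻¹ * ∑ i, ‖(s i).1‖ ^ 4) := by
  have hd0 : 0 ≤ d := (norm_nonneg _).trans hd
  rw [← smul_sub, ← Finset.sum_sub_distrib]
  have hbound : ∀ i, ‖(s i).2 ^ 2 • outer (s i).1 - resid (observe β s) i ^ 2 • outer (s i).1‖
      ≤ 2 * d * (‖(s i).1‖ ^ 3 * |resid (observe β s) i|) + d ^ 2 * ‖(s i).1‖ ^ 4 := by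
    intro i
    set r := resid (observe β s) i with hr
    set v : ℝ := inner ℝ (s i).1 (olsBeta (observe β s) - β) with hv
    have e : (s i).2 = r + v := by
      rw [hr, hv, resid, inner_sub_right]; simp only [observe]; ring
    have hv' : |v| ≤ ‖(s i).1‖ * d :=
      (abs_real_inner_le_norm _ _).trans (by gcongr)
    rw [← sub_smul, norm_smul, Real.norm_eq_abs, e]
    have h1 : |(r + v) ^ 2 - r ^ 2| ≤ 2 * (‖(s i).1‖ * d) * |r| + (‖(s i).1‖ * d) ^ 2 := by
      have : (r + v) ^ 2 - r ^ 2 = 2 * v * r + v ^ 2 := by ring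
      rw [this]
      refine (abs_add_le _ _).trans ?_
      rw [abs_mul, abs_mul, abs_two, abs_pow]
      gcongr
    calc _ ≤ (2 * (‖(s i).1‖ * d) * |r| + (‖(s i).1‖ * d) ^ 2) * ‖(s i).1‖ ^ 2 := by
          gcongr; exact norm_outer_le _
      _ = _ := by ring
  calc _ ≤ (n : ℝ)⁻¹ * ∑ i, (2 * d * (‖(s i).1‖ ^ 3 * |resid (observe β s) i|)
            + d ^ 2 * ‖(s i).1‖ ^ 4) := by
        rw [norm_smul, Real.norm_of_nonneg (by positivity)]
        gcongr
        exact (norm_sum_le _ _).trans (Finset.sum_le_sum fun i _ => hbound i)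
    _ = _ := by
        rw [Finset.sum_add_distrib, ← Finset.mul_sum, ← Finset.mul_sum]; ring

theorem abs_mean_sq_infl_sub_le (hT : IsInvSqrt M T) (hl0 : 0 < l)
    (hl : ∀ x, l * ‖x‖ ^ 2 ≤ inner ℝ x (act M x)) (hg0 : 0 ≤ g) (hg1 : g < 1)
    (hg : ‖(n : ℝ)⁻¹ • ∑ i, outer (act T (s i).1) - 1‖ ≤ g)
    (hz : ‖(n : ℝ)⁻¹ • ∑ i, (s i).2 • act T (s i).1‖ ≤ z) (u β : Vec p) {d : ℝ}
    (hd : d = l ^ (-(1 / 2) : ℝ) * (g / (1 - g) + 1) * z) :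
    |(n : ℝ)⁻¹ * ∑ i, (inner ℝ u (act M⁻¹ (s i).1) * (s i).2) ^ 2
        - inner ℝ u (act (Vhat (observe β s)) u)|
      ≤ ‖u‖ ^ 2 * (l⁻¹ ^ 2 * (2 * d * ((n : ℝ)⁻¹ * ∑ i, ‖(s i).1‖ ^ 3 * |resid (observe β s) i|)
          + d ^ 2 * ((n : ℝ)⁻¹ * ∑ i, ‖(s i).1‖ ^ 4))
        + (l⁻¹ * (g / (1 - g))) ^ 2
          * ((n : ℝ)⁻¹ * ∑ i, ‖resid (observe β s) i • (s i).1‖ ^ 2)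
        + 2 * (l⁻¹ * (g / (1 - g)))
          * specNorm ((n : ℝ)⁻¹ • ∑ i, resid (observe β s) i ^ 2
              • (outer (s i).1 * pinv (gram s)))) := by
  obtain ⟨W, h1, h2, h3, h4⟩ := exists_pinv_gram hT hg1 hg
  have hA := norm_inv_le hT hl0 hl
  have hAB := norm_inv_sub_pinv_gram_le hT hl0 hl hg0 hg1 hg
  have hβ := norm_olsBeta_sub_le hT hl0 hl hg0 hg1 hg hz β
  rw [← hd] at hβ
  have hdiff := norm_weighted_outer_sub_le β hβ
  have hd0 : 0 ≤ d := (norm_nonneg _).trans hβ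
  have hAs : (M⁻¹).transpose = M⁻¹ := by rw [hT.inv_eq, Matrix.transpose_mul, hT.symm]
  have hBs : (pinv (gram s)).transpose = pinv (gram s) :=
    pinv_transpose_of_mul_eq_one (gram_transpose s) h2
  have hV : Vhat (observe β s) = pinv (gram s)
      * ((n : ℝ)⁻¹ • ∑ i, resid (observe β s) i ^ 2 • outer (s i).1) * pinv (gram s) := rfl
  have hk : ((n : ℝ)⁻¹ • ∑ i, resid (observe β s) i ^ 2 • (outer (s i).1 * pinv (gram s)))
      = ((n : ℝ)⁻¹ • ∑ i, resid (observe β s) i ^ 2 • outer (s i).1) * pinv (gram s) := by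
    simp only [Matrix.smul_mul, Finset.sum_mul]
  have hms : ((n : ℝ)⁻¹ • ∑ i, resid (observe β s) i ^ 2 • outer (s i).1).transpose
      = (n : ℝ)⁻¹ • ∑ i, resid (observe β s) i ^ 2 • outer (s i).1 := by
    simp [Matrix.transpose_sum, outer_transpose]
  have hm : ‖(n : ℝ)⁻¹ • ∑ i, resid (observe β s) i ^ 2 • outer (s i).1‖
      ≤ (n : ℝ)⁻¹ * ∑ i, ‖resid (observe β s) i • (s i).1‖ ^ 2 := by
    rw [norm_smul, Real.norm_of_nonneg (by positivity)]
    gcongr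
    refine (norm_sum_le _ _).trans (Finset.sum_le_sum fun i _ => ?_)
    rw [norm_smul, norm_smul, mul_pow, norm_pow]
    gcongr
    exact norm_outer_le _
  rw [mean_sq_infl_eq hAs, hV, ← inner_sub_right, ← act_sub, specNorm_eq_norm, hk]
  set E := (n : ℝ)⁻¹ • ∑ i, (s i).2 ^ 2 • outer (s i).1
  set H := (n : ℝ)⁻¹ • ∑ i, resid (observe β s) i ^ 2 • outer (s i).1
  set A := M⁻¹
  set B := pinv (gram s)
  -- The two cross terms are transposes of each other, whence the factor 2, and they retain the
  -- computable `H B`. Together with the bound on `E - H`, these pieces produce the terms of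
  -- `R_var`.
  have hdec : A * E * A - B * H * B
      = A * (E - H) * A + (A - B) * H * (A - B) + (A - B) * (H * B)
        + ((A - B) * (H * B)).transpose := by
    rw [Matrix.transpose_mul, Matrix.transpose_mul, Matrix.transpose_sub, hAs, hBs, hms]
    noncomm_ring
  refine (abs_inner_act_le _ _).trans ?_
  gcongr
  rw [hdec]
  calc _ ≤ ‖A * (E - H) * A‖ + ‖(A - B) * H * (A - B)‖ + ‖(A - B) * (H * B)‖
          + ‖((A - B) * (H * B)).transpose‖ := norm_add₄_le
    _ ≤ ‖A‖ * ‖E - H‖ * ‖A‖ + ‖A - B‖ * ‖H‖ * ‖A - B‖ + ‖A - B‖ * ‖H * B‖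
          + ‖A - B‖ * ‖H * B‖ := by
        rw [norm_transpose]
        gcongr
        · exact (norm_mul_le _ _).trans
            (mul_le_mul_of_nonneg_right (norm_mul_le _ _) (norm_nonneg _))
        · exact (norm_mul_le _ _).trans
            (mul_le_mul_of_nonneg_right (norm_mul_le _ _) (norm_nonneg _))
        · exact norm_mul_le _ _
        · exact norm_mul_le _ _
    _ ≤ l⁻¹ * (2 * d * ((n : ℝ)⁻¹ * ∑ i, ‖(s i).1‖ ^ 3 * |resid (observe β s) i|)
          + d ^ 2 * ((n : ℝ)⁻¹ * ∑ i, ‖(s i).1‖ ^ 4)) * l⁻¹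
        + (l⁻¹ * (g / (1 - g)))
          * ((n : ℝ)⁻¹ * ∑ i, ‖resid (observe β s) i • (s i).1‖ ^ 2) * (l⁻¹ * (g / (1 - g)))
        + (l⁻¹ * (g / (1 - g))) * ‖H * B‖ + (l⁻¹ * (g / (1 - g))) * ‖H * B‖ := by
        gcongr
    _ = _ := by ring

end LeastSquares

/-! ### The remainder bounds of the interval -/

section Remainders

variable {p n : ℕ}

/-- On `goodEvent` the Gram matrix and the score are controlled at confidence `γ`. -/
def goodEvent (c : Bounds) (T : Mat p) (n : ℕ) (γ : ℝ) : Set (Fin n → Vec p × ℝ) :=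
  {s | specNorm ((n : ℝ)⁻¹ • ∑ i, outer (act T (s i).1) - 1) ≤ gammaTilde c n γ ∧
    ‖(n : ℝ)⁻¹ • ∑ i, (s i).2 • act T (s i).1‖ ≤ √2 * (c.Keps / γ) ^ (1 / 4 : ℝ) / √n}

variable {M T : Mat p} {s : Fin n → Vec p × ℝ} {c : Bounds} {γ : ℝ}

theorem gammaTilde_nonneg (c : Bounds) (n : ℕ) (γ : ℝ) : 0 ≤ gammaTilde c n γ := Real.sqrt_nonneg _

theorem abs_linearization_le_Rlin (hc : c.Pos) (hT : IsInvSqrt M T)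
    (hl : ∀ x, c.lamReg * ‖x‖ ^ 2 ≤ inner ℝ x (act M x)) (hg1 : gammaTilde c n γ < 1)
    (hs : s ∈ goodEvent c T n γ) (u β : Vec p) :
    |inner ℝ u (olsBeta (observe β s) - β)
        - (n : ℝ)⁻¹ * ∑ i, inner ℝ u (act M⁻¹ (s i).1) * (s i).2| ≤ Rlin u c n γ / √n := by
  refine (abs_linearization_le hT hc.1 hl (gammaTilde_nonneg c n γ) hg1 hs.1 hs.2 u β).trans_eq ?_
  rw [Rlin]; ring

theorem abs_mean_sq_infl_sub_le_Rvar (hc : c.Pos) (hγ : 0 < γ) (hn : 0 < n) (hT : IsInvSqrt M T)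
    (hl : ∀ x, c.lamReg * ‖x‖ ^ 2 ≤ inner ℝ x (act M x)) (hg1 : gammaTilde c n γ < 1)
    (hs : s ∈ goodEvent c T n γ) (u β : Vec p) :
    |(n : ℝ)⁻¹ * ∑ i, (inner ℝ u (act M⁻¹ (s i).1) * (s i).2) ^ 2
        - inner ℝ u (act (Vhat (observe β s)) u)| ≤ ‖u‖ ^ 2 * Rvar c (observe β s) γ := by
  refine (abs_mean_sq_infl_sub_le hT hc.1 hl (gammaTilde_nonneg c n γ) hg1 hs.1 hs.2 u β
    rfl).trans_eq ?_
  obtain ⟨h1, h2, h3, -⟩ := hc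
  have hn' : (0 : ℝ) < n := by exact_mod_cast hn
  -- All fractional powers are rewritten through `√l`, `√n`, `√2` and the quartic root of `K_ε/γ`,
  -- so that the identification with `R_var` becomes a rational identity.
  have hl2 : c.lamReg ^ (5 / 2 : ℝ) = c.lamReg ^ 2 * √c.lamReg := by
    rw [Real.sqrt_eq_rpow, ← Real.rpow_natCast, ← Real.rpow_add h1]; norm_num
  have hl1 : c.lamReg ^ (-(1 / 2) : ℝ) = (√c.lamReg)⁻¹ := by
    rw [Real.sqrt_eq_rpow, Real.rpow_neg h1.le]
  have hh : √(c.Keps / γ) = ((c.Keps / γ) ^ (1 / 4 : ℝ)) ^ 2 := by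
    rw [Real.sqrt_eq_rpow, ← Real.rpow_natCast, ← Real.rpow_mul (by positivity)]; norm_num
  have hg2 : gammaTilde c n γ ^ 2 = c.Kreg / (n * γ) := Real.sq_sqrt (by positivity)
  rw [Rvar, hl2, hh, ← hg2, hl1]
  have hsl := Real.sq_sqrt h1.le
  have hsn := Real.sq_sqrt hn'.le
  have hsl0 := Real.sqrt_pos.2 h1
  have hsn0 := Real.sqrt_pos.2 hn'
  have hs2 := Real.sq_sqrt (zero_le_two (α := ℝ))
  have hg3 : 1 - gammaTilde c n γ ≠ 0 := by linarith
  simp only [observe, gram_observe]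
  generalize specNorm _ = k
  generalize (n : ℝ)⁻¹ * ∑ i, ‖(s i).1‖ ^ 4 = m4
  generalize (n : ℝ)⁻¹ * ∑ i, ‖(s i).1‖ ^ 3 * |_| = m3
  generalize (n : ℝ)⁻¹ * ∑ i, ‖(_ : ℝ) • (s i).1‖ ^ 2 = m2
  generalize (c.Keps / γ) ^ (1 / 4 : ℝ) = h
  generalize gammaTilde c n γ = g at *
  generalize c.lamReg = l at *
  generalize √(n : ℝ) = q at *
  rw [← hsn]
  generalize √l = r at *
  rw [← hsl]
  generalize √(2 : ℝ) = w at *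
  field_simp
  ring_nf
  simp only [hs2]
  ring

end Remainders


/-! ### Moments of sums of independent vectors -/

section Moments

variable {α β H : Type*} [MeasurableSpace α] [MeasurableSpace β]
  [NormedAddCommGroup H] [InnerProductSpace ℝ H] [CompleteSpace H]
  {P : Measure α} [IsProbabilityMeasure P] {Q : Measure β} [IsProbabilityMeasure Q]
  {f : α → H} {g : β → H}

omit [InnerProductSpace ℝ H] [CompleteSpace H] in
theorem integrable_norm_pow_of_le {k m : ℕ} (hkm : k ≤ m) (hf : AEStronglyMeasurable f P)
    (h : Integrable (fun x => ‖f x‖ ^ m) P) : Integrable (fun x => ‖f x‖ ^ k) P := by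
  refine ((integrable_const (1 : ℝ)).add h).mono' (hf.norm.pow k) (ae_of_all _ fun x => ?_)
  rw [Real.norm_of_nonneg (by positivity)]
  simp only [Pi.add_apply]
  rcases le_total ‖f x‖ 1 with h1 | h1
  · linarith [pow_le_one₀ (norm_nonneg (f x)) h1 (n := k), pow_nonneg (norm_nonneg (f x)) m]
  · linarith [pow_le_pow_right₀ h1 hkm]

omit [InnerProductSpace ℝ H] [CompleteSpace H] in
theorem integrable_of_norm_pow {m : ℕ} (hm : 1 ≤ m) (hf : AEStronglyMeasurable f P)
    (h : Integrable (fun x => ‖f x‖ ^ m) P) : Integrable f P := by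
  have := integrable_norm_pow_of_le hm hf h
  simp only [pow_one] at this
  exact (integrable_norm_iff hf).1 this

omit [CompleteSpace H] [IsProbabilityMeasure P] [IsProbabilityMeasure Q] in
theorem integrable_inner_prod (hf : Integrable f P) (hg : Integrable g Q) :
    Integrable (fun q : α × β => (inner ℝ (g q.2) (f q.1) : ℝ)) (P.prod Q) := by
  refine (hf.norm.mul_prod hg.norm).mono'
    (hg.aestronglyMeasurable.comp_snd.inner hf.aestronglyMeasurable.comp_fst)
    (ae_of_all _ fun q => ?_)
  rw [mul_comm]
  exact norm_inner_le_norm _ _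

theorem integral_inner_prod (hf : Integrable f P) (hg : Integrable g Q) :
    ∫ q : α × β, (inner ℝ (g q.2) (f q.1) : ℝ) ∂P.prod Q = inner ℝ (∫ y, g y ∂Q) (∫ x, f x ∂P) := by
  rw [integral_prod_symm _ (integrable_inner_prod hf hg)]
  simp_rw [integral_inner hf]
  rw [real_inner_comm, ← integral_inner hg]
  simp_rw [real_inner_comm]

/-- The cross term factorizes over the product measure and vanishes because `f` is centred; `g` need
not be. -/
theorem integral_norm_add_sq (hf : AEStronglyMeasurable f P) (hg : AEStronglyMeasurable g Q)
    (hf2 : Integrable (fun x => ‖f x‖ ^ 2) P) (hg2 : Integrable (fun x => ‖g x‖ ^ 2) Q)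
    (hf0 : ∫ x, f x ∂P = 0) :
    Integrable (fun q : α × β => ‖f q.1 + g q.2‖ ^ 2) (P.prod Q) ∧
    ∫ q : α × β, ‖f q.1 + g q.2‖ ^ 2 ∂P.prod Q = ∫ x, ‖f x‖ ^ 2 ∂P + ∫ y, ‖g y‖ ^ 2 ∂Q := by
  have hfi := integrable_of_norm_pow one_le_two hf hf2
  have hgi := integrable_of_norm_pow one_le_two hg hg2
  have e : ∀ q : α × β, ‖f q.1 + g q.2‖ ^ 2
      = ‖f q.1‖ ^ 2 + 2 * inner ℝ (g q.2) (f q.1) + ‖g q.2‖ ^ 2 := fun q => by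
    rw [norm_add_sq_real, real_inner_comm]
  have i1 : Integrable (fun q : α × β => ‖f q.1‖ ^ 2) (P.prod Q) := hf2.comp_fst Q
  have i2 : Integrable (fun q : α × β => ‖g q.2‖ ^ 2) (P.prod Q) := hg2.comp_snd P
  have i3 := (integrable_inner_prod hfi hgi).const_mul 2
  have i13 : Integrable (fun q : α × β => ‖f q.1‖ ^ 2 + 2 * inner ℝ (g q.2) (f q.1))
    (P.prod Q) := i1.add i3
  simp_rw [e]
  refine ⟨i13.add i2, ?_⟩
  rw [integral_add i13 i2, integral_add i1 i3, integral_const_mul,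
    integral_inner_prod hfi hgi, hf0, integral_fun_fst (fun x => ‖f x‖ ^ 2),
    integral_fun_snd (fun x => ‖g x‖ ^ 2)]
  simp

/-- Square the expansion of `‖f + g‖²`. The terms of odd degree in `f` and in `g` integrate to zero
since both are centred. Cauchy-Schwarz turns `4⟨f,g⟩²` into `4‖f‖²‖g‖²`, which joins `2‖f‖²‖g‖²` to
give the constant 6. -/
theorem integral_norm_add_pow_four_le (hf : AEStronglyMeasurable f P)
    (hg : AEStronglyMeasurable g Q)
    (hf4 : Integrable (fun x => ‖f x‖ ^ 4) P) (hg4 : Integrable (fun x => ‖g x‖ ^ 4) Q)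
    (hf0 : ∫ x, f x ∂P = 0) (hg0 : ∫ y, g y ∂Q = 0) :
    Integrable (fun q : α × β => ‖f q.1 + g q.2‖ ^ 4) (P.prod Q) ∧
    ∫ q : α × β, ‖f q.1 + g q.2‖ ^ 4 ∂P.prod Q
      ≤ ∫ x, ‖f x‖ ^ 4 ∂P + 6 * ((∫ x, ‖f x‖ ^ 2 ∂P) * ∫ y, ‖g y‖ ^ 2 ∂Q)
        + ∫ y, ‖g y‖ ^ 4 ∂Q := by
  have hfi := integrable_of_norm_pow (by norm_num) hf hf4
  have hgi := integrable_of_norm_pow (by norm_num) hg hg4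
  have hf2 := integrable_norm_pow_of_le (by norm_num : 2 ≤ 4) hf hf4
  have hg2 := integrable_norm_pow_of_le (by norm_num : 2 ≤ 4) hg hg4
  have hf3 : Integrable (fun x => ‖f x‖ ^ 2 • f x) P :=
    (integrable_norm_pow_of_le (by norm_num : 3 ≤ 4) hf hf4).mono' ((hf.norm.pow 2).smul hf)
      (ae_of_all _ fun x => by rw [norm_smul, norm_pow, norm_norm, pow_succ _ 2])
  have hg3 : Integrable (fun x => ‖g x‖ ^ 2 • g x) Q :=
    (integrable_norm_pow_of_le (by norm_num : 3 ≤ 4) hg hg4).mono' ((hg.norm.pow 2).smul hg)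
      (ae_of_all _ fun x => by rw [norm_smul, norm_pow, norm_norm, pow_succ _ 2])
  have i1 : Integrable (fun q : α × β => ‖f q.1‖ ^ 4) (P.prod Q) := hf4.comp_fst Q
  have i2 : Integrable (fun q : α × β => ‖g q.2‖ ^ 4) (P.prod Q) := hg4.comp_snd P
  have i3 := (integrable_inner_prod hf3 hgi).const_mul 4
  have i4 := (integrable_inner_prod hfi hg3).const_mul 4
  have i5 : Integrable (fun q : α × β => 6 * (‖f q.1‖ ^ 2 * ‖g q.2‖ ^ 2)) (P.prod Q) :=
    (hf2.mul_prod hg2).const_mul 6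
  have hle : ∀ q : α × β, ‖f q.1 + g q.2‖ ^ 4
      ≤ ‖f q.1‖ ^ 4 + 6 * (‖f q.1‖ ^ 2 * ‖g q.2‖ ^ 2) + ‖g q.2‖ ^ 4
        + 4 * inner ℝ (g q.2) (‖f q.1‖ ^ 2 • f q.1) + 4 * inner ℝ (‖g q.2‖ ^ 2 • g q.2) (f q.1) := by
    intro q
    have e : ‖f q.1 + g q.2‖ ^ 4
        = (‖f q.1‖ ^ 2 + 2 * inner ℝ (g q.2) (f q.1) + ‖g q.2‖ ^ 2) ^ 2 := by
      rw [real_inner_comm, ← norm_add_sq_real]; ring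
    have h : (inner ℝ (g q.2) (f q.1) : ℝ) ^ 2 ≤ ‖f q.1‖ ^ 2 * ‖g q.2‖ ^ 2 := by
      rw [← sq_abs, ← mul_pow, mul_comm]
      exact pow_le_pow_left₀ (abs_nonneg _) (abs_real_inner_le_norm _ _) 2
    rw [e, real_inner_smul_right, real_inner_smul_left]
    linarith
  have i6 : Integrable (fun q : α × β => ‖f q.1‖ ^ 4 + 6 * (‖f q.1‖ ^ 2 * ‖g q.2‖ ^ 2))
    (P.prod Q) := i1.add i5
  have i7 : Integrable (fun q : α × β => ‖f q.1‖ ^ 4 + 6 * (‖f q.1‖ ^ 2 * ‖g q.2‖ ^ 2)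
    + ‖g q.2‖ ^ 4) (P.prod Q) := i6.add i2
  have i8 : Integrable (fun q : α × β => ‖f q.1‖ ^ 4 + 6 * (‖f q.1‖ ^ 2 * ‖g q.2‖ ^ 2)
    + ‖g q.2‖ ^ 4 + 4 * inner ℝ (g q.2) (‖f q.1‖ ^ 2 • f q.1)) (P.prod Q) := i7.add i3
  have i := i8.add i4
  have hint : Integrable (fun q : α × β => ‖f q.1 + g q.2‖ ^ 4) (P.prod Q) :=
    i.mono' ((hf.comp_fst.add hg.comp_snd).norm.pow 4) (ae_of_all _ fun q => by
      rw [Real.norm_of_nonneg (by positivity)]; exact hle q)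
  refine ⟨hint, (integral_mono hint i hle).trans_eq ?_⟩
  rw [integral_add' i8 i4, integral_add i7 i3, integral_add i6 i2, integral_add i1 i5, integral_const_mul, integral_const_mul,
    integral_const_mul, integral_inner_prod hf3 hgi, integral_inner_prod hfi hg3, hf0, hg0,
    integral_prod_mul (fun x => ‖f x‖ ^ 2) (fun y => ‖g y‖ ^ 2),
    integral_fun_fst (fun x => ‖f x‖ ^ 4), integral_fun_snd (fun x => ‖g x‖ ^ 4)]
  simp

/-! ### Splitting off the first observation of an i.i.d. sample, and moments of sums -/

variable (P) in
theorem measurePreserving_head_tail (n : ℕ) :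
    MeasurePreserving (fun w : Fin (n + 1) → α => (w 0, fun i : Fin n => w i.succ))
      (Measure.pi fun _ => P) (P.prod (Measure.pi fun _ => P)) :=
  measurePreserving_piFinSuccAbove (fun _ : Fin (n + 1) => P) 0

variable (P) in
theorem measurableEmbedding_head_tail (n : ℕ) :
    MeasurableEmbedding (fun w : Fin (n + 1) → α => (w 0, fun i : Fin n => w i.succ)) :=
  (MeasurableEquiv.piFinSuccAbove (fun _ : Fin (n + 1) => α) 0).measurableEmbedding

omit [InnerProductSpace ℝ H] [CompleteSpace H] in
theorem stronglyMeasurable_sum_eval (hf : StronglyMeasurable f) (n : ℕ) :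
    StronglyMeasurable fun w : Fin n → α => ∑ i, f (w i) :=
  Finset.stronglyMeasurable_fun_sum _ fun i _ => hf.comp_measurable (measurable_pi_apply i)

theorem integrable_eval {E : Type*} [NormedAddCommGroup E] {n : ℕ} (i : Fin n)
    {h : α → E} (hh : Integrable h P) :
    Integrable (fun w : Fin n → α => h (w i)) (Measure.pi fun _ => P) :=
  (measurePreserving_eval (fun _ : Fin n => P) i).integrable_comp_of_integrable hh

theorem integral_eval {E : Type*} [NormedAddCommGroup E] [NormedSpace ℝ E] {n : ℕ} (i : Fin n)
    {h : α → E} (hh : AEStronglyMeasurable h P) :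
    ∫ w : Fin n → α, h (w i) ∂(Measure.pi fun _ => P) = ∫ x, h x ∂P := by
  have e := measurePreserving_eval (fun _ : Fin n => P) i
  have h := integral_map e.aemeasurable (f := h) (by rw [e.map_eq]; exact hh)
  rw [e.map_eq] at h
  exact h.symm

omit [CompleteSpace H] in
theorem integral_sum_eval {n : ℕ} (hf : Integrable f P) :
    ∫ w : Fin n → α, ∑ i, f (w i) ∂(Measure.pi fun _ => P) = (n : ℝ) • ∫ x, f x ∂P := by
  rw [integral_finsetSum _ fun i _ => integrable_eval i hf]
  simp [integral_eval _ hf.aestronglyMeasurable, Nat.cast_smul_eq_nsmul]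

theorem integral_norm_sum_sq (hf : StronglyMeasurable f)
    (hf2 : Integrable (fun x => ‖f x‖ ^ 2) P) (hf0 : ∫ x, f x ∂P = 0) (n : ℕ) :
    Integrable (fun w : Fin n → α => ‖∑ i, f (w i)‖ ^ 2) (Measure.pi fun _ => P) ∧
    ∫ w : Fin n → α, ‖∑ i, f (w i)‖ ^ 2 ∂(Measure.pi fun _ => P) = n * ∫ x, ‖f x‖ ^ 2 ∂P := by
  induction n with
  | zero => simp
  | succ n ih =>
    have h := integral_norm_add_sq hf.aestronglyMeasurable
      (stronglyMeasurable_sum_eval hf n).aestronglyMeasurable hf2 ih.1 hf0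
    have hm := measurePreserving_head_tail P n
    have he := measurableEmbedding_head_tail (α := α) n
    simp_rw [Fin.sum_univ_succ]
    refine ⟨hm.integrable_comp_of_integrable h.1, ?_⟩
    have := hm.integral_comp he fun q : α × (Fin n → α) => ‖f q.1 + ∑ i, f (q.2 i)‖ ^ 2
    rw [this, h.2, ih.2]
    push_cast; ring

omit [InnerProductSpace ℝ H] [CompleteSpace H] in
theorem sq_integral_norm_sq_le (hf : StronglyMeasurable f)
    (hf4 : Integrable (fun x => ‖f x‖ ^ 4) P) :
    (∫ x, ‖f x‖ ^ 2 ∂P) ^ 2 ≤ ∫ x, ‖f x‖ ^ 4 ∂P := by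
  have hf2 := integrable_norm_pow_of_le (by norm_num : 2 ≤ 4) hf.aestronglyMeasurable hf4
  set m := ∫ x, ‖f x‖ ^ 2 ∂P with hm
  have h : 0 ≤ ∫ x, (‖f x‖ ^ 2 - m) ^ 2 ∂P := integral_nonneg fun x => sq_nonneg _
  have e : ∀ x, (‖f x‖ ^ 2 - m) ^ 2 = ‖f x‖ ^ 4 - 2 * m * ‖f x‖ ^ 2 + m ^ 2 := fun x => by ring
  have i2 := hf2.const_mul (2 * m)
  have i3 : Integrable (fun x => ‖f x‖ ^ 4 - 2 * m * ‖f x‖ ^ 2) P := hf4.sub i2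
  simp_rw [e] at h
  rw [integral_add i3 (integrable_const _), integral_sub hf4 i2, integral_const_mul, ← hm] at h
  simp only [integral_const, probReal_univ, one_smul] at h
  nlinarith

/-- Induction on `n`: with `(E‖f‖²)² ≤ E‖f‖⁴`, adding one summand brings the constant to at most `1
+ 6n + 3n² ≤ 3(n+1)²`. -/
theorem integral_norm_sum_pow_four_le (hf : StronglyMeasurable f)
    (hf4 : Integrable (fun x => ‖f x‖ ^ 4) P) (hf0 : ∫ x, f x ∂P = 0) (n : ℕ) :
    Integrable (fun w : Fin n → α => ‖∑ i, f (w i)‖ ^ 4) (Measure.pi fun _ => P) ∧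
    ∫ w : Fin n → α, ‖∑ i, f (w i)‖ ^ 4 ∂(Measure.pi fun _ => P)
      ≤ 3 * n ^ 2 * ∫ x, ‖f x‖ ^ 4 ∂P := by
  have hf2 := integrable_norm_pow_of_le (by norm_num : 2 ≤ 4) hf.aestronglyMeasurable hf4
  induction n with
  | zero => simp
  | succ n ih =>
    have hsum0 : ∫ w : Fin n → α, ∑ i, f (w i) ∂(Measure.pi fun _ => P) = 0 := by
      rw [integral_sum_eval (integrable_of_norm_pow (by norm_num) hf.aestronglyMeasurable hf4),
        hf0, smul_zero]
    have h := integral_norm_add_pow_four_le hf.aestronglyMeasurable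
      (stronglyMeasurable_sum_eval hf n).aestronglyMeasurable hf4 ih.1 hf0 hsum0
    have hm := measurePreserving_head_tail P n
    have he := measurableEmbedding_head_tail (α := α) n
    simp_rw [Fin.sum_univ_succ]
    refine ⟨hm.integrable_comp_of_integrable h.1, ?_⟩
    have := hm.integral_comp he fun q : α × (Fin n → α) => ‖f q.1 + ∑ i, f (q.2 i)‖ ^ 4
    rw [this]
    refine h.2.trans ?_
    rw [(integral_norm_sum_sq hf hf2 hf0 n).2]
    have h1 := sq_integral_norm_sq_le hf hf4
    have h2 := ih.2
    have h3 : 0 ≤ ∫ x, ‖f x‖ ^ 4 ∂P := integral_nonneg fun x => by positivity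
    push_cast
    have h4 : (n : ℝ) * (∫ x, ‖f x‖ ^ 2 ∂P) ^ 2 ≤ n * ∫ x, ‖f x‖ ^ 4 ∂P := by gcongr
    nlinarith

end Moments

/-! ### Tail bounds for averages -/

section Tails

variable {α : Type*} [MeasurableSpace α] {P : Measure α} [IsProbabilityMeasure P]

theorem measureReal_lt_le_div_of_integral_le {Ω : Type*} [MeasurableSpace Ω] {μ : Measure Ω}
    [IsProbabilityMeasure μ] {X : Ω → ℝ} (hX : ∀ w, 0 ≤ X w) (hi : Integrable X μ) {C b : ℝ}
    (hb : 0 < b) (hC : ∫ w, X w ∂μ ≤ C) : μ.real {w | b < X w} ≤ C / b := by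
  rw [le_div_iff₀ hb, mul_comm]
  refine le_trans ?_ ((mul_meas_ge_le_integral_of_nonneg (ae_of_all _ hX) hi b).trans hC)
  exact mul_le_mul_of_nonneg_left (measureReal_mono fun w (hw : b < X w) => hw.le) hb.le

theorem measureReal_lt_average_le {X : α → ℝ} (hX : ∀ x, 0 ≤ X x) (hi : Integrable X P) {C b : ℝ}
    (hb : 0 < b) (hC : ∫ x, X x ∂P ≤ C) {n : ℕ} (hn : 0 < n) :
    (Measure.pi fun _ : Fin n => P).real {w | b < (n : ℝ)⁻¹ * ∑ i, X (w i)} ≤ C / b := by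
  refine measureReal_lt_le_div_of_integral_le
    (fun w => mul_nonneg (by positivity) (Finset.sum_nonneg fun i _ => hX _))
    ((integrable_finsetSum _ fun i _ => integrable_eval i hi).const_mul _) hb ?_
  rw [integral_const_mul, integral_sum_eval hi, smul_eq_mul,
    inv_mul_cancel_left₀ (by positivity)]
  exact hC

/-- Invert `exp x ≥ 1 + x + x²/2` and use `(1 + x + x²/2)(1 - x + x²/2) = 1 + x⁴/4 ≥ 1`. -/
theorem exp_neg_le_quadratic {x : ℝ} (hx : 0 ≤ x) : Real.exp (-x) ≤ 1 - x + x ^ 2 / 2 := by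
  rw [Real.exp_neg]
  refine inv_le_of_inv_le₀ (by nlinarith [sq_nonneg (x - 1)]) ?_
  refine le_trans ?_ (Real.quadratic_le_exp_of_nonneg hx)
  rw [inv_le_iff_one_le_mul₀ (by nlinarith [sq_nonneg (x - 1)])]
  nlinarith [sq_nonneg (x ^ 2)]

/-- Chernoff's method for the lower tail. Nonnegativity lets `exp (-tX)` be bounded by its quadratic
expansion, so a second moment suffices for an exponential rate. -/
theorem measureReal_average_le_exp {X : α → ℝ} (hm : Measurable X) (hX : ∀ x, 0 ≤ X x)
    (hi : Integrable X P) (hi2 : Integrable (fun x => X x ^ 2) P) {b : ℝ}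
    (hv : 0 < ∫ x, X x ^ 2 ∂P) (hb : b ≤ ∫ x, X x ∂P) {n : ℕ} (hn : 0 < n) :
    (Measure.pi fun _ : Fin n => P).real {w | (n : ℝ)⁻¹ * ∑ i, X (w i) ≤ b}
      ≤ Real.exp (-(n * ((∫ x, X x ∂P) - b) ^ 2 / (2 * ∫ x, X x ^ 2 ∂P))) := by
  set m := ∫ x, X x ∂P with hm'
  set v := ∫ x, X x ^ 2 ∂P with hv'
  -- The minimizer of the exponent `n (t b - t m + t² v / 2)`.
  set t := (m - b) / v with ht
  have ht0 : 0 ≤ t := div_nonneg (by linarith) hv.le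
  have hn' : (0 : ℝ) < n := by exact_mod_cast hn
  have hei : Integrable (fun x => Real.exp (-(t * X x))) P :=
    (integrable_const (1 : ℝ)).mono' (by fun_prop) (ae_of_all _ fun x => by
      rw [Real.norm_of_nonneg (Real.exp_pos _).le]
      exact Real.exp_le_one_iff.2 (by nlinarith [mul_nonneg ht0 (hX x)]))
  have h1 : ∫ x, Real.exp (-(t * X x)) ∂P ≤ Real.exp (-(t * m) + t ^ 2 * v / 2) := by
    have i1 : Integrable (fun x => 1 - t * X x) P := (integrable_const _).sub (hi.const_mul t)
    have i2 : Integrable (fun x => t ^ 2 / 2 * X x ^ 2) P := hi2.const_mul _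
    calc _ ≤ ∫ x, ((1 - t * X x) + t ^ 2 / 2 * X x ^ 2) ∂P := by
          refine integral_mono hei (i1.add i2) fun x => ?_
          exact (exp_neg_le_quadratic (mul_nonneg ht0 (hX x))).trans_eq (by ring)
      _ = 1 - t * m + t ^ 2 / 2 * v := by
          rw [integral_add i1 i2, integral_sub (integrable_const _) (hi.const_mul t),
            integral_const_mul, integral_const_mul, ← hm', ← hv']
          simp
      _ ≤ _ := by
          refine le_trans (le_of_eq (by ring)) (Real.add_one_le_exp (-(t * m) + t ^ 2 * v / 2))
  have h2 : ∫ w : Fin n → α, ∏ i, Real.exp (-(t * X (w i))) ∂(Measure.pi fun _ => P)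
      = (∫ x, Real.exp (-(t * X x)) ∂P) ^ n := by
    rw [integral_fintype_prod_eq_pow (fun x => Real.exp (-(t * X x)))]; simp
  have hint : Integrable (fun w : Fin n → α => ∏ i, Real.exp (-(t * X (w i))))
      (Measure.pi fun _ => P) := Integrable.fintype_prod (fun _ => hei)
  have h3 : (Measure.pi fun _ : Fin n => P).real {w | (n : ℝ)⁻¹ * ∑ i, X (w i) ≤ b}
      ≤ (Measure.pi fun _ : Fin n => P).real
        {w | Real.exp (-(t * (n * b))) ≤ ∏ i, Real.exp (-(t * X (w i)))} := by
    refine measureReal_mono fun w hw => ?_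
    simp only [Set.mem_ofPred_eq] at hw ⊢
    rw [← Real.exp_sum, Real.exp_le_exp, Finset.sum_neg_distrib, ← Finset.mul_sum]
    rw [inv_mul_le_iff₀ hn'] at hw
    exact neg_le_neg (mul_le_mul_of_nonneg_left hw ht0)
  have h4 := mul_meas_ge_le_integral_of_nonneg (ae_of_all _ fun w : Fin n → α =>
    Finset.prod_nonneg fun i _ => (Real.exp_pos (-(t * X (w i)))).le) hint
    (Real.exp (-(t * (n * b))))
  rw [h2] at h4
  have h5 : (∫ x, Real.exp (-(t * X x)) ∂P) ^ n ≤ Real.exp (n * (-(t * m) + t ^ 2 * v / 2)) := by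
    rw [Real.exp_nat_mul]
    exact pow_le_pow_left₀ (integral_nonneg fun x => (Real.exp_pos _).le) h1 n
  refine h3.trans ?_
  have h6 := h4.trans h5
  rw [mul_comm, ← le_div_iff₀ (Real.exp_pos _), ← Real.exp_sub] at h6
  refine h6.trans_eq ?_
  congr 1
  rw [ht]
  field_simp
  ring

end Tails


/-! ### The standard normal distribution -/

section Gaussian

theorem gaussCDF_eq (t : ℝ) : gaussCDF t = (gaussianReal 0 1).real (Set.Iic t) := cdf_eq_real _ t

theorem gaussianPDFReal_le_exp (t : ℝ) : gaussianPDFReal 0 1 t ≤ Real.exp (-t ^ 2 / 2) := by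
  rw [gaussianPDFReal]
  simp only [NNReal.coe_one, mul_one, sub_zero]
  refine mul_le_of_le_one_left (Real.exp_pos _).le (inv_le_one_of_one_le₀ ?_)
  rw [Real.one_le_sqrt]
  nlinarith [Real.pi_gt_three]

theorem gaussianPDFReal_le_one (t : ℝ) : gaussianPDFReal 0 1 t ≤ 1 :=
  (gaussianPDFReal_le_exp t).trans (Real.exp_le_one_iff.2 (by nlinarith [sq_nonneg t]))

theorem gaussCDF_mono : Monotone gaussCDF := monotone_cdf _

/-- The normal density is at most 1. This crude Lipschitz constant gives continuity here and later
absorbs the enlargement of the threshold `z`. -/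
theorem gaussCDF_sub_le {a b : ℝ} (hab : a ≤ b) : gaussCDF b - gaussCDF a ≤ b - a := by
  have h1 : gaussCDF b - gaussCDF a = (gaussianReal 0 1).real (Set.Ioc a b) := by
    have e : Set.Ioc a b = Set.Iic b \ Set.Iic a := by ext x; simp [and_comm]
    rw [gaussCDF_eq, gaussCDF_eq, e,
      measureReal_sdiff (Set.Iic_subset_Iic.2 hab) measurableSet_Iic]
  have h2 : gaussianReal 0 1 (Set.Ioc a b) ≤ ENNReal.ofReal (b - a) := by
    rw [gaussianReal_apply 0 one_ne_zero]
    calc _ ≤ ∫⁻ _ in Set.Ioc a b, 1 := by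
          refine lintegral_mono fun x => ?_
          rw [gaussianPDF, ← ENNReal.ofReal_one]
          exact ENNReal.ofReal_le_ofReal (gaussianPDFReal_le_one x)
      _ = _ := by simp
  rw [h1, measureReal_def]
  exact ENNReal.toReal_le_of_le_ofReal (by linarith) h2

theorem continuous_gaussCDF : Continuous gaussCDF := by
  have : LipschitzWith 1 gaussCDF := by
    refine LipschitzWith.of_le_add_mul 1 fun a b => ?_
    rw [NNReal.coe_one, one_mul, Real.dist_eq]
    rcases le_total a b with h | h
    · linarith [gaussCDF_mono h, abs_nonneg (a - b)]
    · linarith [gaussCDF_sub_le h, le_abs_self (a - b)]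
  exact this.continuous

theorem gaussCDF_neg (t : ℝ) : gaussCDF (-t) = 1 - gaussCDF t := by
  have _ : NullSingletonClass (gaussianReal 0 1) := nullSingletonClass_gaussianReal one_ne_zero
  have h1 : (gaussianReal 0 1).real (Set.Iic (-t)) = (gaussianReal 0 1).real (Set.Ici t) := by
    have h : (gaussianReal 0 1).map (fun x => -x) = gaussianReal 0 1 := by
      rw [gaussianReal_map_neg, neg_zero]
    conv_lhs => rw [← h]
    rw [map_measureReal_apply measurable_neg measurableSet_Iic]
    congr 1
    ext x; simp
  rw [gaussCDF_eq, gaussCDF_eq, h1, ← probReal_compl_eq_one_sub measurableSet_Iic, Set.compl_Iic,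
    measureReal_def, measureReal_def, Ioi_ae_eq_Ici.measure_eq]

theorem gaussCDF_le_one (t : ℝ) : gaussCDF t ≤ 1 := cdf_le_one _ t

theorem gaussCDF_nonneg (t : ℝ) : 0 ≤ gaussCDF t := cdf_nonneg _ t

theorem exists_gaussCDF_eq {τ : ℝ} (h : τ ∈ Set.Ioo (0 : ℝ) 1) : ∃ z, gaussCDF z = τ := by
  obtain ⟨a, ha⟩ := ((tendsto_cdf_atBot (gaussianReal 0 1)).eventually (gt_mem_nhds h.1)).exists
  obtain ⟨b, hb⟩ := ((tendsto_cdf_atTop (gaussianReal 0 1)).eventually (lt_mem_nhds h.2)).exists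
  exact mem_range_of_exists_le_of_exists_ge continuous_gaussCDF ⟨a, le_of_lt ha⟩ ⟨b, le_of_lt hb⟩

/-- Positivity of `τ` is essential: otherwise the set is the whole line and the infimum defining the
quantile is a default value. -/
theorem bddBelow_le_gaussCDF {τ : ℝ} (h : 0 < τ) : BddBelow {x | τ ≤ gaussCDF x} := by
  obtain ⟨a, ha⟩ := ((tendsto_cdf_atBot (gaussianReal 0 1)).eventually (gt_mem_nhds h)).exists
  exact ⟨a, fun x hx => le_of_not_gt fun hxa =>
    absurd (lt_of_le_of_lt hx (lt_of_le_of_lt (gaussCDF_mono hxa.le) ha)) (lt_irrefl τ)⟩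

theorem gaussQuantile_le {τ z : ℝ} (h : 0 < τ) (hz : τ ≤ gaussCDF z) : gaussQuantile τ ≤ z :=
  csInf_le (bddBelow_le_gaussCDF h) hz

theorem le_gaussCDF_gaussQuantile {τ : ℝ} (h : τ ∈ Set.Ioo (0 : ℝ) 1) :
    τ ≤ gaussCDF (gaussQuantile τ) := by
  obtain ⟨z, hz⟩ := exists_gaussCDF_eq h
  exact (isClosed_le continuous_const continuous_gaussCDF).csInf_mem ⟨z, hz.ge⟩
    (bddBelow_le_gaussCDF h.1)

theorem gaussCDF_zero : gaussCDF 0 = 1 / 2 := by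
  have := gaussCDF_neg 0
  rw [neg_zero] at this
  linarith

theorem le_of_gaussCDF_lt {a b : ℝ} (h : gaussCDF a < gaussCDF b) : a < b :=
  lt_of_not_ge fun hba => absurd (gaussCDF_mono hba) (not_le.2 h)

theorem gaussQuantile_nonneg {τ : ℝ} (h1 : 1 / 2 < τ) (h2 : τ < 1) : 0 ≤ gaussQuantile τ := by
  refine (le_of_gaussCDF_lt ?_).le
  rw [gaussCDF_zero]
  exact h1.trans_le (le_gaussCDF_gaussQuantile ⟨by linarith, h2⟩)

/-- Boundedness of the Edgeworth correction makes the supremum in `deltaE` a true one; an unbounded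
real supremum would take the default value 0. -/
theorem abs_hermite_mul_gaussianPDFReal_le (t : ℝ) : |(1 - t ^ 2) * gaussianPDFReal 0 1 t| ≤ 2 := by
  rw [abs_mul, abs_of_nonneg (gaussianPDFReal_nonneg 0 1 t)]
  have h1 : |1 - t ^ 2| ≤ 2 * (1 + t ^ 2 / 2) := by
    rw [abs_le]; constructor <;> nlinarith [sq_nonneg t]
  have h2 : (1 + t ^ 2 / 2) * Real.exp (-t ^ 2 / 2) ≤ 1 := by
    have : (1 + t ^ 2 / 2) ≤ Real.exp (t ^ 2 / 2) := by
      linarith [Real.add_one_le_exp (t ^ 2 / 2)]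
    calc _ ≤ Real.exp (t ^ 2 / 2) * Real.exp (-t ^ 2 / 2) := by gcongr
      _ = 1 := by rw [← Real.exp_add]; ring_nf; simp
  calc _ ≤ 2 * (1 + t ^ 2 / 2) * Real.exp (-t ^ 2 / 2) := by
        gcongr
        · exact gaussianPDFReal_nonneg 0 1 t
        · exact gaussianPDFReal_le_exp t
    _ ≤ 2 := by linarith

end Gaussian

/-! ### Two-sided probabilities from a uniform approximation of the distribution function -/

section TwoSided

variable {Ω : Type*} [MeasurableSpace Ω] {Q : Measure Ω} [IsProbabilityMeasure Q] {S : Ω → ℝ}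
  {G : ℝ → ℝ} {δ : ℝ}

theorem sub_le_measureReal_abs_le (h : ∀ t, |Q.real {w | S w ≤ t} - G t| ≤ δ) (z : ℝ) :
    G z - G (-z) - 2 * δ ≤ Q.real {w | |S w| ≤ z} := by
  have h1 : Q.real {w | S w ≤ z} ≤ Q.real {w | S w ≤ -z} + Q.real {w | |S w| ≤ z} := by
    refine le_trans (measureReal_mono fun w (hw : S w ≤ z) => ?_) (measureReal_union_le _ _)
    rcases le_or_gt (S w) (-z) with h | h
    · exact Or.inl h
    · exact Or.inr (abs_le.2 ⟨h.le, hw⟩)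
  have h2 := (abs_le.1 (h z)).1
  have h3 := (abs_le.1 (h (-z))).2
  linarith

theorem measureReal_abs_le_le (hS : Measurable S) (hG : Continuous G)
    (h : ∀ t, |Q.real {w | S w ≤ t} - G t| ≤ δ) {z : ℝ} (hz : 0 ≤ z) :
    Q.real {w | |S w| ≤ z} ≤ G z - G (-z) + 2 * δ := by
  -- The distribution function of `S` may jump at `-z`, so only `{S ≤ -z - ε}` is removed;
  -- continuity of `G` then permits `ε → 0`.
  have h1 : ∀ᶠ ε in 𝓝[>] (0 : ℝ), Q.real {w | |S w| ≤ z} ≤ G z - G (-z - ε) + 2 * δ := by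
    filter_upwards [self_mem_nhdsWithin] with ε (hε : 0 < ε)
    have h2 : Q.real {w | S w ≤ -z - ε} + Q.real {w | |S w| ≤ z} ≤ Q.real {w | S w ≤ z} := by
      rw [← measureReal_union _ (measurableSet_le hS.abs measurable_const)]
      · refine measureReal_mono fun w hw => ?_
        rcases hw with hw | hw
        · simp only [Set.mem_ofPred_eq] at hw ⊢; linarith
        · exact (le_abs_self (S w)).trans hw
      · refine Set.disjoint_left.2 fun w hw hw' => ?_
        simp only [Set.mem_ofPred_eq] at hw hw'
        linarith [(abs_le.1 hw').1]
    have h3 := (abs_le.1 (h z)).2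
    have h4 := (abs_le.1 (h (-z - ε))).1
    linarith
  refine ge_of_tendsto (x := 𝓝[>] (0 : ℝ)) ?_ h1
  have : Continuous fun ε => G z - G (-z - ε) + 2 * δ := by fun_prop
  have h2 := this.tendsto 0
  rw [sub_zero] at h2
  exact h2.mono_left nhdsWithin_le_nhds

/-! ### Application to the standardized sum -/

theorem abs_stdSumCDF_sub_le_deltaB (ν : Measure ℝ) [IsProbabilityMeasure ν] (n : ℕ) (t : ℝ) :
    |stdSumCDF ν n t - gaussCDF t| ≤ deltaB ν n := by
  refine le_ciSup (f := fun t => |stdSumCDF ν n t - gaussCDF t|) ⟨1, ?_⟩ t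
  rintro _ ⟨x, rfl⟩
  have h1 : stdSumCDF ν n x ≤ 1 := measureReal_le_one
  have h2 : 0 ≤ stdSumCDF ν n x := measureReal_nonneg
  have h3 := gaussCDF_le_one x
  have h4 := gaussCDF_nonneg x
  exact abs_le.2 ⟨by linarith, by linarith⟩

theorem abs_stdSumCDF_sub_le_deltaE (ν : Measure ℝ) [IsProbabilityMeasure ν] (n : ℕ) (t : ℝ) :
    |stdSumCDF ν n t - gaussCDF t - skewness ν / (6 * √n) * (1 - t ^ 2) * gaussianPDFReal 0 1 t|
      ≤ deltaE ν n := by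
  refine le_ciSup (f := fun t => |stdSumCDF ν n t - gaussCDF t
    - skewness ν / (6 * √n) * (1 - t ^ 2) * gaussianPDFReal 0 1 t|)
    ⟨1 + |skewness ν / (6 * √n)| * 2, ?_⟩ t
  rintro _ ⟨x, rfl⟩
  have h1 : stdSumCDF ν n x ≤ 1 := measureReal_le_one
  have h2 : 0 ≤ stdSumCDF ν n x := measureReal_nonneg
  have h3 := gaussCDF_le_one x
  have h4 := gaussCDF_nonneg x
  refine (abs_sub _ _).trans (add_le_add (abs_le.2 ⟨by linarith, by linarith⟩) ?_)
  rw [mul_assoc, abs_mul]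
  gcongr
  exact abs_hermite_mul_gaussianPDFReal_le x

/-- A continuous approximation of the distribution function of the standardized sum, within `δ`,
whose two-sided increments are those of the normal distribution function. -/
theorem exists_approx_stdSumCDF (ν : Measure ℝ) [IsProbabilityMeasure ν] {n : ℕ}
    (h : min (deltaE ν n) (deltaB ν n) ≤ δ) :
    ∃ G : ℝ → ℝ, Continuous G ∧ (∀ z, G z - G (-z) = 2 * gaussCDF z - 1) ∧
      ∀ t, |stdSumCDF ν n t - G t| ≤ δ := by
  rcases min_le_iff.1 h with h | h
  · refine ⟨fun t => gaussCDF t + skewness ν / (6 * √n) * (1 - t ^ 2) * gaussianPDFReal 0 1 t,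
      ?_, fun z => ?_, fun t => ?_⟩
    · have : Continuous fun t : ℝ => gaussianPDFReal 0 1 t := by
        unfold gaussianPDFReal; fun_prop
      have := continuous_gaussCDF
      fun_prop
    -- The correction `(1 - z²) φ(z)` is even, so it disappears from `G z - G (-z)`, whatever the
    -- skewness.
    · have e : gaussianPDFReal 0 1 (-z) = gaussianPDFReal 0 1 z := by simp [gaussianPDFReal]
      simp only [e, neg_sq, gaussCDF_neg]; ring
    · rw [← sub_sub]; exact (abs_stdSumCDF_sub_le_deltaE ν n t).trans h
  · exact ⟨gaussCDF, continuous_gaussCDF, fun z => by rw [gaussCDF_neg]; ring,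
      fun t => (abs_stdSumCDF_sub_le_deltaB ν n t).trans h⟩

theorem measurable_stdSum (ν : Measure ℝ) (n : ℕ) : Measurable (stdSum ν n) := by
  unfold stdSum; fun_prop

theorem le_measureReal_abs_stdSum_le (ν : Measure ℝ) [IsProbabilityMeasure ν] {n : ℕ}
    (h : min (deltaE ν n) (deltaB ν n) ≤ δ) (z : ℝ) :
    2 * gaussCDF z - 1 - 2 * δ ≤ (Measure.pi fun _ : Fin n => ν).real {x | |stdSum ν n x| ≤ z} := by
  obtain ⟨G, -, h2, h3⟩ := exists_approx_stdSumCDF ν h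
  rw [← h2]
  exact sub_le_measureReal_abs_le h3 z

theorem measureReal_abs_stdSum_le_le (ν : Measure ℝ) [IsProbabilityMeasure ν] {n : ℕ}
    (h : min (deltaE ν n) (deltaB ν n) ≤ δ) {z : ℝ} (hz : 0 ≤ z) :
    (Measure.pi fun _ : Fin n => ν).real {x | |stdSum ν n x| ≤ z} ≤ 2 * gaussCDF z - 1 + 2 * δ := by
  obtain ⟨G, h1, h2, h3⟩ := exists_approx_stdSumCDF ν h
  rw [← h2]
  exact measureReal_abs_le_le (measurable_stdSum ν n) h1 h3 hz

theorem min_delta_nonneg (ν : Measure ℝ) (n : ℕ) : 0 ≤ min (deltaE ν n) (deltaB ν n) :=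
  le_min (Real.iSup_nonneg fun _ => abs_nonneg _) (Real.iSup_nonneg fun _ => abs_nonneg _)

end TwoSided


/-! ### Measurability of the interval -/

section Measurability

variable {p n : ℕ} {Ω : Type*} [MeasurableSpace Ω]

theorem measurable_vec {f : Ω → Vec p} (h : ∀ i, Measurable fun w => f w i) : Measurable f :=
  (WithLp.measurable_toLp 2 (Fin p → ℝ)).comp (measurable_pi_iff.2 h)

theorem measurable_coord {f : Ω → Vec p} (h : Measurable f) (i : Fin p) :
    Measurable fun w => f w i :=
  (measurable_pi_apply i).comp ((WithLp.measurable_ofLp 2 (Fin p → ℝ)).comp h)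

theorem measurable_act {A : Ω → Mat p} {x : Ω → Vec p} (hA : ∀ i j, Measurable fun w => A w i j)
    (hx : Measurable x) : Measurable fun w => act (A w) (x w) :=
  measurable_vec fun i => by
    simp only [act_apply]
    exact Finset.measurable_fun_sum _ fun j _ => (hA i j).mul (measurable_coord hx j)

theorem measurable_mul_apply {A B : Ω → Mat p} (hA : ∀ i j, Measurable fun w => A w i j)
    (hB : ∀ i j, Measurable fun w => B w i j) (i j : Fin p) :
    Measurable fun w => (A w * B w) i j := by
  simp only [Matrix.mul_apply]
  exact Finset.measurable_fun_sum _ fun k _ => (hA i k).mul (hB k j)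

theorem measurable_outer_apply {x : Ω → Vec p} (hx : Measurable x) (i j : Fin p) :
    Measurable fun w => outer (x w) i j :=
  (measurable_coord hx i).mul (measurable_coord hx j)

theorem measurable_average_apply {A : Fin n → Ω → Mat p}
    (hA : ∀ k i j, Measurable fun w => A k w i j) (i j : Fin p) :
    Measurable fun w => ((n : ℝ)⁻¹ • ∑ k, A k w) i j := by
  simp only [Matrix.smul_apply, Matrix.sum_apply, smul_eq_mul]
  exact (Finset.measurable_fun_sum _ fun k _ => hA k i j).const_mul _

theorem measurable_fst_eval (i : Fin n) : Measurable fun s : Fin n → Vec p × ℝ => (s i).1 :=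
  measurable_fst.comp (measurable_pi_apply i)

theorem measurable_snd_eval (i : Fin n) : Measurable fun s : Fin n → Vec p × ℝ => (s i).2 :=
  measurable_snd.comp (measurable_pi_apply i)

theorem measurable_gram_apply (i j : Fin p) :
    Measurable fun s : Fin n → Vec p × ℝ => gram s i j :=
  measurable_average_apply (fun k => measurable_outer_apply (measurable_fst_eval k)) i j

theorem measurable_olsBeta : Measurable (olsBeta : (Fin n → Vec p × ℝ) → Vec p) :=
  measurable_act (measurable_pinv measurable_gram_apply) (by
    have h : ∀ i : Fin n, Measurable fun s : Fin n → Vec p × ℝ => (s i).2 • (s i).1 :=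
      fun i => (measurable_snd_eval i).smul (measurable_fst_eval i)
    fun_prop)

theorem measurable_resid (i : Fin n) : Measurable fun s : Fin n → Vec p × ℝ => resid s i :=
  (measurable_snd_eval i).sub ((measurable_fst_eval i).inner measurable_olsBeta)

theorem measurable_Vhat_apply (i j : Fin p) :
    Measurable fun s : Fin n → Vec p × ℝ => Vhat s i j :=
  measurable_mul_apply (measurable_mul_apply (measurable_pinv measurable_gram_apply)
    (measurable_average_apply fun k i j =>
      ((measurable_resid k).pow_const 2).mul (measurable_outer_apply (measurable_fst_eval k) i j)))
    (measurable_pinv measurable_gram_apply) i j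

theorem measurable_Rvar (c : Bounds) (γ : ℝ) :
    Measurable fun s : Fin n → Vec p × ℝ => Rvar c s γ := by
  have h1 : Measurable fun s : Fin n → Vec p × ℝ => specNorm ((n : ℝ)⁻¹ • ∑ i, resid s i ^ 2
      • (outer (s i).1 * pinv (gram s))) :=
    measurable_specNorm (measurable_average_apply fun k i j =>
      ((measurable_resid k).pow_const 2).mul (measurable_mul_apply
        (measurable_outer_apply (measurable_fst_eval k)) (measurable_pinv measurable_gram_apply)
        i j))
  have h2 : ∀ i, Measurable fun s : Fin n → Vec p × ℝ => resid s i := measurable_resid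
  have h3 : ∀ i, Measurable fun s : Fin n → Vec p × ℝ => (s i).1 := measurable_fst_eval
  unfold Rvar
  fun_prop

theorem measurable_halfWidth (u : Vec p) (c : Bounds) (t : Tuning) (α : ℝ) :
    Measurable fun s : Fin n → Vec p × ℝ => halfWidth u c t α s := by
  have h1 : Measurable fun s : Fin n → Vec p × ℝ => Rvar c s (t.ω n * α / 2) :=
    measurable_Rvar c _
  have h2 : Measurable fun s : Fin n → Vec p × ℝ => (inner ℝ u (act (Vhat s) u) : ℝ) :=
    measurable_const.inner (measurable_act measurable_Vhat_apply measurable_const)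
  unfold halfWidth enlargedVar
  fun_prop

theorem measurableSet_mem_ciEdg (u : Vec p) (c : Bounds) (t : Tuning) (α : ℝ) (n : ℕ) (x : ℝ) :
    MeasurableSet {s : Fin n → Vec p × ℝ | x ∈ ciEdg u c t α n s} := by
  by_cases h : (n : ℕ∞) ≤ nZero c t α
  · simp [ciEdg, h]
  · have h1 : Measurable fun s : Fin n → Vec p × ℝ => (inner ℝ u (olsBeta s) : ℝ) :=
      measurable_const.inner measurable_olsBeta
    have h2 := measurable_halfWidth (n := n) u c t α
    simp only [ciEdg, h, if_false, Set.mem_Icc]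
    exact (measurableSet_le (h1.sub h2) measurable_const).inter
      (measurableSet_le measurable_const (h1.add h2))

theorem isConfidenceSeq_ciEdg (u : Vec p) (c : Bounds) (t : Tuning) (α : ℝ) :
    IsConfidenceSeq (ciEdg u c t α) (target u) (linearModel p) := by
  refine ⟨fun n s => ?_, fun n _ θ _ => measurableSet_mem_ciEdg u c t α n _⟩
  unfold ciEdg
  split_ifs
  · exact MeasurableSet.univ
  · exact measurableSet_Icc

instance (θ : Param p) : IsProbabilityMeasure (errLaw θ) := θ.2.2

/-- Coverage is moved to samples of `(X, ε)`, where `ξ` and the errors are functions of the sample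
point. -/
theorem coverage_ciEdg (u : Vec p) (c : Bounds) (t : Tuning) (α : ℝ) (θ : Param p) (n : ℕ) :
    coverage (ciEdg u c t α) (obsLaw θ) n (target u θ)
      = (Measure.pi fun _ : Fin n => errLaw θ).real
        {s | target u θ ∈ ciEdg u c t α n (observe θ.1 s)} := by
  have hf : Measurable fun z : Vec p × ℝ => (z.1, inner ℝ z.1 θ.1 + z.2) :=
    measurable_fst.prodMk ((measurable_fst.inner measurable_const).add measurable_snd)
  have _ : IsProbabilityMeasure (obsLaw θ) := Measure.isProbabilityMeasure_map hf.aemeasurable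
  have _ : ∀ _ : Fin n, SigmaFinite ((errLaw θ).map fun z => (z.1, inner ℝ z.1 θ.1 + z.2)) :=
    fun _ => inferInstanceAs (SigmaFinite (obsLaw θ))
  have h := Measure.pi_map_pi (μ := fun _ : Fin n => errLaw θ)
    (f := fun _ z => (z.1, inner ℝ z.1 θ.1 + z.2)) fun _ => hf.aemeasurable
  have hm : Measurable fun (s : Fin n → Vec p × ℝ) i => ((s i).1, inner ℝ (s i).1 θ.1 + (s i).2) :=
    measurable_pi_iff.2 fun i => hf.comp (measurable_pi_apply i)
  rw [coverage]
  simp only [obsLaw]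
  rw [← h, map_measureReal_apply hm (measurableSet_mem_ciEdg u c t α n _)]
  rfl

end Measurability


/-! ### Population moments -/

section Population

open scoped Matrix.Norms.L2Operator

variable {p : ℕ} {u : Vec p} {c : Bounds} {θ : Param p}

theorem inner_act_eq_sum (M : Mat p) (x y : Vec p) :
    inner ℝ x (act M y) = ∑ i, ∑ j, x i * y j * M i j := by
  simp only [PiLp.inner_apply, act_apply, RCLike.inner_apply, conj_trivial, Finset.sum_mul]
  exact Finset.sum_congr rfl fun i _ => Finset.sum_congr rfl fun j _ => by ring

theorem apply_eq_inner_act (M : Mat p) (i j : Fin p) :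
    M i j = inner ℝ (EuclideanSpace.single i (1 : ℝ)) (act M (EuclideanSpace.single j 1)) := by
  simp [EuclideanSpace.inner_single_left, act_apply]

theorem inner_act_integral {α : Type*} [MeasurableSpace α] {P : Measure α} {A : α → Mat p}
    (hA : ∀ i j, Integrable (fun z => A z i j) P) (x y : Vec p) :
    inner ℝ x (act (Matrix.of fun i j => ∫ z, A z i j ∂P) y)
      = ∫ z, inner ℝ x (act (A z) y) ∂P := by
  simp_rw [inner_act_eq_sum, Matrix.of_apply]
  rw [integral_finsetSum _ fun i _ => integrable_finsetSum _ fun j _ => (hA i j).const_mul _]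
  refine Finset.sum_congr rfl fun i _ => ?_
  rw [integral_finsetSum _ fun j _ => (hA i j).const_mul _]
  exact Finset.sum_congr rfl fun j _ => by rw [integral_const_mul]

theorem abs_outer_apply_le (x : Vec p) (i j : Fin p) : |outer x i j| ≤ ‖x‖ ^ 2 := by
  have h := fun k => PiLp.norm_apply_le x k
  simp only [Real.norm_eq_abs] at h
  rw [outer, Matrix.vecMulVec_apply, abs_mul, sq]
  exact mul_le_mul (h i) (h j) (abs_nonneg _) (norm_nonneg _)

theorem integrable_norm_sq_fst (hθ : θ ∈ linearModel p) :
    Integrable (fun z => ‖z.1‖ ^ 2) (errLaw θ) :=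
  integrable_norm_pow_of_le (by norm_num) measurable_fst.aestronglyMeasurable hθ.1

theorem measurable_score (p : ℕ) : Measurable fun z : Vec p × ℝ => z.2 • z.1 :=
  measurable_snd.smul measurable_fst

theorem integrable_score (hθ : θ ∈ linearModel p) :
    Integrable (fun z => z.2 • z.1) (errLaw θ) :=
  integrable_of_norm_pow one_le_two (measurable_score p).aestronglyMeasurable hθ.2.1

theorem integrable_outer_apply (hθ : θ ∈ linearModel p) (i j : Fin p) :
    Integrable (fun z => outer z.1 i j) (errLaw θ) :=
  (integrable_norm_sq_fst hθ).mono' (measurable_outer_apply measurable_fst i j).aestronglyMeasurable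
    (ae_of_all _ fun z => abs_outer_apply_le z.1 i j)

theorem integrable_sq_mul_outer_apply (hθ : θ ∈ linearModel p) (i j : Fin p) :
    Integrable (fun z => z.2 ^ 2 * outer z.1 i j) (errLaw θ) := by
  refine hθ.2.1.mono' ((measurable_snd.pow_const 2).mul
    (measurable_outer_apply measurable_fst i j)).aestronglyMeasurable (ae_of_all _ fun z => ?_)
  rw [norm_mul, norm_pow, norm_smul, mul_pow, Real.norm_eq_abs (outer _ _ _)]
  gcongr
  exact abs_outer_apply_le z.1 i j

theorem momXX_transpose (θ : Param p) : (momXX θ).transpose = momXX θ := by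
  ext i j
  simp only [momXX, Matrix.transpose_apply, Matrix.of_apply, outer, Matrix.vecMulVec_apply, mul_comm]

theorem momXXee_transpose (θ : Param p) : (momXXee θ).transpose = momXXee θ := by
  ext i j
  simp only [momXXee, Matrix.transpose_apply, Matrix.of_apply, outer, Matrix.vecMulVec_apply,
    mul_comm]

theorem inner_act_momXX (hθ : θ ∈ linearModel p) (x y : Vec p) :
    inner ℝ x (act (momXX θ) y) = ∫ z, inner ℝ x z.1 * inner ℝ z.1 y ∂errLaw θ := by
  rw [momXX, inner_act_integral (integrable_outer_apply hθ)]
  simp only [act_outer, real_inner_smul_right, mul_comm]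

theorem inner_act_momXXee (hθ : θ ∈ linearModel p) (x : Vec p) :
    inner ℝ x (act (momXXee θ) x) = ∫ z, (inner ℝ x z.1 * z.2) ^ 2 ∂errLaw θ := by
  have h := inner_act_integral (A := fun z : Vec p × ℝ => z.2 ^ 2 • outer z.1)
    (integrable_sq_mul_outer_apply hθ) x x
  refine h.trans (integral_congr_ae (ae_of_all _ fun z => ?_))
  simp only [act_smul, act_outer, real_inner_smul_right, real_inner_comm x z.1]
  ring

theorem isInvSqrt_momXX (hθ : θ ∈ linearModel p) :
    IsInvSqrt (momXX θ) (invSqrt (momXX θ)) :=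
  isInvSqrt_invSqrt (momXX_transpose θ) hθ.2.2.2.1

theorem norm_momXX_le (hθ : θ ∈ linearModel p) : ‖momXX θ‖ ≤ ∫ z, ‖z.1‖ ^ 2 ∂errLaw θ := by
  set C := ∫ z, ‖z.1‖ ^ 2 ∂errLaw θ with hC
  have hC0 : 0 ≤ C := integral_nonneg fun z => by positivity
  refine norm_le_of_act_le hC0 fun y => ?_
  have key : ∀ x : Vec p, inner ℝ x (act (momXX θ) y) ≤ C * (‖x‖ * ‖y‖) := fun x => by
    rw [inner_act_momXX hθ, hC, ← integral_mul_const]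
    refine (Real.le_norm_self _).trans (norm_integral_le_of_norm_le
      ((integrable_norm_sq_fst hθ).mul_const _) (ae_of_all _ fun z => ?_))
    rw [norm_mul]
    calc _ ≤ (‖x‖ * ‖z.1‖) * (‖z.1‖ * ‖y‖) :=
          mul_le_mul (norm_inner_le_norm _ _) (norm_inner_le_norm _ _) (norm_nonneg _)
            (by positivity)
      _ = _ := by ring
  -- Testing the bilinear bound at `x = M y` gives `‖M y‖² ≤ C ‖M y‖ ‖y‖`.
  have h := key (act (momXX θ) y)
  rw [real_inner_self_eq_norm_sq] at h
  generalize ‖act (momXX θ) y‖ = r at h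
  by_contra! hlt
  have hr : 0 < r := lt_of_le_of_lt (by positivity) hlt
  have := mul_lt_mul_of_pos_left hlt hr
  linarith

/-! ### The influence function and its law -/

theorem infl_eq_inner (hθ : θ ∈ linearModel p) (z : Vec p × ℝ) :
    infl u θ z = inner ℝ (act (momXX θ)⁻¹ u) z.1 * z.2 := by
  have h := isInvSqrt_momXX hθ
  have hs : ((momXX θ)⁻¹).transpose = (momXX θ)⁻¹ := by
    rw [h.inv_eq, Matrix.transpose_mul, h.symm]
  rw [infl, inner_act_of_symm hs]

theorem act_momXX_act_inv (hθ : θ ∈ linearModel p) (u : Vec p) :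
    act (momXX θ) (act (momXX θ)⁻¹ u) = u := by
  have h := isInvSqrt_momXX hθ
  rw [← act_mul, h.inv_eq, h.mul_mul_self, act_one]

theorem integral_infl_sq (hθ : θ ∈ linearModel p) :
    ∫ z, infl u θ z ^ 2 ∂errLaw θ
      = inner ℝ (act (momXX θ)⁻¹ u) (act (momXXee θ) (act (momXX θ)⁻¹ u)) := by
  rw [inner_act_momXXee hθ]
  simp_rw [infl_eq_inner hθ]

theorem integral_infl_sq_ge (hθ : θ ∈ linearModel p) {l : ℝ} (hl : l ≤ lambdaMin (momXXee θ)) :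
    l * ‖act (momXX θ)⁻¹ u‖ ^ 2 ≤ ∫ z, infl u θ z ^ 2 ∂errLaw θ := by
  rw [integral_infl_sq hθ]
  exact le_inner_act_of_le_lambdaMin (momXXee_transpose θ) hl _

theorem integral_infl_sq_pos (hθ : θ ∈ linearModel p) (hu : u ≠ 0) :
    0 < ∫ z, infl u θ z ^ 2 ∂errLaw θ := by
  refine lt_of_lt_of_le ?_ (integral_infl_sq_ge hθ le_rfl)
  have : act (momXX θ)⁻¹ u ≠ 0 := fun h => hu (by
    rw [← act_momXX_act_inv hθ u, h]; simp [act])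
  have := norm_pos_iff.2 this
  have := hθ.2.2.2.2
  positivity

theorem measurable_infl (u : Vec p) (θ : Param p) : Measurable (infl u θ) :=
  (measurable_const.inner
    (measurable_act (A := fun _ => (momXX θ)⁻¹) (fun _ _ => measurable_const) measurable_fst)).mul
    measurable_snd

theorem infl_eq_inner_score (hθ : θ ∈ linearModel p) (z : Vec p × ℝ) :
    infl u θ z = inner ℝ (act (momXX θ)⁻¹ u) (z.2 • z.1) := by
  rw [infl_eq_inner hθ, real_inner_smul_right, mul_comm]

theorem integral_infl (hθ : θ ∈ linearModel p) : ∫ z, infl u θ z ∂errLaw θ = 0 := by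
  simp_rw [infl_eq_inner_score hθ]
  rw [integral_inner (integrable_score hθ), hθ.2.2.1, inner_zero_right]

instance (u : Vec p) (θ : Param p) : IsProbabilityMeasure (inflLaw u θ) :=
  Measure.isProbabilityMeasure_map (measurable_infl u θ).aemeasurable

theorem integral_id_inflLaw (hθ : θ ∈ linearModel p) : ∫ y, y ∂inflLaw u θ = 0 := by
  rw [inflLaw, integral_map (measurable_infl u θ).aemeasurable (by fun_prop), integral_infl hθ]

theorem stdDev_inflLaw (hθ : θ ∈ linearModel p) :
    stdDev (inflLaw u θ) = √(∫ z, infl u θ z ^ 2 ∂errLaw θ) := by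
  rw [stdDev, variance_of_integral_eq_zero (by fun_prop) (integral_id_inflLaw hθ), inflLaw,
    integral_map (measurable_infl u θ).aemeasurable (by fun_prop)]

theorem stdSum_inflLaw (hθ : θ ∈ linearModel p) {n : ℕ} (s : Fin n → Vec p × ℝ) :
    stdSum (inflLaw u θ) n (fun i => infl u θ (s i))
      = (∑ i, infl u θ (s i)) / (√(∫ z, infl u θ z ^ 2 ∂errLaw θ) * √n) := by
  simp only [stdSum, integral_id_inflLaw hθ, sub_zero, stdDev_inflLaw hθ]

theorem measureReal_stdSum_infl (n : ℕ) (z : ℝ) :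
    (Measure.pi fun _ : Fin n => errLaw θ).real
        {s | |stdSum (inflLaw u θ) n (fun i => infl u θ (s i))| ≤ z}
      = (Measure.pi fun _ : Fin n => inflLaw u θ).real {x | |stdSum (inflLaw u θ) n x| ≤ z} := by
  have _ : ∀ _ : Fin n, SigmaFinite ((errLaw θ).map (infl u θ)) :=
    fun _ => inferInstanceAs (SigmaFinite (inflLaw u θ))
  have h := Measure.pi_map_pi (μ := fun _ : Fin n => errLaw θ)
    (f := fun _ => infl u θ) fun _ => (measurable_infl u θ).aemeasurable
  have hm : Measurable fun (s : Fin n → Vec p × ℝ) i => infl u θ (s i) :=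
    measurable_pi_iff.2 fun i => (measurable_infl u θ).comp (measurable_pi_apply i)
  have h' : (Measure.pi fun _ : Fin n => inflLaw u θ)
      = (Measure.pi fun _ : Fin n => errLaw θ).map fun s i => infl u θ (s i) := h.symm
  rw [h', map_measureReal_apply hm
    (measurableSet_le (measurable_stdSum (inflLaw u θ) n).abs measurable_const)]
  rfl

/-! ### The rotated score and the rotated Gram matrix are centred -/

theorem integral_rotated_score (hθ : θ ∈ linearModel p) :
    ∫ z, z.2 • rotated θ z.1 ∂errLaw θ = 0 := by
  have e : ∀ z : Vec p × ℝ, z.2 • rotated θ z.1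
      = Matrix.toEuclideanCLM (𝕜 := ℝ) (invSqrt (momXX θ)) (z.2 • z.1) := fun z => by
    rw [map_smul]; rfl
  simp_rw [e]
  rw [ContinuousLinearMap.integral_comp_comm _ (integrable_score hθ), hθ.2.2.1, map_zero]

theorem measurable_rotated (θ : Param p) : Measurable (rotated θ) :=
  measurable_act (A := fun _ => invSqrt (momXX θ)) (fun _ _ => measurable_const) measurable_id

/-- The vectorized deviation of the rotated Gram matrix of one observation from the identity. -/
def gramDev (θ : Param p) (z : Vec p × ℝ) : EuclideanSpace ℝ (Fin p × Fin p) :=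
  WithLp.toLp 2 (Matrix.vec (outer (rotated θ z.1) - 1))

theorem measurable_gramDev (θ : Param p) : Measurable (gramDev θ) := by
  refine (WithLp.measurable_toLp 2 _).comp (measurable_pi_iff.2 fun k => ?_)
  exact (measurable_outer_apply ((measurable_rotated θ).comp measurable_fst) k.2 k.1).sub
    measurable_const

theorem integral_gramDev (hθ : θ ∈ linearModel p) (hi : Integrable (gramDev θ) (errLaw θ)) :
    ∫ z, gramDev θ z ∂errLaw θ = 0 := by
  have h := isInvSqrt_momXX hθ
  -- Vectorization stacks columns, so the coordinate `(j, i)` is the entry in row `i` and column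
  -- `j`.
  ext ⟨j, i⟩
  rw [eval_integral_piLp fun k => hi.eval_piLp k]
  have e : ∀ z, gramDev θ z (j, i) = inner ℝ (act (invSqrt (momXX θ)) (EuclideanSpace.single i 1))
      (act (outer z.1) (act (invSqrt (momXX θ)) (EuclideanSpace.single j 1)))
        - (1 : Mat p) i j := fun z => by
    change (outer (rotated θ z.1) - 1) i j = _
    rw [Matrix.sub_apply, rotated, ← mul_outer_mul h.symm, apply_eq_inner_act (_ * _ * _),
      inner_act_of_symm h.symm, act_mul, act_mul]
  have e1 : inner ℝ (act (invSqrt (momXX θ)) (EuclideanSpace.single i 1))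
      (act (momXX θ) (act (invSqrt (momXX θ)) (EuclideanSpace.single j 1))) = (1 : Mat p) i j := by
    rw [inner_act_of_symm h.symm, ← act_mul, ← act_mul, h.conj,
      apply_eq_inner_act 1]
  have hk : Integrable (fun z => gramDev θ z (j, i) + (1 : Mat p) i j) (errLaw θ) :=
    (hi.eval_piLp (j, i)).add (integrable_const _)
  simp_rw [e, sub_add_cancel] at hk
  simp_rw [e]
  rw [integral_sub hk (integrable_const _), ← inner_act_integral (integrable_outer_apply hθ)]
  have e2 : (Matrix.of fun i j => ∫ z, outer z.1 i j ∂errLaw θ) = momXX θ := rfl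
  rw [e2, e1]
  simp

/-! ### Probabilities of the exceptional events -/

theorem measureReal_gramDev_le (hc : c.Pos) (hθ : θ ∈ thetaEE u c) {n : ℕ} (hn : 0 < n) {γ : ℝ}
    (hγ : 0 < γ) :
    (Measure.pi fun _ : Fin n => errLaw θ).real
      {s | gammaTilde c n γ
        < specNorm ((n : ℝ)⁻¹ • ∑ i, outer (act (invSqrt (momXX θ)) (s i).1) - 1)} ≤ γ := by
  obtain ⟨h1, h2, h3, -⟩ := hc
  obtain ⟨hL, -, ⟨hi, hK⟩, -⟩ := hθ
  have hn' : (0 : ℝ) < n := by exact_mod_cast hn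
  have hi' : Integrable (fun z => ‖gramDev θ z‖ ^ 2) (errLaw θ) := hi
  have hK' : ∫ z, ‖gramDev θ z‖ ^ 2 ∂errLaw θ ≤ c.Kreg := hK
  have hm := (measurable_gramDev θ).stronglyMeasurable
  have h0 := integral_gramDev hL (integrable_of_norm_pow one_le_two hm.aestronglyMeasurable hi')
  have hs := integral_norm_sum_sq hm hi' h0 n
  have hg2 : gammaTilde c n γ ^ 2 = c.Kreg / (n * γ) := Real.sq_sqrt (by positivity)
  have hsub : {s : Fin n → Vec p × ℝ | gammaTilde c n γ
        < specNorm ((n : ℝ)⁻¹ • ∑ i, outer (act (invSqrt (momXX θ)) (s i).1) - 1)}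
      -- The threshold is `(n γ̃)²`; Markov's inequality with second moment at most `n K_reg` then
      -- gives exactly `γ`.
      ⊆ {s | n * c.Kreg / γ < ‖∑ i, gramDev θ (s i)‖ ^ 2} := by
    intro s hs
    have e : (n : ℝ)⁻¹ • ∑ i, outer (act (invSqrt (momXX θ)) (s i).1) - 1
        = (n : ℝ)⁻¹ • ∑ i, (outer (act (invSqrt (momXX θ)) (s i).1) - 1) := by
      rw [Finset.sum_sub_distrib, smul_sub]
      simp only [Finset.sum_const, Finset.card_univ, Fintype.card_fin]
      rw [← Nat.cast_smul_eq_nsmul ℝ, smul_smul, inv_mul_cancel₀ hn'.ne', one_smul]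
    have e2 : WithLp.toLp 2 (Matrix.vec ((n : ℝ)⁻¹
        • ∑ i, (outer (act (invSqrt (momXX θ)) (s i).1) - 1)))
        = (n : ℝ)⁻¹ • ∑ i, gramDev θ (s i) := by
      ext k
      simp [gramDev, rotated, Matrix.vec, Matrix.sum_apply, Matrix.natCast_apply, Matrix.one_apply]
    have h := lt_of_lt_of_le (show gammaTilde c n γ < _ from hs) (norm_le_norm_vec _)
    rw [e, e2, norm_smul, Real.norm_of_nonneg (by positivity), ← div_eq_inv_mul,
      lt_div_iff₀ hn'] at h
    have h' := pow_lt_pow_left₀ h (mul_nonneg (gammaTilde_nonneg c n γ) hn'.le) two_ne_zero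
    rw [mul_pow, hg2] at h'
    refine lt_of_eq_of_lt ?_ h'
    field_simp
  refine (measureReal_mono hsub).trans ?_
  refine (measureReal_lt_le_div_of_integral_le (fun s => by positivity) hs.1
    (b := n * c.Kreg / γ) (C := n * c.Kreg) (by positivity) ?_).trans_eq ?_
  · rw [hs.2]; gcongr
  · field_simp

theorem measureReal_score_le (hc : c.Pos) (hθ : θ ∈ thetaEE u c) {n : ℕ} (hn : 0 < n) {γ : ℝ}
    (hγ : 0 < γ) :
    (Measure.pi fun _ : Fin n => errLaw θ).real
      {s | √2 * (c.Keps / γ) ^ (1 / 4 : ℝ) / √n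
        < ‖(n : ℝ)⁻¹ • ∑ i, (s i).2 • act (invSqrt (momXX θ)) (s i).1‖} ≤ γ := by
  obtain ⟨h1, h2, h3, -⟩ := hc
  obtain ⟨hL, -, -, ⟨hi, hK⟩, -⟩ := hθ
  have hn' : (0 : ℝ) < n := by exact_mod_cast hn
  have hm : StronglyMeasurable fun z : Vec p × ℝ => z.2 • rotated θ z.1 :=
    (measurable_snd.smul ((measurable_rotated θ).comp measurable_fst)).stronglyMeasurable
  have hs := integral_norm_sum_pow_four_le hm hi (integral_rotated_score hL) n
  have hh : ((c.Keps / γ) ^ (1 / 4 : ℝ)) ^ 4 = c.Keps / γ := by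
    rw [← Real.rpow_natCast, ← Real.rpow_mul (by positivity)]; norm_num
  have hsn : √(n : ℝ) ^ 4 = (n : ℝ) ^ 2 := by
    rw [show (4 : ℕ) = 2 * 2 by norm_num, pow_mul, Real.sq_sqrt hn'.le]
  have hs2 : √(2 : ℝ) ^ 4 = 4 := by
    rw [show (4 : ℕ) = 2 * 2 by norm_num, pow_mul, Real.sq_sqrt zero_le_two]; norm_num
  have hsub : {s : Fin n → Vec p × ℝ | √2 * (c.Keps / γ) ^ (1 / 4 : ℝ) / √n
        < ‖(n : ℝ)⁻¹ • ∑ i, (s i).2 • act (invSqrt (momXX θ)) (s i).1‖}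
      -- The factor `√2` in the bound becomes 4 at the fourth power and dominates the 3 of the
      -- fourth-moment inequality, leaving `3γ/4`.
      ⊆ {s | 4 * c.Keps * n ^ 2 / γ < ‖∑ i, (s i).2 • rotated θ (s i).1‖ ^ 4} := by
    intro s hs
    have h := hs
    rw [Set.mem_ofPred_eq] at h
    rw [norm_smul, Real.norm_of_nonneg (by positivity), ← div_eq_inv_mul, lt_div_iff₀ hn'] at h
    have h' := pow_lt_pow_left₀ h (by positivity) four_ne_zero
    rw [mul_pow, div_pow, mul_pow, hh, hsn, hs2] at h'
    refine lt_of_eq_of_lt ?_ h'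
    field_simp
  refine (measureReal_mono hsub).trans ?_
  refine (measureReal_lt_le_div_of_integral_le (fun s => by positivity) hs.1
    (b := 4 * c.Keps * n ^ 2 / γ) (C := 3 * n ^ 2 * c.Keps) (by positivity) ?_).trans ?_
  · exact hs.2.trans (by gcongr)
  · rw [div_div_eq_mul_div, div_le_iff₀ (by positivity)]
    nlinarith [mul_pos (mul_pos h3 hγ) (pow_pos hn' 2)]

theorem measureReal_goodEvent_compl_le (hc : c.Pos) (hθ : θ ∈ thetaEE u c) {n : ℕ} (hn : 0 < n)
    {γ : ℝ} (hγ : 0 < γ) :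
    (Measure.pi fun _ : Fin n => errLaw θ).real (goodEvent c (invSqrt (momXX θ)) n γ)ᶜ
      ≤ 2 * γ := by
  refine (measureReal_mono (fun s hs => ?_)).trans ((measureReal_union_le _ _).trans
    ((add_le_add (measureReal_gramDev_le hc hθ hn hγ) (measureReal_score_le hc hθ hn hγ)).trans_eq
      (two_mul γ).symm))
  rw [Set.mem_compl_iff, goodEvent, Set.mem_ofPred_eq, not_and_or, not_le, not_le] at hs
  exact hs

/-- The Chernoff bound for `ξ²` at level `σ²/a`: the exponent is `n σ⁴ (1 - 1/a)² / (2 E[ξ⁴])`, and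
the kurtosis bound eliminates the unknown moments. -/
theorem measureReal_mean_sq_infl_le (hu : u ≠ 0) (hc : c.Pos) (hθ : θ ∈ thetaEE u c) {n : ℕ}
    (hn : 0 < n) {a : ℝ} (ha : 1 < a) :
    (Measure.pi fun _ : Fin n => errLaw θ).real
      {s | (n : ℝ)⁻¹ * ∑ i, infl u θ (s i) ^ 2 ≤ (∫ z, infl u θ z ^ 2 ∂errLaw θ) / a}
      ≤ Real.exp (-(n * (1 - 1 / a) ^ 2 / (2 * c.Kxi))) := by
  obtain ⟨hL, -, -, -, ⟨hi, hK⟩⟩ := hθ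
  have hσ := integral_infl_sq_pos hL hu
  have hi4 : Integrable (fun z => ‖infl u θ z‖ ^ 4) (errLaw θ) := by
    simpa only [Real.norm_eq_abs, Even.pow_abs (by decide : Even 4)] using hi
  have hi2 : Integrable (fun z => infl u θ z ^ 2) (errLaw θ) := by
    simpa only [Real.norm_eq_abs, sq_abs] using integrable_norm_pow_of_le (by norm_num : 2 ≤ 4)
      (measurable_infl u θ).aestronglyMeasurable hi4
  have hv : (∫ z, infl u θ z ^ 2 ∂errLaw θ) ^ 2 ≤ ∫ z, infl u θ z ^ 4 ∂errLaw θ := by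
    have := sq_integral_norm_sq_le (measurable_infl u θ).stronglyMeasurable hi4
    simpa only [Real.norm_eq_abs, Even.pow_abs (by decide : Even 4), sq_abs] using this
  have e : ∀ z, (infl u θ z ^ 2) ^ 2 = infl u θ z ^ 4 := fun z => by ring
  set σ2 := ∫ z, infl u θ z ^ 2 ∂errLaw θ with hσ2
  set v := ∫ z, infl u θ z ^ 4 ∂errLaw θ with hv4
  have hv0 : 0 < v := (pow_pos hσ 2).trans_le hv
  have h := measureReal_average_le_exp (P := errLaw θ) (X := fun z => infl u θ z ^ 2)
    ((measurable_infl u θ).pow_const 2) (fun z => sq_nonneg _) hi2 (by simpa only [e] using hi)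
    (b := σ2 / a) (by simp only [e]; exact hv0)
    (by rw [← hσ2]; exact div_le_self hσ.le ha.le) hn
  simp only [e] at h
  rw [← hσ2, ← hv4] at h
  refine h.trans (Real.exp_le_exp.2 (neg_le_neg ?_))
  rw [div_le_iff₀ (pow_pos hσ 2)] at hK
  have e2 : (σ2 - σ2 / a) ^ 2 = σ2 ^ 2 * (1 - 1 / a) ^ 2 := by ring
  rw [e2, div_le_div_iff₀ (by linarith [hc.2.2.2]) (by linarith)]
  nlinarith [mul_le_mul_of_nonneg_left hK (mul_nonneg n.cast_nonneg (sq_nonneg (1 - 1 / a)) :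
    (0 : ℝ) ≤ n * (1 - 1 / a) ^ 2)]

end Population


/-! ### Non-asymptotic validity -/

section Validity

variable {p n : ℕ} {u : Vec p} {c : Bounds} {t : Tuning} {α : ℝ} {θ : Param p}

theorem lt_of_not_le_nZero (hn : 1 ≤ n) (h : ¬ (n : ℕ∞) ≤ nZero c t α) :
    2 * c.Kreg / (t.ω n * α) < n ∧ nuEdg c t α n < α / 2 := by
  by_contra h'
  rw [not_and_or, not_lt, not_lt] at h'
  exact h (le_iSup₂ (f := fun (m : ℕ) (_ : 1 ≤ m ∧ ((m : ℝ) ≤ 2 * c.Kreg / (t.ω m * α) ∨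
    α / 2 ≤ nuEdg c t α m)) => (m : ℕ∞)) n ⟨hn, h'⟩)

theorem gammaTilde_lt_one {γ : ℝ} (hγ : 0 < γ) (hn : 0 < n) (h : c.Kreg / γ < n) :
    gammaTilde c n γ < 1 := by
  have hn' : (0 : ℝ) < n := by exact_mod_cast hn
  rw [gammaTilde, Real.sqrt_lt' one_pos, one_pow, div_lt_one (by positivity)]
  rwa [div_lt_iff₀ hγ] at h

theorem lamReg_mul_norm_sq_le (hθ : θ ∈ thetaEE u c) (x : Vec p) :
    c.lamReg * ‖x‖ ^ 2 ≤ inner ℝ x (act (momXX θ) x) :=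
  le_inner_act_of_le_lambdaMin (momXX_transpose θ) hθ.2.1 x

variable {s : Fin n → Vec p × ℝ} {γ : ℝ}

theorem abs_estimation_error_sub_le (hc : c.Pos) (hθ : θ ∈ thetaEE u c)
    (hg1 : gammaTilde c n γ < 1) (hs : s ∈ goodEvent c (invSqrt (momXX θ)) n γ) :
    |inner ℝ u (olsBeta (observe θ.1 s)) - target u θ - (n : ℝ)⁻¹ * ∑ i, infl u θ (s i)|
      ≤ Rlin u c n γ / √n := by
  have h := abs_linearization_le_Rlin hc (isInvSqrt_momXX hθ.1) (lamReg_mul_norm_sq_le hθ) hg1 hs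
    u θ.1
  rwa [inner_sub_right] at h

theorem abs_mean_sq_infl_sub_Vhat_le (hc : c.Pos) (hθ : θ ∈ thetaEE u c) (hγ : 0 < γ) (hn : 0 < n)
    (hg1 : gammaTilde c n γ < 1) (hs : s ∈ goodEvent c (invSqrt (momXX θ)) n γ) :
    |(n : ℝ)⁻¹ * ∑ i, infl u θ (s i) ^ 2 - inner ℝ u (act (Vhat (observe θ.1 s)) u)|
      ≤ ‖u‖ ^ 2 * Rvar c (observe θ.1 s) γ :=
  abs_mean_sq_infl_sub_le_Rvar hc hγ hn (isInvSqrt_momXX hθ.1) (lamReg_mul_norm_sq_le hθ) hg1 hs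
    u θ.1

theorem mean_infl_eq (hθ : θ ∈ linearModel p) (hu : u ≠ 0) (hn : 0 < n)
    (s : Fin n → Vec p × ℝ) :
    (n : ℝ)⁻¹ * ∑ i, infl u θ (s i)
      = stdSum (inflLaw u θ) n (fun i => infl u θ (s i))
        * √(∫ z, infl u θ z ^ 2 ∂errLaw θ) / √n := by
  have hσ := Real.sqrt_pos.2 (integral_infl_sq_pos hθ hu)
  have hn' : (0 : ℝ) < n := by exact_mod_cast hn
  have hsn := Real.sqrt_pos.2 hn'
  rw [stdSum_inflLaw hθ]
  nth_rewrite 1 [← Real.sq_sqrt hn'.le]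
  field_simp

theorem mem_ciEdg_iff (hn : ¬ (n : ℕ∞) ≤ nZero c t α) (s : Fin n → Vec p × ℝ) (x : ℝ) :
    x ∈ ciEdg u c t α n s ↔ |inner ℝ u (olsBeta s) - x| ≤ halfWidth u c t α s := by
  simp only [ciEdg, hn, if_false, Set.mem_Icc, abs_le]
  constructor <;> rintro ⟨h1, h2⟩ <;> constructor <;> linarith

/-- The chain `σ² / a_n < mean(ξ²) ≤ D_n` replaces the unknown `σ` by `√a_n √D_n`, and `R_lin`
covers the linearization error. -/
theorem target_mem_ciEdg (hu : u ≠ 0) (hc : c.Pos) (hθ : θ ∈ thetaEE u c) (hn : 0 < n)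
    (hn0 : ¬ (n : ℕ∞) ≤ nZero c t α) (ha : 1 < t.a n) (hγ : 0 < t.ω n * α / 2)
    (hg1 : gammaTilde c n (t.ω n * α / 2) < 1)
    (hs : s ∈ goodEvent c (invSqrt (momXX θ)) n (t.ω n * α / 2))
    (hvar : (∫ z, infl u θ z ^ 2 ∂errLaw θ) / t.a n < (n : ℝ)⁻¹ * ∑ i, infl u θ (s i) ^ 2)
    (hq : 0 ≤ gaussQuantile (1 - α / 2 + nuEdg c t α n))
    (hS : |stdSum (inflLaw u θ) n (fun i => infl u θ (s i))|
      ≤ gaussQuantile (1 - α / 2 + nuEdg c t α n)) :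
    target u θ ∈ ciEdg u c t α n (observe θ.1 s) := by
  rw [mem_ciEdg_iff hn0]
  have h1 := abs_estimation_error_sub_le hc hθ hg1 hs
  have h2 := abs_mean_sq_infl_sub_Vhat_le hc hθ hγ hn hg1 hs
  rw [mean_infl_eq hθ.1 hu hn] at h1
  rw [halfWidth]
  set q := gaussQuantile (1 - α / 2 + nuEdg c t α n)
  set S := stdSum (inflLaw u θ) n (fun i => infl u θ (s i))
  set σ2 := ∫ z, infl u θ z ^ 2 ∂errLaw θ
  have hD : σ2 ≤ t.a n * enlargedVar u c t α (observe θ.1 s) := by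
    rw [← div_le_iff₀' (by linarith), enlargedVar]
    linarith [(abs_le.1 h2).2]
  have hσ : √σ2 ≤ √(t.a n) * √(enlargedVar u c t α (observe θ.1 s)) := by
    rw [← Real.sqrt_mul (by linarith)]; exact Real.sqrt_le_sqrt hD
  have h3 : |S * √σ2 / √n|
      ≤ √(t.a n) * q * √(enlargedVar u c t α (observe θ.1 s)) / √n := by
    rw [abs_div, abs_mul, abs_of_nonneg (Real.sqrt_nonneg σ2), abs_of_nonneg (Real.sqrt_nonneg n)]
    refine div_le_div_of_nonneg_right ?_ (Real.sqrt_nonneg _)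
    calc |S| * √σ2 ≤ q * (√(t.a n) * √(enlargedVar u c t α (observe θ.1 s))) := by gcongr
      _ = _ := by ring
  rw [add_div]
  have h4 := abs_add_le (inner ℝ u (olsBeta (observe θ.1 s)) - target u θ - S * √σ2 / √n)
    (S * √σ2 / √n)
  rw [sub_add_cancel] at h4
  linarith

theorem nonAsymptoticallyValid_ciEdg (hu : u ≠ 0) (hα : α ∈ Set.Ioo (0 : ℝ) 1) (hc : c.Pos)
    (ha : ∀ n, 1 ≤ n → 1 < t.a n) (hω : ∀ n, 1 ≤ n → t.ω n ∈ Set.Ioo (0 : ℝ) 1)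
    (hδ : ∀ n, 1 ≤ n → ∀ θ ∈ thetaEE u c,
      min (deltaE (inflLaw u θ) n) (deltaB (inflLaw u θ) n) ≤ t.δ n) :
    NonAsymptoticallyValid (ciEdg u c t α) obsLaw (target u) (thetaEE u c) α := by
  intro n hn θ hθ
  rw [coverage_ciEdg]
  by_cases hn0 : (n : ℕ∞) ≤ nZero c t α
  · simp [ciEdg, hn0, hα.1.le]
  obtain ⟨h1, h2⟩ := lt_of_not_le_nZero hn hn0
  have hω0 := (hω n hn).1
  have hα0 := hα.1
  have hγ : 0 < t.ω n * α / 2 := by positivity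
  have hg1 : gammaTilde c n (t.ω n * α / 2) < 1 := by
    refine gammaTilde_lt_one hγ hn (lt_of_eq_of_lt ?_ h1)
    field_simp
  have hδ0 : 0 ≤ t.δ n := (min_delta_nonneg _ _).trans (hδ n hn θ hθ)
  have hν : 0 ≤ nuEdg c t α n := by
    rw [nuEdg]
    have := Real.exp_pos (-(n * (1 - 1 / t.a n) ^ 2 / (2 * c.Kxi)))
    positivity
  have hτ1 : 1 / 2 < 1 - α / 2 + nuEdg c t α n := by linarith [hα.2]
  have hτ2 : 1 - α / 2 + nuEdg c t α n < 1 := by linarith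
  have hq := gaussQuantile_nonneg hτ1 hτ2
  have h3 := le_measureReal_abs_stdSum_le (inflLaw u θ) (hδ n hn θ hθ)
    (gaussQuantile (1 - α / 2 + nuEdg c t α n))
  have h4 := le_gaussCDF_gaussQuantile ⟨by linarith, hτ2⟩
  rw [← measureReal_stdSum_infl] at h3
  have h5 := measureReal_goodEvent_compl_le hc hθ hn hγ
  have h6 := measureReal_mean_sq_infl_le hu hc hθ hn (ha n hn)
  -- If `|S_n| ≤ q`, then the target is covered, or the good event fails, or `mean(ξ²)` is too
  -- small.
  have h7 : (Measure.pi fun _ : Fin n => errLaw θ).real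
      {s | |stdSum (inflLaw u θ) n (fun i => infl u θ (s i))|
        ≤ gaussQuantile (1 - α / 2 + nuEdg c t α n)}
      ≤ (Measure.pi fun _ : Fin n => errLaw θ).real
          {s | target u θ ∈ ciEdg u c t α n (observe θ.1 s)}
        + (Measure.pi fun _ : Fin n => errLaw θ).real
          (goodEvent c (invSqrt (momXX θ)) n (t.ω n * α / 2))ᶜ
        + (Measure.pi fun _ : Fin n => errLaw θ).real
          {s | (n : ℝ)⁻¹ * ∑ i, infl u θ (s i) ^ 2
            ≤ (∫ z, infl u θ z ^ 2 ∂errLaw θ) / t.a n} := by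
    refine (measureReal_mono fun s hs => ?_).trans ((measureReal_union_le _ _).trans
      (add_le_add_left (measureReal_union_le _ _) _))
    by_cases hs1 : s ∈ goodEvent c (invSqrt (momXX θ)) n (t.ω n * α / 2)
    · rcases le_or_gt ((n : ℝ)⁻¹ * ∑ i, infl u θ (s i) ^ 2)
        ((∫ z, infl u θ z ^ 2 ∂errLaw θ) / t.a n) with hs2 | hs2
      · exact Or.inr hs2
      · exact Or.inl (Or.inl (target_mem_ciEdg hu hc hθ hn hn0 (ha n hn) hγ hg1 hs1 hs2 hq hs))
    · exact Or.inl (Or.inr hs1)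
  -- The budget balances: `2Φ(q) - 1 ≥ 1 - α + 2ν_n`, and `2ν_n` is the sum of the three losses.
  have h8 : 2 * nuEdg c t α n = t.ω n * α
      + Real.exp (-(n * (1 - 1 / t.a n) ^ 2 / (2 * c.Kxi))) + 2 * t.δ n := by
    rw [nuEdg]; ring
  linarith

end Validity


/-! ### Uniform moment bounds over the strict class -/

section StrictMoments

open scoped Matrix.Norms.L2Operator

variable {p n : ℕ} {u : Vec p} {c : Bounds} {θ : Param p} {lamEps ρ KX : ℝ}

theorem pow_four_le_one_add_rpow (hρ : 0 ≤ ρ) {x : ℝ} (hx : 0 ≤ x) :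
    x ^ 4 ≤ 1 + x ^ (4 * (1 + ρ)) := by
  rcases le_total x 1 with h | h
  · linarith [pow_le_one₀ hx h (n := 4), Real.rpow_nonneg hx (4 * (1 + ρ))]
  · have := Real.rpow_le_rpow_of_exponent_le h (by linarith : (4 : ℝ) ≤ 4 * (1 + ρ))
    rw [show (4 : ℝ) = ((4 : ℕ) : ℝ) by norm_num, Real.rpow_natCast] at this
    norm_num at this ⊢
    linarith

theorem integral_norm_pow_four_le (hρ : 0 ≤ ρ) (hθ : θ ∈ thetaStrict u c lamEps ρ KX) :
    ∫ z, ‖z.1‖ ^ 4 ∂errLaw θ ≤ 1 + KX := by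
  obtain ⟨hE, -, hi, hK⟩ := hθ
  calc _ ≤ ∫ z, (1 + ‖z.1‖ ^ (4 * (1 + ρ))) ∂errLaw θ :=
        integral_mono hE.1.1 ((integrable_const 1).add hi)
          fun z => pow_four_le_one_add_rpow hρ (norm_nonneg _)
    _ ≤ 1 + KX := by
        rw [integral_add (integrable_const 1) hi]
        simpa using hK

theorem norm_momXX_le_of_strict (hρ : 0 ≤ ρ) (hθ : θ ∈ thetaStrict u c lamEps ρ KX) :
    ‖momXX θ‖ ≤ 2 + KX := by
  have hL := hθ.1.1
  refine (norm_momXX_le hL).trans ?_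
  calc _ ≤ ∫ z, (1 + ‖z.1‖ ^ 4) ∂errLaw θ := by
        refine integral_mono (integrable_norm_sq_fst hL) ((integrable_const 1).add hL.1) fun z => ?_
        nlinarith [sq_nonneg (‖z.1‖ ^ 2 - 1)]
    _ ≤ 2 + KX := by
        rw [integral_add (integrable_const 1) hL.1]
        simp only [integral_const, probReal_univ, one_smul]
        linarith [integral_norm_pow_four_le hρ hθ]

/-- From `u = M M⁻¹ u` and `‖M‖ ≤ 2 + K_X` follows `‖M⁻¹ u‖ ≥ ‖u‖ / (2 + K_X)`. A uniform floor for
`σ²` makes additive remainders negligible relative to it. -/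
theorem integral_infl_sq_ge_of_strict (hlam : 0 < lamEps) (hKX : 0 < KX) (hρ : 0 ≤ ρ)
    (hθ : θ ∈ thetaStrict u c lamEps ρ KX) :
    lamEps * (‖u‖ / (2 + KX)) ^ 2 ≤ ∫ z, infl u θ z ^ 2 ∂errLaw θ := by
  refine le_trans ?_ (integral_infl_sq_ge hθ.1.1 hθ.2.1)
  gcongr
  rw [div_le_iff₀' (by linarith)]
  calc ‖u‖ = ‖act (momXX θ) (act (momXX θ)⁻¹ u)‖ := by rw [act_momXX_act_inv hθ.1.1]
    _ ≤ ‖momXX θ‖ * ‖act (momXX θ)⁻¹ u‖ := norm_act_le _ _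
    _ ≤ _ := by gcongr; exact norm_momXX_le_of_strict hρ hθ

/-- A bound on `E‖Xε‖²` that is uniform over the strict class. -/
def scoreBound (c : Bounds) (KX : ℝ) : ℝ :=
  ((2 + KX) * c.lamReg ^ (-(1 / 2) : ℝ)) ^ 2 * (1 + c.Keps)

theorem integral_norm_score_sq_le (hc : c.Pos) (hKX : 0 < KX) (hρ : 0 ≤ ρ)
    (hθ : θ ∈ thetaStrict u c lamEps ρ KX) :
    ∫ z, ‖z.2 • z.1‖ ^ 2 ∂errLaw θ ≤ scoreBound c KX := by
  obtain ⟨hL, -, -, ⟨hi, hK⟩, -⟩ := hθ.1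
  have hT := isInvSqrt_momXX hL
  have hn := hT.norm_le hc.1 (lamReg_mul_norm_sq_le hθ.1)
  have hM := norm_momXX_le_of_strict hρ hθ
  have key : ∀ z : Vec p × ℝ, ‖z.2 • z.1‖ ^ 2
      ≤ ((2 + KX) * c.lamReg ^ (-(1 / 2) : ℝ)) ^ 2 * (1 + ‖z.2 • rotated θ z.1‖ ^ 4) := by
    intro z
    -- Since `M T T = 1`, the score is recovered from its rotated version, the one whose fourth
    -- moment is controlled.
    have e : z.2 • z.1 = act (momXX θ) (act (invSqrt (momXX θ)) (z.2 • rotated θ z.1)) := by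
      rw [rotated, ← act_smul_right, ← act_mul, ← act_mul, Matrix.mul_assoc,
        hT.mul_mul_self, act_one]
    have h1 : ‖z.2 • z.1‖
        ≤ (2 + KX) * c.lamReg ^ (-(1 / 2) : ℝ) * ‖z.2 • rotated θ z.1‖ := by
      rw [e]
      calc _ ≤ ‖momXX θ‖ * (‖invSqrt (momXX θ)‖ * ‖z.2 • rotated θ z.1‖) :=
            (norm_act_le _ _).trans (mul_le_mul_of_nonneg_left (norm_act_le _ _) (norm_nonneg _))
        _ ≤ (2 + KX) * (c.lamReg ^ (-(1 / 2) : ℝ) * ‖z.2 • rotated θ z.1‖) := by gcongr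
        _ = _ := by ring
    calc _ ≤ ((2 + KX) * c.lamReg ^ (-(1 / 2) : ℝ) * ‖z.2 • rotated θ z.1‖) ^ 2 := by gcongr
      _ = ((2 + KX) * c.lamReg ^ (-(1 / 2) : ℝ)) ^ 2 * ‖z.2 • rotated θ z.1‖ ^ 2 := mul_pow _ _ _
      _ ≤ _ := by
        gcongr
        nlinarith [sq_nonneg (‖z.2 • rotated θ z.1‖ ^ 2 - 1)]
  have hi1 := ((integrable_const (1 : ℝ)).add hi).const_mul
    (((2 + KX) * c.lamReg ^ (-(1 / 2) : ℝ)) ^ 2)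
  refine (integral_mono hL.2.1 hi1 key).trans ?_
  simp only [Pi.add_apply]
  rw [integral_const_mul, integral_add (integrable_const _) hi, scoreBound]
  gcongr
  simp

/-- Chebyshev's inequality, as the kurtosis bound gives `Var(ξ²) ≤ K_ξ σ⁴`. No exponential rate is
needed on this side. -/
theorem measureReal_mean_sq_infl_gt_le (hu : u ≠ 0) (hθ : θ ∈ thetaEE u c)
    (hn : 0 < n) {κ : ℝ} (hκ : 0 < κ) :
    (Measure.pi fun _ : Fin n => errLaw θ).real
      {s | (1 + κ) * ∫ z, infl u θ z ^ 2 ∂errLaw θ < (n : ℝ)⁻¹ * ∑ i, infl u θ (s i) ^ 2}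
      ≤ c.Kxi / (n * κ ^ 2) := by
  obtain ⟨hL, -, -, -, ⟨hi, hK⟩⟩ := hθ
  have hσ := integral_infl_sq_pos hL hu
  have hn' : (0 : ℝ) < n := by exact_mod_cast hn
  have hi4 : Integrable (fun z => ‖infl u θ z‖ ^ 4) (errLaw θ) := by
    simpa only [Real.norm_eq_abs, Even.pow_abs (by decide : Even 4)] using hi
  have hi2 : Integrable (fun z => infl u θ z ^ 2) (errLaw θ) := by
    simpa only [Real.norm_eq_abs, sq_abs] using integrable_norm_pow_of_le (by norm_num : 2 ≤ 4)
      (measurable_infl u θ).aestronglyMeasurable hi4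
  set σ2 := ∫ z, infl u θ z ^ 2 ∂errLaw θ with hσ2
  rw [div_le_iff₀ (pow_pos hσ 2)] at hK
  have hm : StronglyMeasurable fun z => infl u θ z ^ 2 - σ2 :=
    (((measurable_infl u θ).pow_const 2).sub_const _).stronglyMeasurable
  have e : ∀ z, ‖infl u θ z ^ 2 - σ2‖ ^ 2 = infl u θ z ^ 4 - 2 * σ2 * infl u θ z ^ 2 + σ2 ^ 2 :=
    fun z => by rw [Real.norm_eq_abs, sq_abs]; ring
  have i2 := hi2.const_mul (2 * σ2)
  have i3 : Integrable (fun z => infl u θ z ^ 4 - 2 * σ2 * infl u θ z ^ 2) (errLaw θ) := hi.sub i2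
  have i4 : Integrable (fun z => ‖infl u θ z ^ 2 - σ2‖ ^ 2) (errLaw θ) := by
    simp_rw [e]; exact i3.add (integrable_const _)
  have hle : ∫ z, ‖infl u θ z ^ 2 - σ2‖ ^ 2 ∂errLaw θ ≤ c.Kxi * σ2 ^ 2 := by
    simp_rw [e]
    rw [integral_add i3 (integrable_const _), integral_sub hi i2, integral_const_mul, ← hσ2]
    simp only [integral_const, probReal_univ, one_smul]
    nlinarith [sq_nonneg σ2]
  have h0 : ∫ z, (infl u θ z ^ 2 - σ2) ∂errLaw θ = 0 := by
    rw [integral_sub hi2 (integrable_const _), ← hσ2]; simp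
  have hs := integral_norm_sum_sq hm i4 h0 n
  have hsub : {s : Fin n → Vec p × ℝ | (1 + κ) * σ2 < (n : ℝ)⁻¹ * ∑ i, infl u θ (s i) ^ 2}
      ⊆ {s | (n * κ * σ2) ^ 2 < ‖∑ i, (infl u θ (s i) ^ 2 - σ2)‖ ^ 2} := by
    intro s hs
    rw [Set.mem_ofPred_eq] at hs ⊢
    rw [Real.norm_eq_abs, sq_abs]
    rw [inv_mul_eq_div, lt_div_iff₀ hn'] at hs
    refine pow_lt_pow_left₀ ?_ (by positivity) two_ne_zero
    rw [Finset.sum_sub_distrib]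
    simp only [Finset.sum_const, Finset.card_univ, Fintype.card_fin, nsmul_eq_mul]
    linarith
  refine (measureReal_mono hsub).trans ?_
  refine (measureReal_lt_le_div_of_integral_le (fun s => by positivity) hs.1
    (b := (n * κ * σ2) ^ 2) (C := n * (c.Kxi * σ2 ^ 2)) (by positivity) ?_).trans_eq ?_
  · rw [hs.2]; gcongr
  · field_simp

end StrictMoments

/-! ### A deterministic bound on the variance remainder -/

section RvarBound

open scoped Matrix.Norms.L2Operator

variable {p n : ℕ} {c : Bounds}

/-- The bound on the norm of the estimation error on the good event. -/
def olsBound (c : Bounds) (n : ℕ) (γ : ℝ) : ℝ :=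
  c.lamReg ^ (-(1 / 2) : ℝ) * (gammaTilde c n γ / (1 - gammaTilde c n γ) + 1)
    * (√2 * (c.Keps / γ) ^ (1 / 4 : ℝ) / √n)

/-- The bound on the variance remainder when the empirical moments are at most `B`. -/
def RvarBound (c : Bounds) (n : ℕ) (γ B : ℝ) : ℝ :=
  2 / (n * c.lamReg ^ 3) * (gammaTilde c n γ / (1 - gammaTilde c n γ) + 1) ^ 2 * √(c.Keps / γ) * B
    + 2 * √2 / (c.lamReg ^ (5 / 2 : ℝ) * √n)
      * (gammaTilde c n γ / (1 - gammaTilde c n γ) + 1) * (c.Keps / γ) ^ (1 / 4 : ℝ) * (5 * B)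
    + c.Kreg / (n * γ) / (c.lamReg ^ 2 * (1 - gammaTilde c n γ) ^ 2) * (4 * B)
    + 2 * gammaTilde c n γ / (c.lamReg * (1 - gammaTilde c n γ))
      * (4 * B * (c.lamReg⁻¹ * (gammaTilde c n γ / (1 - gammaTilde c n γ) + 1)))

theorem norm_resid_smul_sq_le {β : Vec p} {s : Fin n → Vec p × ℝ}
    (h : ‖olsBeta (observe β s) - β‖ ≤ 1) (i : Fin n) :
    ‖resid (observe β s) i • (s i).1‖ ^ 2 ≤ 2 * ‖(s i).2 • (s i).1‖ ^ 2 + 2 * ‖(s i).1‖ ^ 4 := by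
  set v : ℝ := inner ℝ (s i).1 (olsBeta (observe β s) - β) with hv
  have e : resid (observe β s) i = (s i).2 - v := by
    rw [hv, resid, inner_sub_right]; simp only [observe]; ring
  have hv' : |v| ≤ ‖(s i).1‖ :=
    (abs_real_inner_le_norm _ _).trans (mul_le_of_le_one_right (norm_nonneg _) h)
  have hv2 : v ^ 2 ≤ ‖(s i).1‖ ^ 2 := by rw [← sq_abs]; gcongr
  rw [norm_smul, norm_smul, mul_pow, mul_pow, Real.norm_eq_abs, Real.norm_eq_abs, sq_abs, sq_abs, e]
  have h1 : ((s i).2 - v) ^ 2 ≤ 2 * (s i).2 ^ 2 + 2 * ‖(s i).1‖ ^ 2 := by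
    nlinarith [sq_nonneg ((s i).2 + v)]
  calc _ ≤ (2 * (s i).2 ^ 2 + 2 * ‖(s i).1‖ ^ 2) * ‖(s i).1‖ ^ 2 := by gcongr
    _ = _ := by ring

/-- Once `‖β̂ - β‖ ≤ 1`, residual moments reduce to those of `X` and `Xε`: `‖rX‖² ≤ 2‖Xε‖² + 2‖X‖⁴`
yields `4B`, and `‖X‖³|r| ≤ ‖X‖⁴ + ‖rX‖²` yields `5B`. -/
theorem Rvar_le_RvarBound (hc : c.Pos) {γ : ℝ} (hγ : 0 < γ) {M T : Mat p} (hT : IsInvSqrt M T)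
    (hl : ∀ x, c.lamReg * ‖x‖ ^ 2 ≤ inner ℝ x (act M x)) (hg1 : gammaTilde c n γ < 1)
    (hd : olsBound c n γ ≤ 1) {s : Fin n → Vec p × ℝ} (hs : s ∈ goodEvent c T n γ) (β : Vec p)
    {B : ℝ} (h4 : (n : ℝ)⁻¹ * ∑ i, ‖(s i).1‖ ^ 4 ≤ B)
    (h2 : (n : ℝ)⁻¹ * ∑ i, ‖(s i).2 • (s i).1‖ ^ 2 ≤ B) :
    Rvar c (observe β s) γ ≤ RvarBound c n γ B := by
  have hg0 := gammaTilde_nonneg c n γ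
  have hβ : ‖olsBeta (observe β s) - β‖ ≤ 1 :=
    (norm_olsBeta_sub_le hT hc.1 hl hg0 hg1 hs.1 hs.2 β).trans hd
  have hB := norm_pinv_gram_le hT hc.1 hl hg0 hg1 hs.1
  obtain ⟨hl0, hr0, he0, -⟩ := hc
  have h1g : 0 < 1 - gammaTilde c n γ := by linarith
  have hr2 : (n : ℝ)⁻¹ * ∑ i, ‖resid (observe β s) i • (s i).1‖ ^ 2 ≤ 4 * B := by
    calc _ ≤ (n : ℝ)⁻¹ * ∑ i, (2 * ‖(s i).2 • (s i).1‖ ^ 2 + 2 * ‖(s i).1‖ ^ 4) := by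
          gcongr with i; exact norm_resid_smul_sq_le hβ i
      _ = 2 * ((n : ℝ)⁻¹ * ∑ i, ‖(s i).2 • (s i).1‖ ^ 2)
          + 2 * ((n : ℝ)⁻¹ * ∑ i, ‖(s i).1‖ ^ 4) := by
          rw [Finset.sum_add_distrib, ← Finset.mul_sum, ← Finset.mul_sum]; ring
      _ ≤ _ := by linarith
  have hr3 : (n : ℝ)⁻¹ * ∑ i, ‖(s i).1‖ ^ 3 * |resid (observe β s) i| ≤ 5 * B := by
    calc _ ≤ (n : ℝ)⁻¹ * ∑ i, (‖(s i).1‖ ^ 4 + ‖resid (observe β s) i • (s i).1‖ ^ 2) := by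
          gcongr with i
          rw [norm_smul, Real.norm_eq_abs]
          nlinarith [sq_nonneg (‖(s i).1‖ ^ 2 - |resid (observe β s) i| * ‖(s i).1‖),
            sq_nonneg (‖(s i).1‖ ^ 2), sq_nonneg (|resid (observe β s) i| * ‖(s i).1‖)]
      _ = (n : ℝ)⁻¹ * ∑ i, ‖(s i).1‖ ^ 4
          + (n : ℝ)⁻¹ * ∑ i, ‖resid (observe β s) i • (s i).1‖ ^ 2 := by
          rw [Finset.sum_add_distrib]; ring
      _ ≤ _ := by linarith
  have hk : specNorm ((n : ℝ)⁻¹ • ∑ i, resid (observe β s) i ^ 2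
        • (outer (s i).1 * pinv (gram s)))
      ≤ 4 * B * (c.lamReg⁻¹ * (gammaTilde c n γ / (1 - gammaTilde c n γ) + 1)) := by
    have e : ((n : ℝ)⁻¹ • ∑ i, resid (observe β s) i ^ 2 • (outer (s i).1 * pinv (gram s)))
        = ((n : ℝ)⁻¹ • ∑ i, resid (observe β s) i ^ 2 • outer (s i).1) * pinv (gram s) := by
      simp only [Matrix.smul_mul, Finset.sum_mul]
    have hm : ‖(n : ℝ)⁻¹ • ∑ i, resid (observe β s) i ^ 2 • outer (s i).1‖
        ≤ (n : ℝ)⁻¹ * ∑ i, ‖resid (observe β s) i • (s i).1‖ ^ 2 := by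
      rw [norm_smul, Real.norm_of_nonneg (by positivity)]
      gcongr
      refine (norm_sum_le _ _).trans (Finset.sum_le_sum fun i _ => ?_)
      rw [norm_smul, norm_smul, mul_pow, norm_pow]
      gcongr
      exact norm_outer_le _
    rw [e, specNorm_eq_norm]
    refine (norm_mul_le _ _).trans (mul_le_mul (hm.trans hr2) hB (norm_nonneg _) ?_)
    exact (norm_nonneg _).trans (hm.trans hr2)
  rw [Rvar, RvarBound]
  have e4 : ∑ i, ‖(observe β s i).1‖ ^ 4 = ∑ i, ‖(s i).1‖ ^ 4 := rfl
  have e3 : ∑ i, ‖(observe β s i).1‖ ^ 3 * |resid (observe β s) i|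
    = ∑ i, ‖(s i).1‖ ^ 3 * |resid (observe β s) i| := rfl
  have e2 : ∑ i, ‖resid (observe β s) i • (observe β s i).1‖ ^ 2
    = ∑ i, ‖resid (observe β s) i • (s i).1‖ ^ 2 := rfl
  have e1 : ∑ i, resid (observe β s) i ^ 2 • (outer (observe β s i).1 * pinv (gram (observe β s)))
    = ∑ i, resid (observe β s) i ^ 2 • (outer (s i).1 * pinv (gram s)) := rfl
  rw [e4, e3, e2, e1]
  gcongr

end RvarBound


/-! ### Asymptotics of the tuning parameters -/

section Asymptotics

variable {p : ℕ} {u : Vec p} {c : Bounds} {t : Tuning} {α : ℝ}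

theorem tendsto_nat_mul_gamma (hα : 0 < α)
    (hω : ∀ n, 1 ≤ n → t.ω n ∈ Set.Ioo (0 : ℝ) 1)
    (hω_rate : Tendsto (fun n : ℕ => t.ω n * (n : ℝ) ^ (2 / 3 : ℝ)) atTop atTop) :
    Tendsto (fun n : ℕ => (n : ℝ) * (t.ω n * α / 2)) atTop atTop := by
  refine tendsto_atTop_mono' _ ?_ (hω_rate.atTop_mul_const (by positivity : 0 < α / 2))
  filter_upwards [eventually_ge_atTop 1] with n hn
  have hn' : (1 : ℝ) ≤ n := by exact_mod_cast hn
  have h1 := Real.rpow_le_rpow_of_exponent_le hn' (by norm_num : (2 / 3 : ℝ) ≤ 1)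
  rw [Real.rpow_one] at h1
  have h2 := (hω n hn).1
  calc _ ≤ t.ω n * n * (α / 2) := by gcongr
    _ = _ := by ring

theorem tendsto_gammaTilde (hα : 0 < α)
    (hω : ∀ n, 1 ≤ n → t.ω n ∈ Set.Ioo (0 : ℝ) 1)
    (hω_rate : Tendsto (fun n : ℕ => t.ω n * (n : ℝ) ^ (2 / 3 : ℝ)) atTop atTop) :
    Tendsto (fun n : ℕ => gammaTilde c n (t.ω n * α / 2)) atTop (𝓝 0) := by
  have h := (Real.continuous_sqrt.tendsto 0).comp
    ((tendsto_nat_mul_gamma hα hω hω_rate).const_div_atTop c.Kreg)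
  rwa [Real.sqrt_zero] at h

theorem tendsto_of_pow_four {x : ℕ → ℝ} (hx : ∀ᶠ n in atTop, 0 ≤ x n)
    (h : Tendsto (fun n => x n ^ 4) atTop (𝓝 0)) : Tendsto x atTop (𝓝 0) := by
  have h1 := h.rpow_const (p := (1 / 4 : ℝ)) (Or.inr (by norm_num))
  rw [Real.zero_rpow (by norm_num)] at h1
  refine h1.congr' ?_
  filter_upwards [hx] with n hn
  rw [← Real.rpow_natCast, ← Real.rpow_mul hn]
  norm_num

theorem rpow_quarter_pow_four {x : ℝ} (hx : 0 ≤ x) : (x ^ (1 / 4 : ℝ)) ^ 4 = x := by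
  rw [← Real.rpow_natCast, ← Real.rpow_mul hx]; norm_num

/-- The fourth power is `K_reg² K_ε / (n² γ³) = K_reg² K_ε / (n^(2/3) γ)³`: here the exponent `2/3`
is used at full strength. -/
theorem tendsto_gammaTilde_mul_rpow (hc : c.Pos) (hα : 0 < α)
    (hω : ∀ n, 1 ≤ n → t.ω n ∈ Set.Ioo (0 : ℝ) 1)
    (hω_rate : Tendsto (fun n : ℕ => t.ω n * (n : ℝ) ^ (2 / 3 : ℝ)) atTop atTop) :
    Tendsto (fun n : ℕ => gammaTilde c n (t.ω n * α / 2)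
      * (c.Keps / (t.ω n * α / 2)) ^ (1 / 4 : ℝ)) atTop (𝓝 0) := by
  obtain ⟨-, h2, h3, -⟩ := hc
  have h0 : Tendsto (fun n : ℕ => (t.ω n * (n : ℝ) ^ (2 / 3 : ℝ) * (α / 2)) ^ 3) atTop atTop :=
    (tendsto_pow_atTop (by norm_num)).comp (hω_rate.atTop_mul_const (by positivity : 0 < α / 2))
  refine tendsto_of_pow_four ?_ ((h0.const_div_atTop (c.Kreg ^ 2 * c.Keps)).congr' ?_)
  · filter_upwards [eventually_ge_atTop 1] with n hn
    have := (hω n hn).1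
    exact mul_nonneg (gammaTilde_nonneg c n _) (by positivity)
  · filter_upwards [eventually_ge_atTop 1] with n hn
    have hω0 := (hω n hn).1
    have hn' : (0 : ℝ) < n := by exact_mod_cast hn
    have hg2 : gammaTilde c n (t.ω n * α / 2) ^ 2 = c.Kreg / (n * (t.ω n * α / 2)) :=
      Real.sq_sqrt (by positivity)
    have hr : ((n : ℝ) ^ (2 / 3 : ℝ)) ^ 3 = (n : ℝ) ^ 2 := by
      rw [← Real.rpow_natCast, ← Real.rpow_mul hn'.le, ← Real.rpow_natCast]; norm_num
    rw [mul_pow, mul_pow, hr, mul_pow (gammaTilde _ _ _), rpow_quarter_pow_four (by positivity),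
      show gammaTilde c n (t.ω n * α / 2) ^ 4 = (gammaTilde c n (t.ω n * α / 2) ^ 2) ^ 2 by ring,
      hg2]
    field_simp

theorem tendsto_rpow_div_sqrt (hc : c.Pos) (hα : 0 < α)
    (hω : ∀ n, 1 ≤ n → t.ω n ∈ Set.Ioo (0 : ℝ) 1)
    (hω_rate : Tendsto (fun n : ℕ => t.ω n * (n : ℝ) ^ (2 / 3 : ℝ)) atTop atTop) :
    Tendsto (fun n : ℕ => (c.Keps / (t.ω n * α / 2)) ^ (1 / 4 : ℝ) / √n) atTop (𝓝 0) := by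
  obtain ⟨-, h2, h3, -⟩ := hc
  have h0 := (tendsto_nat_mul_gamma hα hω hω_rate).atTop_mul_atTop₀
    (tendsto_natCast_atTop_atTop (R := ℝ))
  refine tendsto_of_pow_four ?_ ((h0.const_div_atTop c.Keps).congr' ?_)
  · filter_upwards [eventually_ge_atTop 1] with n hn
    have := (hω n hn).1
    positivity
  · filter_upwards [eventually_ge_atTop 1] with n hn
    have hω0 := (hω n hn).1
    have hn' : (0 : ℝ) < n := by exact_mod_cast hn
    rw [div_pow, rpow_quarter_pow_four (by positivity),
      show √(n : ℝ) ^ 4 = (√(n : ℝ) ^ 2) ^ 2 by ring, Real.sq_sqrt hn'.le]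
    field_simp

theorem tendsto_olsBound (hc : c.Pos) (hα : 0 < α)
    (hω : ∀ n, 1 ≤ n → t.ω n ∈ Set.Ioo (0 : ℝ) 1)
    (hω_rate : Tendsto (fun n : ℕ => t.ω n * (n : ℝ) ^ (2 / 3 : ℝ)) atTop atTop) :
    Tendsto (fun n : ℕ => olsBound c n (t.ω n * α / 2)) atTop (𝓝 0) := by
  have hg := tendsto_gammaTilde (c := c) hα hω hω_rate
  have hh := tendsto_rpow_div_sqrt hc hα hω hω_rate
  have h1 := (hg.div (tendsto_const_nhds.sub hg) (by norm_num : (1 : ℝ) - 0 ≠ 0)).add_const 1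
  have := (h1.const_mul (c.lamReg ^ (-(1 / 2) : ℝ))).mul (hh.const_mul √2)
  simp only [mul_zero] at this
  refine this.congr fun n => ?_
  simp only [olsBound, Pi.div_apply]
  ring

theorem tendsto_Rlin (hc : c.Pos) (hα : 0 < α)
    (hω : ∀ n, 1 ≤ n → t.ω n ∈ Set.Ioo (0 : ℝ) 1)
    (hω_rate : Tendsto (fun n : ℕ => t.ω n * (n : ℝ) ^ (2 / 3 : ℝ)) atTop atTop) (u : Vec p) :
    Tendsto (fun n : ℕ => Rlin u c n (t.ω n * α / 2)) atTop (𝓝 0) := by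
  have hg := tendsto_gammaTilde (c := c) hα hω hω_rate
  have hgh := tendsto_gammaTilde_mul_rpow hc hα hω hω_rate
  have := (hgh.div (tendsto_const_nhds.sub hg) (by norm_num : (1 : ℝ) - 0 ≠ 0)).const_mul
    (√2 * ‖u‖ * c.lamReg ^ (-(1 / 2) : ℝ))
  simp only [zero_div, mul_zero] at this
  refine this.congr fun n => ?_
  simp only [Rlin, Pi.div_apply]
  ring

/-- Each summand has a factor `γ̃` or `(K_ε/γ)^(1/4) / √n`, both vanishing; in the first summand the
latter appears squared. -/
theorem tendsto_RvarBound (hc : c.Pos) (hα : 0 < α)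
    (hω : ∀ n, 1 ≤ n → t.ω n ∈ Set.Ioo (0 : ℝ) 1)
    (hω_rate : Tendsto (fun n : ℕ => t.ω n * (n : ℝ) ^ (2 / 3 : ℝ)) atTop atTop) (B : ℝ) :
    Tendsto (fun n : ℕ => RvarBound c n (t.ω n * α / 2) B) atTop (𝓝 0) := by
  have hg := tendsto_gammaTilde (c := c) hα hω hω_rate
  have hh := tendsto_rpow_div_sqrt hc hα hω hω_rate
  have h1g : Tendsto (fun n : ℕ => 1 - gammaTilde c n (t.ω n * α / 2)) atTop (𝓝 (1 - 0)) :=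
    tendsto_const_nhds.sub hg
  have hq := hg.div h1g (by norm_num : (1 : ℝ) - 0 ≠ 0)
  have hq1 := hq.add_const 1
  have hgs := (hg.pow 2).div (h1g.pow 2) (by norm_num : ((1 : ℝ) - 0) ^ 2 ≠ 0)
  have k1 := ((hq1.pow 2).mul (hh.pow 2)).const_mul (2 / c.lamReg ^ 3 * B)
  have k2 := (hq1.mul hh).const_mul (2 * √2 / c.lamReg ^ (5 / 2 : ℝ) * (5 * B))
  have k3 := hgs.const_mul (4 * B / c.lamReg ^ 2)
  have k4 := (hq.mul hq1).const_mul (2 / c.lamReg * (4 * B * c.lamReg⁻¹))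
  have k := ((k1.add k2).add k3).add k4
  norm_num at k
  refine k.congr' ?_
  obtain ⟨hl, h2, h3, -⟩ := hc
  filter_upwards [eventually_ge_atTop 1] with n hn
  have hω0 := (hω n hn).1
  have hn' : (0 : ℝ) < n := by exact_mod_cast hn
  have hg2 : gammaTilde c n (t.ω n * α / 2) ^ 2 = c.Kreg / (n * (t.ω n * α / 2)) :=
    Real.sq_sqrt (by positivity)
  have hs : √(c.Keps / (t.ω n * α / 2)) = ((c.Keps / (t.ω n * α / 2)) ^ (1 / 4 : ℝ)) ^ 2 := by
    rw [Real.sqrt_eq_rpow, ← Real.rpow_natCast, ← Real.rpow_mul (by positivity)]; norm_num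
  have hsn := Real.sq_sqrt hn'.le
  rw [RvarBound, hs, ← hg2]
  simp only [div_pow, hsn]
  generalize 1 - gammaTilde c n (t.ω n * α / 2) = y
  ring

theorem tendsto_nuEdg (hc : c.Pos) (ha : ∀ n, 1 ≤ n → 1 < t.a n)
    (hδ_lim : Tendsto t.δ atTop (𝓝 0)) (hω_lim : Tendsto t.ω atTop (𝓝 0))
    (ha_lim : Tendsto (fun n => t.a n - 1) atTop (𝓝 0))
    (ha_rate : Tendsto (fun n : ℕ => (t.a n - 1) * √n) atTop atTop) :
    Tendsto (nuEdg c t α) atTop (𝓝 0) := by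
  have ha1 : Tendsto t.a atTop (𝓝 1) := by simpa using ha_lim.add_const 1
  have h1 : Tendsto (fun n : ℕ => ((t.a n - 1) * √n) ^ 2) atTop atTop :=
    (tendsto_pow_atTop (by norm_num)).comp ha_rate
  have h2 : Tendsto (fun n => (2 * c.Kxi * t.a n ^ 2)⁻¹) atTop (𝓝 (2 * c.Kxi * 1 ^ 2)⁻¹) :=
    ((ha1.pow 2).const_mul _).inv₀ (by have := hc.2.2.2; positivity)
  have h3 := Real.tendsto_exp_neg_atTop_nhds_zero.comp
    (h1.atTop_mul_pos (by have := hc.2.2.2; positivity) h2)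
  have h4 := (((hω_lim.mul_const α).add h3).div_const 2).add hδ_lim
  norm_num at h4
  refine h4.congr' ?_
  filter_upwards [eventually_ge_atTop 1] with n hn
  have hn' : (0 : ℝ) ≤ n := n.cast_nonneg
  have ha0 := ha n hn
  have := hc.2.2.2
  -- With `a_n → 1`, the exponent grows like `((a_n - 1)√n)²`.
  have e : ((t.a n - 1) * √n) ^ 2 * (2 * c.Kxi * t.a n ^ 2)⁻¹
      = n * (1 - 1 / t.a n) ^ 2 / (2 * c.Kxi) := by
    rw [mul_pow, Real.sq_sqrt hn']
    field_simp
  simp only [nuEdg, ← e]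
  norm_num

/-- Both conditions defining `n_0` eventually fail, since `nγ → ∞` and `ν_n → 0`; hence the supremum
is finite and the interval is eventually bounded. -/
theorem eventually_not_le_nZero (hα : 0 < α)
    (hω : ∀ n, 1 ≤ n → t.ω n ∈ Set.Ioo (0 : ℝ) 1)
    (hω_rate : Tendsto (fun n : ℕ => t.ω n * (n : ℝ) ^ (2 / 3 : ℝ)) atTop atTop)
    (hν : Tendsto (nuEdg c t α) atTop (𝓝 0)) :
    ∀ᶠ n : ℕ in atTop, ¬ (n : ℕ∞) ≤ nZero c t α := by
  have h1 := (tendsto_nat_mul_gamma hα hω hω_rate).eventually_gt_atTop c.Kreg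
  have h2 := hν.eventually (gt_mem_nhds (by positivity : (0 : ℝ) < α / 2))
  obtain ⟨N, hN⟩ := eventually_atTop.1 ((h1.and h2).and (eventually_ge_atTop 1))
  have hle : nZero c t α ≤ N := by
    refine iSup₂_le fun m hm => ?_
    by_contra hlt
    rw [not_le, Nat.cast_lt] at hlt
    obtain ⟨⟨h3, h4⟩, h5⟩ := hN m hlt.le
    have hω0 := (hω m hm.1).1
    rcases hm.2 with h | h
    · rw [le_div_iff₀ (by positivity)] at h
      linarith
    · linarith
  filter_upwards [eventually_gt_atTop N] with n hn
  rw [not_le]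
  exact hle.trans_lt (by exact_mod_cast hn)

end Asymptotics


/-! ### Uniform asymptotic exactness -/

section Exactness

variable {p n : ℕ} {u : Vec p} {c : Bounds} {t : Tuning} {α : ℝ} {θ : Param p}
  {lamEps ρ KX : ℝ}

/-- The converse of `target_mem_ciEdg`, up to a relative enlargement. The remainders enter twice,
once as allowances in the interval and once as actual errors, hence the factors 2 in `hRv` and
`hRl`. -/
theorem abs_stdSum_le_of_mem_ciEdg (hu : u ≠ 0) (hc : c.Pos) (hθ : θ ∈ thetaEE u c) (hn : 0 < n)
    (hn0 : ¬ (n : ℕ∞) ≤ nZero c t α) (hγ : 0 < t.ω n * α / 2)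
    (hg1 : gammaTilde c n (t.ω n * α / 2) < 1) (hd : olsBound c n (t.ω n * α / 2) ≤ 1)
    {s : Fin n → Vec p × ℝ} (hs : s ∈ goodEvent c (invSqrt (momXX θ)) n (t.ω n * α / 2))
    {B κ s0 z : ℝ} (hκ : 0 < κ) (hz : 0 ≤ z) (hs0 : 0 < s0)
    (hσ : s0 ≤ ∫ z, infl u θ z ^ 2 ∂errLaw θ)
    (h4 : (n : ℝ)⁻¹ * ∑ i, ‖(s i).1‖ ^ 4 ≤ B)
    (h2 : (n : ℝ)⁻¹ * ∑ i, ‖(s i).2 • (s i).1‖ ^ 2 ≤ B)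
    (hvar : (n : ℝ)⁻¹ * ∑ i, infl u θ (s i) ^ 2 ≤ (1 + κ) * ∫ z, infl u θ z ^ 2 ∂errLaw θ)
    (ha : t.a n ≤ 1 + κ)
    (hq : gaussQuantile (1 - α / 2 + nuEdg c t α n) ≤ z)
    (hRv : 2 * ‖u‖ ^ 2 * RvarBound c n (t.ω n * α / 2) B ≤ κ * s0)
    (hRl : 2 * Rlin u c n (t.ω n * α / 2) ≤ κ * √s0)
    (hmem : target u θ ∈ ciEdg u c t α n (observe θ.1 s)) :
    |stdSum (inflLaw u θ) n (fun i => infl u θ (s i))| ≤ (1 + κ) * (1 + 2 * κ) * z + κ := by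
  rw [mem_ciEdg_iff hn0, halfWidth] at hmem
  have h1 := abs_estimation_error_sub_le hc hθ hg1 hs
  have h3 := abs_mean_sq_infl_sub_Vhat_le hc hθ hγ hn hg1 hs
  have h5 := Rvar_le_RvarBound hc hγ (isInvSqrt_momXX hθ.1) (lamReg_mul_norm_sq_le hθ) hg1 hd hs
    θ.1 h4 h2
  rw [mean_infl_eq hθ.1 hu hn] at h1
  set q := gaussQuantile (1 - α / 2 + nuEdg c t α n)
  set S := stdSum (inflLaw u θ) n (fun i => infl u θ (s i))
  set σ2 := ∫ z, infl u θ z ^ 2 ∂errLaw θ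
  have hσ0 : 0 < σ2 := hs0.trans_le hσ
  have hsn : 0 < √(n : ℝ) := Real.sqrt_pos.2 (by exact_mod_cast hn)
  have hsσ : 0 < √σ2 := Real.sqrt_pos.2 hσ0
  -- In fact `D ≤ (1 + κ)σ² + 2‖u‖² R_var ≤ (1 + 2κ)σ²`; the square merely makes the root explicit.
  have hD : enlargedVar u c t α (observe θ.1 s) ≤ (1 + 2 * κ) ^ 2 * σ2 := by
    have h6 : ‖u‖ ^ 2 * Rvar c (observe θ.1 s) (t.ω n * α / 2)
        ≤ ‖u‖ ^ 2 * RvarBound c n (t.ω n * α / 2) B := by gcongr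
    have h7 : κ * s0 ≤ κ * σ2 := by gcongr
    rw [enlargedVar]
    nlinarith [(abs_le.1 h3).1, mul_pos hκ hσ0, mul_pos (mul_pos hκ hκ) hσ0]
  have hsD : √(enlargedVar u c t α (observe θ.1 s)) ≤ (1 + 2 * κ) * √σ2 := by
    refine (Real.sqrt_le_sqrt hD).trans_eq ?_
    rw [Real.sqrt_mul (by positivity), Real.sqrt_sq (by positivity)]
  have hsa : √(t.a n) ≤ 1 + κ := by
    rw [Real.sqrt_le_left (by positivity)]; nlinarith
  have hR : 2 * Rlin u c n (t.ω n * α / 2) ≤ κ * √σ2 :=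
    hRl.trans (mul_le_mul_of_nonneg_left (Real.sqrt_le_sqrt hσ) hκ.le)
  have h8 : |S * √σ2 / √n| ≤ (√(t.a n) * q * √(enlargedVar u c t α (observe θ.1 s))
      + 2 * Rlin u c n (t.ω n * α / 2)) / √n := by
    have h9 := abs_sub_abs_le_abs_sub (S * √σ2 / √n)
      (inner ℝ u (olsBeta (observe θ.1 s)) - target u θ)
    rw [abs_sub_comm (S * √σ2 / √n)] at h9
    have e : (√(t.a n) * q * √(enlargedVar u c t α (observe θ.1 s))
      + 2 * Rlin u c n (t.ω n * α / 2)) / √n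
      = (√(t.a n) * q * √(enlargedVar u c t α (observe θ.1 s))
      + Rlin u c n (t.ω n * α / 2)) / √n + Rlin u c n (t.ω n * α / 2) / √n := by ring
    rw [e]
    linarith
  rw [abs_div, abs_mul, abs_of_pos hsσ, abs_of_pos hsn, div_le_div_iff_of_pos_right hsn] at h8
  have h10 : √(t.a n) * q * √(enlargedVar u c t α (observe θ.1 s))
      ≤ (1 + κ) * z * ((1 + 2 * κ) * √σ2) := by
    refine mul_le_mul ?_ hsD (Real.sqrt_nonneg _) (by positivity)
    exact (mul_le_mul_of_nonneg_left hq (Real.sqrt_nonneg _)).trans (by gcongr)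
  refine le_of_mul_le_mul_right (h8.trans ?_) hsσ
  linarith

theorem coverage_le_measureReal_stdSum_add (hu : u ≠ 0) (hc : c.Pos) (hlamEps : 0 < lamEps)
    (hρ : 0 ≤ ρ) (hKX : 0 < KX) (hθ : θ ∈ thetaStrict u c lamEps ρ KX) (hn : 0 < n)
    (hn0 : ¬ (n : ℕ∞) ≤ nZero c t α) (hγ : 0 < t.ω n * α / 2)
    (hg1 : gammaTilde c n (t.ω n * α / 2) < 1) (hd : olsBound c n (t.ω n * α / 2) ≤ 1)
    {B κ z : ℝ} (hB : 0 < B) (hκ : 0 < κ) (hz : 0 ≤ z)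
    (hs0 : 0 < lamEps * (‖u‖ / (2 + KX)) ^ 2) (ha : t.a n ≤ 1 + κ)
    (hq : gaussQuantile (1 - α / 2 + nuEdg c t α n) ≤ z)
    (hRv : 2 * ‖u‖ ^ 2 * RvarBound c n (t.ω n * α / 2) B
      ≤ κ * (lamEps * (‖u‖ / (2 + KX)) ^ 2))
    (hRl : 2 * Rlin u c n (t.ω n * α / 2) ≤ κ * √(lamEps * (‖u‖ / (2 + KX)) ^ 2)) :
    coverage (ciEdg u c t α) (obsLaw θ) n (target u θ)
      ≤ (Measure.pi fun _ : Fin n => errLaw θ).real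
          {s | |stdSum (inflLaw u θ) n (fun i => infl u θ (s i))|
            ≤ (1 + κ) * (1 + 2 * κ) * z + κ}
        + (t.ω n * α + (c.Kxi / (n * κ ^ 2) + ((1 + KX) / B + scoreBound c KX / B))) := by
  have hθE := hθ.1
  have b1 := measureReal_goodEvent_compl_le hc hθE hn hγ
  rw [mul_div_cancel₀ _ two_ne_zero] at b1
  have b2 := measureReal_mean_sq_infl_gt_le hu hθE hn hκ
  have b3 := measureReal_lt_average_le (P := errLaw θ) (X := fun z => ‖z.1‖ ^ 4)
    (fun z => by positivity) hθE.1.1 hB (integral_norm_pow_four_le hρ hθ) hn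
  have b4 := measureReal_lt_average_le (P := errLaw θ) (X := fun z => ‖z.2 • z.1‖ ^ 2)
    (fun z => by positivity) hθE.1.2.1 hB (integral_norm_score_sq_le hc hKX hρ hθ) hn
  rw [coverage_ciEdg]
  refine (measureReal_mono fun s hs => ?_).trans ((measureReal_union_le _ _).trans
    (add_le_add_right ((measureReal_union_le _ _).trans (add_le_add b1
      ((measureReal_union_le _ _).trans (add_le_add b2
        ((measureReal_union_le _ _).trans (add_le_add b3 b4)))))) _))
  by_contra hnot
  simp only [Set.mem_union, not_or, Set.mem_ofPred_eq, Set.mem_compl_iff, not_not, not_lt] at hnot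
  obtain ⟨g0, g1, g2, g3, g4⟩ := hnot
  exact g0 (abs_stdSum_le_of_mem_ciEdg hu hc hθE hn hn0 hγ hg1 hd g1 hκ hz hs0
    (integral_infl_sq_ge_of_strict hlamEps hKX hρ hθ) g3 g4 g2 ha hq hRv hRl hs)

theorem eventually_coverage_le (hu : u ≠ 0) (hα : α ∈ Set.Ioo (0 : ℝ) 1) (hc : c.Pos)
    (hlamEps : 0 < lamEps) (hρ : 0 ≤ ρ) (hKX : 0 < KX)
    (ha : ∀ n, 1 ≤ n → 1 < t.a n) (hω : ∀ n, 1 ≤ n → t.ω n ∈ Set.Ioo (0 : ℝ) 1)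
    (hδ : ∀ n, 1 ≤ n → ∀ θ ∈ thetaEE u c,
      min (deltaE (inflLaw u θ) n) (deltaB (inflLaw u θ) n) ≤ t.δ n)
    (hδ_lim : Tendsto t.δ atTop (𝓝 0)) (hω_lim : Tendsto t.ω atTop (𝓝 0))
    (hω_rate : Tendsto (fun n : ℕ => t.ω n * (n : ℝ) ^ (2 / 3 : ℝ)) atTop atTop)
    (ha_lim : Tendsto (fun n => t.a n - 1) atTop (𝓝 0))
    (ha_rate : Tendsto (fun n : ℕ => (t.a n - 1) * √n) atTop atTop) {e : ℝ} (he : 0 < e) :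
    ∀ᶠ n : ℕ in atTop, ∀ θ ∈ thetaStrict u c lamEps ρ KX,
      coverage (ciEdg u c t α) (obsLaw θ) n (target u θ) ≤ 1 - α + e := by
  have hα0 := hα.1
  have hα1 := hα.2
  -- A fixed `z` slightly above the normal quantile eventually dominates the moving quantile; `η ≤
  -- α/4` keeps its order below 1.
  obtain ⟨η, hη0, hη1, hη2⟩ : ∃ η, 0 < η ∧ η ≤ e / 8 ∧ η ≤ α / 4 :=
    ⟨min (e / 8) (α / 4), by positivity, min_le_left _ _, min_le_right _ _⟩
  obtain ⟨z, hz⟩ := exists_gaussCDF_eq (τ := 1 - α / 2 + η) ⟨by linarith, by linarith⟩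
  have hz0 : 0 ≤ z := (le_of_gaussCDF_lt (by rw [gaussCDF_zero, hz]; linarith)).le
  -- For `κ ≤ 1` the enlargement `(1+κ)(1+2κ)z + κ - z` is at most `κ(5z + 1)`.
  obtain ⟨κ, hκ0, hκ1, hκ2⟩ : ∃ κ : ℝ, 0 < κ ∧ κ ≤ 1 ∧ κ * (5 * z + 1) ≤ e / 16 := by
    refine ⟨min 1 (e / (16 * (5 * z + 1))), by positivity, min_le_left _ _, ?_⟩
    have h := min_le_right 1 (e / (16 * (5 * z + 1)))
    rw [le_div_iff₀ (by positivity)] at h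
    linarith
  have hu0 := norm_pos_iff.2 hu
  have hs00 : 0 < lamEps * (‖u‖ / (2 + KX)) ^ 2 := by positivity
  have hsb : 0 < scoreBound c KX := by
    have := hc.1; have := hc.2.2.1
    rw [scoreBound]; positivity
  obtain ⟨B, hB0, hB1, hB2⟩ :
      ∃ B, 0 < B ∧ (1 + KX) / B ≤ e / 16 ∧ scoreBound c KX / B ≤ e / 16 := by
    refine ⟨16 * (1 + KX + scoreBound c KX) / e, by positivity, ?_, ?_⟩ <;>
    · rw [div_le_iff₀ (by positivity)]
      field_simp
      linarith
  have hν := tendsto_nuEdg (α := α) hc ha hδ_lim hω_lim ha_lim ha_rate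
  have tRv := (tendsto_RvarBound hc hα0 hω hω_rate B).const_mul (2 * ‖u‖ ^ 2)
  have tRl := (tendsto_Rlin hc hα0 hω hω_rate u).const_mul 2
  have tω := hω_lim.mul_const α
  have tK : Tendsto (fun n : ℕ => c.Kxi / (n * κ ^ 2)) atTop (𝓝 0) :=
    (tendsto_natCast_atTop_atTop.atTop_mul_const (by positivity : 0 < κ ^ 2)).const_div_atTop _
  rw [mul_zero] at tRv tRl
  rw [zero_mul] at tω
  filter_upwards [eventually_ge_atTop 1, eventually_not_le_nZero hα0 hω hω_rate hν,
    (tendsto_gammaTilde (c := c) hα0 hω hω_rate).eventually (gt_mem_nhds one_pos),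
    (tendsto_olsBound hc hα0 hω hω_rate).eventually (gt_mem_nhds one_pos),
    tRv.eventually (gt_mem_nhds (by positivity : 0 < κ * (lamEps * (‖u‖ / (2 + KX)) ^ 2))),
    tRl.eventually (gt_mem_nhds (by positivity : 0 < κ * √(lamEps * (‖u‖ / (2 + KX)) ^ 2))),
    tω.eventually (gt_mem_nhds (by positivity : 0 < e / 16)),
    tK.eventually (gt_mem_nhds (by positivity : 0 < e / 16)),
    hδ_lim.eventually (gt_mem_nhds (by positivity : 0 < e / 16)),
    ha_lim.eventually (gt_mem_nhds hκ0),
    hν.eventually (gt_mem_nhds hη0),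
    -- This keeps the order of the quantile positive, away from its default value.
    hν.eventually (lt_mem_nhds (by linarith : -(1 - α / 2) < 0))]
    with n hn hn0 hg1 hd hRv hRl hωn hKn hδn han hν1 hν2 θ hθ
  have hθE := hθ.1
  have hω0 := (hω n hn).1
  have hγ : 0 < t.ω n * α / 2 := by positivity
  have hq : gaussQuantile (1 - α / 2 + nuEdg c t α n) ≤ z :=
    gaussQuantile_le (by linarith) (by rw [hz]; linarith)
  have hcov := coverage_le_measureReal_stdSum_add hu hc hlamEps hρ hKX hθ hn hn0 hγ hg1 hd.le hB0
    hκ0 hz0 hs00 (by linarith) hq hRv.le hRl.le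
  obtain ⟨z', hz'⟩ : ∃ z', z' = (1 + κ) * (1 + 2 * κ) * z + κ := ⟨_, rfl⟩
  rw [← hz'] at hcov
  have hz'0 : z ≤ z' := by
    have : 0 ≤ (3 * κ + 2 * κ ^ 2) * z := by positivity
    nlinarith
  have hz'1 : z' - z ≤ e / 16 := by
    have : κ ^ 2 * z ≤ κ * z := by gcongr; nlinarith
    nlinarith
  have hΦ : gaussCDF z' ≤ 1 - α / 2 + η + e / 16 := by
    have := gaussCDF_sub_le hz'0
    rw [hz] at this
    linarith
  have hP := measureReal_abs_stdSum_le_le (inflLaw u θ) (hδ n hn θ hθE) (hz0.trans hz'0)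
  rw [← measureReal_stdSum_infl] at hP
  linarith

theorem asymptoticallyExactUniformly_ciEdg (hu : u ≠ 0) (hα : α ∈ Set.Ioo (0 : ℝ) 1) (hc : c.Pos)
    (hlamEps : 0 < lamEps) (hρ : 0 ≤ ρ) (hKX : 0 < KX)
    (ha : ∀ n, 1 ≤ n → 1 < t.a n) (hω : ∀ n, 1 ≤ n → t.ω n ∈ Set.Ioo (0 : ℝ) 1)
    (hδ : ∀ n, 1 ≤ n → ∀ θ ∈ thetaEE u c,
      min (deltaE (inflLaw u θ) n) (deltaB (inflLaw u θ) n) ≤ t.δ n)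
    (hδ_lim : Tendsto t.δ atTop (𝓝 0)) (hω_lim : Tendsto t.ω atTop (𝓝 0))
    (hω_rate : Tendsto (fun n : ℕ => t.ω n * (n : ℝ) ^ (2 / 3 : ℝ)) atTop atTop)
    (ha_lim : Tendsto (fun n => t.a n - 1) atTop (𝓝 0))
    (ha_rate : Tendsto (fun n : ℕ => (t.a n - 1) * √n) atTop atTop) :
    AsymptoticallyExactUniformly (ciEdg u c t α) obsLaw (target u)
      (thetaStrict u c lamEps ρ KX) α := by
  rw [AsymptoticallyExactUniformly, ENNReal.tendsto_nhds_zero]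
  intro ε hε
  obtain ⟨e, he, heε⟩ : ∃ e : ℝ, 0 < e ∧ ENNReal.ofReal e ≤ ε := by
    obtain ⟨r, hr0, hr⟩ := ENNReal.lt_iff_exists_nnreal_btwn.1 hε
    exact ⟨r, by exact_mod_cast hr0, by rw [ENNReal.ofReal_coe_nnreal]; exact hr.le⟩
  filter_upwards [eventually_ge_atTop 1, eventually_coverage_le hu hα hc hlamEps hρ hKX ha hω hδ
    hδ_lim hω_lim hω_rate ha_lim ha_rate he] with n hn h
  refine iSup₂_le fun θ hθ => (ENNReal.ofReal_le_ofReal ?_).trans heε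
  -- The lower deviation is zero by validity; only the upper one uses the limit.
  have h1 := nonAsymptoticallyValid_ciEdg hu hα hc ha hω hδ n hn θ hθ.1
  have h2 := h θ hθ
  exact abs_le.2 ⟨by linarith, by linarith⟩

end Exactness

end NAVAE

end

theorem mainTheorem3 {p : ℕ} (u : Vec p) (hu : u ≠ 0)
    (α : ℝ) (hα : α ∈ Set.Ioo (0 : ℝ) 1)
    (c : Bounds) (hc : c.Pos)
    (lamEps ρ KX : ℝ) (hlamEps : 0 < lamEps) (hρ : 0 ≤ ρ) (hKX : 0 < KX)
    (t : Tuning)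
    (ha : ∀ n, 1 ≤ n → 1 < t.a n)
    (hω : ∀ n, 1 ≤ n → t.ω n ∈ Set.Ioo (0 : ℝ) 1)
    (hδ : ∀ n, 1 ≤ n → ∀ θ ∈ thetaEE u c,
      min (deltaE (inflLaw u θ) n) (deltaB (inflLaw u θ) n) ≤ t.δ n)
    (hδ_lim : Tendsto t.δ atTop (𝓝 0))
    (hω_lim : Tendsto t.ω atTop (𝓝 0))
    (hω_rate : Tendsto (fun n : ℕ => t.ω n * (n : ℝ) ^ (2 / 3 : ℝ)) atTop atTop)
    (ha_lim : Tendsto (fun n => t.a n - 1) atTop (𝓝 0))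
    (ha_rate : Tendsto (fun n : ℕ => (t.a n - 1) * √n) atTop atTop) :
    IsConfidenceSeq (ciEdg u c t α) (target u) (linearModel p) ∧
    NonAsymptoticallyValid (ciEdg u c t α) obsLaw (target u)
      (thetaStrict u c lamEps ρ KX) α ∧
    AsymptoticallyExactUniformly (ciEdg u c t α) obsLaw (target u)
      (thetaStrict u c lamEps ρ KX) α :=
  ⟨isConfidenceSeq_ciEdg u c t α,
    fun n hn θ hθ => nonAsymptoticallyValid_ciEdg hu hα hc ha hω hδ n hn θ hθ.1,
    asymptoticallyExactUniformly_ciEdg hu hα hc hlamEps hρ hKX ha hω hδ hδ_lim hω_lim hω_rate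
      ha_lim ha_rate⟩
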